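/- **Conventions.** Let $k,m\ge 0$, $n\ge 1$ be integers and $0<\alpha<1$. $\mathcal C^{0+\alpha}$ means locally $\alpha$-Hölder, and $\mathcal C^{1+\alpha}$ means $\mathcal C^1$ with locally $\alpha$-Hölder differential; a function on a submanifold is of such a class if it is locally the restriction of an ambient function of that class. If $M$ is a subset of a complex vector space $V=\mathbb C^d$ and $p\in M$, a *wedge with edge $M$ near $p$* is a set $$\mathcal W=\{x+w:\ x\in M,\ |x-p|<\varepsilon,\ w\in\Gamma,\ |w|<\varepsilon\},$$ where $\varepsilon>0$ and $\Gamma\subset V$ is a nonempty open cone with vertex $0$; its *edge* is $\{x\in M:|x-p|<\varepsilon\}$, and $\mathcal W$ is of *direction* $v$ if $v\in\Gamma$. A function $u$ on $M$ *extends holomorphically to $\mathcal W$* if there is $F\in\mathcal O(\mathcal W)$ with $\lim_{\mathcal W\ni z\to x}F(z)=u(x)$ for every $x$ in the edge; we then write $F|_M=u$. For $j\in\{0,1\}$, a $\mathcal C^{j+\alpha}$ function or map $u$ on a $\mathcal C^{1+\alpha}$ submanifold $M$ is *decomposable at $p$* if, near $p$ on $M$, $u=\sum_{i=1}^K U_i$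 where the $U_i$ are of class $\mathcal C^{j+\alpha}$ on $M$ and each $U_i$ extends holomorphically to some wedge $\mathcal W_i\subset V$ with edge $M$ near $p$ (the $U_i$, hence $u$, are then CR near $p$). A vector $v\in V$ is *complex transversal* to $N$ at $p$ if $v\notin\operatorname{span}_{\mathbb C}T_pN$. **Theorem.** Let $\mathfrak N\subset\mathbb C^{k+m}$ be a generic submanifold of class $\mathcal C^{1+\alpha}$ and real codimension $m$ (so of CR dimension $k$), let $h:\mathfrak N\to\mathbb C^n$ be a CR map of class $\mathcal C^{1+\alpha}$, and let $$N=\{(x,h(x)):x\in\mathfrak N\}\subset\mathbb C^{k+m}\times\mathbb C^n=\mathbb C^{k+m+n}.$$ Let $p_0'\in\mathfrak N$, suppose that $h$ is decomposable (in the class $\mathcal C^{1+\alpha}$) at $p_0'$, and let $v\in\mathbb C^{k+m+n}$ be complex transversal to $N$ at $p_0=(p_0',h(p_0'))$. Let $f$ be a $\mathcal C^{0+\alpha}$ function on $N$ which is decomposable at $p_0$, that is, $x\mapsto f(x,h(x))$ is decomposable (in the class $\mathcal C^{0+\alpha}$) at $p_0'$ on $\mathfrak N$. Then there is a wedge $\mathcal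 W\subset\mathbb C^{k+m+n}$ of direction $v$ with edge a neighbourhood of $p_0$ in $N$ such that: 1. there is $F\in\mathcal O(\mathcal W)$, continuous up to the edge, with $F|_N=f$ on the edge; 2. there are $F_1,\dots,F_n\in\mathcal O(\mathcal W)$ with $dF_1\wedge\dots\wedge dF_n\neq0$ at every point of $\mathcal W$, each of which vanishes to order one on the edge: $F_\ell$ is $\mathcal C^1$ up to the edge, vanishes there, and has nonzero differential there. Precisely, for each $x$ in the edge there is a nonzero $\mathbb C$-linear form $\lambda$ with $F_\ell(z)=\lambda(z-x)+o(|z-x|)$ and $dF_\ell(z)\to\lambda$ as $\mathcal W\ni z\to x$. -/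

import Mathlib

open Set Metric Filter Topology
open scoped NNReal Pointwise

/-- The complex Euclidean space `ℂ^d`. -/
abbrev CSpace (d : ℕ) : Type := EuclideanSpace ℂ (Fin d)

section Regularity

variable {E G : Type*} [NormedAddCommGroup E] [NormedSpace ℝ E]
  [NormedAddCommGroup G] [NormedSpace ℝ G]

/-- `g` is of class `C^{j+α}` on the open set `U`: it is `C^j` there (in the real sense) and its
`j`-th derivative is locally `α`-Hölder. -/
def IsHolderClass (j : ℕ) (α : ℝ≥0) (g : E → G) (U : Set E) : Prop :=
  ContDiffOn ℝ j g U ∧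
    ∀ x ∈ U, ∃ V ∈ 𝓝 x, ∃ C : ℝ≥0, HolderOnWith C α (iteratedFDeriv ℝ j g) V

/-- `u` is of class `C^{j+α}` on the subset `M` (in practice a submanifold): locally, `u` is the
restriction to `M` of a `C^{j+α}` function on an open subset of the ambient space.
Only the values of `u` on `M` matter. -/
def IsHolderClassOn (j : ℕ) (α : ℝ≥0) (u : E → G) (M : Set E) : Prop :=
  ∀ p ∈ M, ∃ U : Set E, IsOpen U ∧ p ∈ U ∧ ∃ g : E → G, IsHolderClass j α g U ∧ EqOn g u (M ∩ U)

/-- The tangent vectors to `M` at `p`: the velocities at time `0` of curves in `M` through `p`. -/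
def tangentVectors (M : Set E) (p : E) : Set E :=
  {w | ∃ γ : ℝ → E, γ 0 = p ∧ (∀ᶠ t in 𝓝 (0 : ℝ), γ t ∈ M) ∧ HasDerivAt γ w 0}

/-- `M` is an embedded (not necessarily closed) `C^{1+α}` submanifold of real codimension `m`. -/
def IsSubmanifold (α : ℝ≥0) (m : ℕ) (M : Set E) : Prop :=
  ∀ p ∈ M, ∃ U : Set E, IsOpen U ∧ p ∈ U ∧ ∃ ρ : E → EuclideanSpace ℝ (Fin m),
    IsHolderClass 1 α ρ U ∧ (∀ z ∈ U, Function.Surjective (fderiv ℝ ρ z)) ∧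
      M ∩ U = {z ∈ U | ρ z = 0}

/-- `Γ` is an open cone with vertex `0`. -/
def IsOpenCone (Γ : Set E) : Prop :=
  IsOpen Γ ∧ ∀ w ∈ Γ, ∀ t : ℝ, 0 < t → t • w ∈ Γ

/-- The (truncated) wedge near `p` with edge `M ∩ ball p ε` and cone of directions `Γ`:
the set of the points `x + w` with `x ∈ M`, `‖x - p‖ < ε`, `w ∈ Γ`, `‖w‖ < ε`. -/
def wedge (M : Set E) (p : E) (Γ : Set E) (ε : ℝ) : Set E :=
  (M ∩ ball p ε) + (Γ ∩ ball 0 ε)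

end Regularity

section CR

variable {E G : Type*} [NormedAddCommGroup E] [NormedSpace ℂ E]
  [NormedAddCommGroup G] [NormedSpace ℂ G]

/-- The complex span of the tangent space to `M` at `p`. -/
def complexTangentSpan (M : Set E) (p : E) : Submodule ℂ E :=
  Submodule.span ℂ (tangentVectors M p)

/-- `M` is generic: at each point the tangent space spans the ambient space over `ℂ`. -/
def IsGeneric (M : Set E) : Prop :=
  ∀ p ∈ M, complexTangentSpan M p = ⊤

/-- `v` is complex transversal to `M` at `p`. -/
def IsComplexTransversal (v : E) (M : Set E) (p : E) : Prop :=
  v ∉ complexTangentSpan M p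

/-- A (differentiable) map `h` is CR on `M`: at each point of `M` its differential along `M` is
complex linear on the complex tangent space `T_pM ∩ i T_pM`, which says that `h` is
annihilated by the vectors of type `(0,1)` tangent to `M`. -/
def IsCRMap (h : E → G) (M : Set E) : Prop :=
  ∀ p ∈ M, ∃ h' : E →L[ℝ] G, HasFDerivWithinAt h h' M p ∧
    ∀ w ∈ tangentVectors M p, Complex.I • w ∈ tangentVectors M p →
      h' (Complex.I • w) = Complex.I • h' w

/-- `F` is holomorphic on the wedge with edge `M ∩ ball p ε` and directions `Γ`, and extends
continuously to the edge with the values of `u` there. -/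
def ExtendsToWedge (F u : E → G) (M : Set E) (p : E) (Γ : Set E) (ε : ℝ) : Prop :=
  DifferentiableOn ℂ F (wedge M p Γ ε) ∧
    ∀ x ∈ M ∩ ball p ε, Tendsto F (𝓝[wedge M p Γ ε] x) (𝓝 (u x))

/-- `u` is decomposable at `p` on `M` in the class `C^{j+α}`: near `p` it is a finite sum of
`C^{j+α}` functions `U i` on `M`, each of which extends holomorphically, and continuously up to
the edge, to some wedge with edge `M` near `p`. Such `U i` are automatically CR near `p`. -/
def IsDecomposableAt (j : ℕ) (α : ℝ≥0) (u : E → G) (M : Set E) (p : E) : Prop :=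
  ∃ ε : ℝ, 0 < ε ∧ ∃ (K : ℕ) (U : Fin K → E → G),
    (∀ x ∈ M ∩ ball p ε, u x = ∑ i, U i x) ∧
    ∀ i, IsHolderClassOn j α (U i) (M ∩ ball p ε) ∧
      ∃ Γ : Set E, IsOpenCone Γ ∧ Γ.Nonempty ∧
        ∃ F : E → G, ExtendsToWedge F (U i) M p Γ ε

/-- `F`, holomorphic on `W`, vanishes to order (exactly) one along the subset `S` of the boundary
of `W`: it is `C^1` up to `S`, vanishes on `S`, and its differential is nonzero on `S`. -/
def VanishesToOrderOne (F : E → ℂ) (W S : Set E) : Prop :=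
  ∀ x ∈ S, ∃ l : E →L[ℂ] ℂ, l ≠ 0 ∧
    (fun z => F z - l (z - x)) =o[𝓝[W] x] (fun z => z - x) ∧
    Tendsto (fderiv ℂ F) (𝓝[W] x) (𝓝 l)

end CR

/-- The graph of `h` over `M`. -/
def graphOver {E G : Type*} (h : E → G) (M : Set E) : Set (E × G) :=
  {q | q.1 ∈ M ∧ q.2 = h q.1}

/-!
If `h` had a holomorphic extension `H`, the components of `w - H z` would be `n` holomorphic
functions cutting out the graph. In general only the summands of `h` extend, each to a wedge of its
own, and these wedges may have no direction in common. The transversal variable is used to move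
into all of them at once: if `D` stands for the defect `w - H z` sought for and `μ` is a linear form
with `μ D` close to a positive number, then `z + μ D • a i` lies in the `i`-th wedge for a proper
choice of the vector `a i`. This leads to the change of variables

  `(z, D) ↦ (z, D + ∑ i, F i (z + μ D • a i) - μ D • a₀)`,

where `F i` are the extensions of the summands of `h`. It is holomorphic on a wedge with edge
`M × {0}`, takes that edge to the graph of `h` and, for a suitable constant `a₀`, has at the
reference point a differential taking the direction of that wedge to the given direction `v`. Its
inverse is defined on a wedge of direction `v` whose edge is the graph. The components of `D`, as
functions of `(z, w)`, vanish to order one on the graph, and `f` is extended by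
`∑ i, F' i (z + μ D • a' i)`, with `F' i` the extensions of the summands of `f`. Below, `D` is
written as `w - l z`, with `l` the differential of `h` at the reference point, so that the
change of variables is tangent to the identity there. Complex transversality of `v` says that
`v.2 ≠ l v.1` (`mem_complexTangentSpan_graphOver`), so that some linear form `μ` is equal to one
at `v.2 - l v.1`. The construction is carried out in `exists_inverse_on_wedge_graphOver`.

The inversion (`exists_inverse_on_roundWedge`) needs the change of variables to be `C^1` up to the
edge, with expansions uniform in the points of the edge (`IsC1AtEdge`). Given that, on a thin wedge
the map is close to the identity on pairs of points (`IsC1AtEdge.exists_approx`), hence injective,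
and the contraction argument for surjectivity is run on balls of radius comparable to the height
above the edge.

The analytic core is therefore `IsSubmanifold.exists_isC1AtEdge`: a holomorphic function `F` on a
wedge, continuous up to the edge with boundary values `u` of class `C^{1+α}`, is `C^1` up to the
edge on smaller cones of directions. It is proved with affine discs only, without solving Bishop's
equation. Through a point `x + w` at height `s` passes a half disc whose diameter is at a much
smaller height `θ` (`IsEdgeModel.exists_disc`). On the scale `s` the edge deviates from its tangent
space at `x` by `O (s ^ (1 + α))`, so that a height `θ` of this order keeps the disc in the wedge.
The two-constants inequality on the half disc (`norm_le_of_halfDisc`) bounds the difference of `F`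
and a function affine along the disc by its size on the diameter, where it is governed by `u`, up to
the rate at which `F` approaches `u`. A first rate comes from a maximum principle argument for
`‖F (x + w) - u x‖` with a penalty (`EdgeSetting.hasEdgeRate_quarter`); the discs then improve it to
almost the Lipschitz rate (`EdgeSetting.hasEdgeRate`). Comparison with the first-order expansion of
`u` gives an expansion of `F` with a remainder `O (s ^ (1 + α / 4))`
(`EdgeSetting.exists_norm_sub_jet_le`), whose linear part is complex linear
(`EdgeSetting.exists_jet_compatible`), and Cauchy's estimate controls the differential of `F`.
-/

/-! ### The two-constants inequality on a half disc -/

/-- Two-constants inequality on a half disc: the exponential factor is the modulus of a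
non-vanishing holomorphic function that is at most one on the diameter and absorbs the larger
bound `t` on the half circle. -/
theorem norm_le_of_halfDisc {G : Type*} [NormedAddCommGroup G] [NormedSpace ℂ G]
    {F : ℂ → G} {O : Set ℂ} {R b t : ℝ} (hF : DifferentiableOn ℂ F O)
    (hR : 1 < R) (hsub : ∀ ζ : ℂ, ‖ζ‖ ≤ R → 0 ≤ ζ.im → ζ ∈ O) (hb : 0 < b) (hbt : b ≤ t)
    (hbot : ∀ ζ : ℂ, ‖ζ‖ ≤ R → ζ.im = 0 → ‖F ζ‖ ≤ b)
    (htop : ∀ ζ : ℂ, ‖ζ‖ ≤ R → 0 ≤ ζ.im → ‖F ζ‖ ≤ t) :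
    ‖F Complex.I‖ ≤ b * (t / b) ^ (3 / R) := by
  have hR0 : 0 < R := by linarith
  set κ : ℝ := Real.log (t / b) with hκ
  have htb : 1 ≤ t / b := (one_le_div hb).2 hbt
  have hκ0 : 0 ≤ κ := Real.log_nonneg htb
  set e : ℂ → ℂ := fun ζ => Complex.exp (-(κ / R ^ 2 : ℝ) * (ζ ^ 2 - 3 * Complex.I * R * ζ)) with he
  have hnorm : ∀ ζ : ℂ, ‖e ζ‖ =
      Real.exp (-(κ / R ^ 2) * (ζ.re ^ 2 - ζ.im ^ 2 + 3 * R * ζ.im)) := by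
    intro ζ
    rw [he, Complex.norm_exp]
    congr 1
    rw [show (-((κ / R ^ 2 : ℝ) : ℂ)) = ((-(κ / R ^ 2) : ℝ) : ℂ) by push_cast; ring,
      Complex.re_ofReal_mul]
    congr 1
    simp [pow_two]
  have hκR : 0 ≤ κ / R ^ 2 := by positivity
  set U : Set ℂ := ball 0 R ∩ {ζ | 0 < ζ.im} with hU
  have hUo : IsOpen U := isOpen_ball.inter (isOpen_lt continuous_const Complex.continuous_im)
  have hUcl : closure U ⊆ {ζ | ‖ζ‖ ≤ R ∧ 0 ≤ ζ.im} := by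
    refine closure_minimal (fun ζ hζ => ⟨?_, le_of_lt hζ.2⟩) ?_
    · have := hζ.1
      rw [mem_ball_zero_iff] at this
      exact this.le
    · exact (isClosed_le continuous_norm continuous_const).inter
        (isClosed_le continuous_const Complex.continuous_im)
  have hUO : closure U ⊆ O := fun ζ hζ => hsub ζ (hUcl hζ).1 (hUcl hζ).2
  have hG : DifferentiableOn ℂ (fun ζ => e ζ • F ζ) O := by
    refine DifferentiableOn.smul ?_ hF
    apply Differentiable.differentiableOn
    rw [he]
    fun_prop
  have key : ‖e Complex.I • F Complex.I‖ ≤ b := by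
    refine Complex.norm_le_of_forall_mem_frontier_norm_le (U := U)
      (f := fun ζ => e ζ • F ζ) (isBounded_ball.subset inter_subset_left)
      (hG.mono hUO).diffContOnCl ?_ (subset_closure ⟨?_, ?_⟩)
    · intro ζ hζ
      have h1 := hUcl hζ.1
      have h2 : ζ ∉ U := by
        have := hζ.2
        rwa [hUo.interior_eq] at this
      have hsq : ‖ζ‖ ^ 2 = ζ.re ^ 2 + ζ.im ^ 2 := by
        rw [Complex.sq_norm, Complex.normSq_apply]; ring
      have himle : ζ.im ≤ R := (le_abs_self _).trans ((Complex.abs_im_le_norm ζ).trans h1.1)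
      rw [norm_smul, hnorm]
      rcases h1.2.eq_or_lt with h0 | h0
      · have hle : Real.exp (-(κ / R ^ 2) * (ζ.re ^ 2 - ζ.im ^ 2 + 3 * R * ζ.im)) ≤ 1 := by
          rw [Real.exp_le_one_iff, ← h0]
          have : 0 ≤ (κ / R ^ 2) * ζ.re ^ 2 := by positivity
          nlinarith
        calc _ ≤ 1 * b := mul_le_mul hle (hbot ζ h1.1 h0.symm) (norm_nonneg _) zero_le_one
          _ = b := one_mul b
      · have hn : ‖ζ‖ = R := by
          refine le_antisymm h1.1 (not_lt.1 fun hlt => h2 ⟨?_, h0⟩)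
          rwa [mem_ball_zero_iff]
        rw [hn] at hsq
        have hle : Real.exp (-(κ / R ^ 2) * (ζ.re ^ 2 - ζ.im ^ 2 + 3 * R * ζ.im)) ≤ b / t := by
          have h3 : R ^ 2 ≤ ζ.re ^ 2 - ζ.im ^ 2 + 3 * R * ζ.im := by nlinarith
          have h4 : κ ≤ (κ / R ^ 2) * (ζ.re ^ 2 - ζ.im ^ 2 + 3 * R * ζ.im) := by
            calc κ = (κ / R ^ 2) * R ^ 2 := by field_simp
              _ ≤ _ := mul_le_mul_of_nonneg_left h3 hκR
          calc _ ≤ Real.exp (-κ) := Real.exp_le_exp.2 (by linarith)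
            _ = b / t := by
              rw [Real.exp_neg, hκ, Real.exp_log (by linarith), inv_div]
        calc _ ≤ b / t * t := mul_le_mul hle (htop ζ h1.1 h1.2) (norm_nonneg _)
              (by have := hb.trans_le hbt; positivity)
          _ = b := div_mul_cancel₀ _ (hb.trans_le hbt).ne'
    · rw [mem_ball_zero_iff]; simpa using hR
    · simp
  rw [norm_smul, hnorm] at key
  simp only [Complex.I_re, Complex.I_im] at key
  have h5 : (t / b) ^ (3 / R) = Real.exp (κ * (3 / R)) := by
    rw [Real.rpow_def_of_pos (by linarith)]
  have h6 : Real.exp (-(κ / R ^ 2) * (0 ^ 2 - 1 ^ 2 + 3 * R * 1)) * Real.exp (κ * (3 / R)) ≥ 1 := by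
    rw [← Real.exp_add]
    apply Real.one_le_exp
    have : -(κ / R ^ 2) * (0 ^ 2 - 1 ^ 2 + 3 * R * 1) + κ * (3 / R) = κ / R ^ 2 := by
      field_simp
      ring
    rw [this]
    exact hκR
  rw [h5]
  calc ‖F Complex.I‖ ≤ (Real.exp (-(κ / R ^ 2) * (0 ^ 2 - 1 ^ 2 + 3 * R * 1)) *
        Real.exp (κ * (3 / R))) * ‖F Complex.I‖ := le_mul_of_one_le_left (norm_nonneg _) h6
    _ = (Real.exp (-(κ / R ^ 2) * (0 ^ 2 - 1 ^ 2 + 3 * R * 1)) * ‖F Complex.I‖) *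
        Real.exp (κ * (3 / R)) := by ring
    _ ≤ _ := mul_le_mul_of_nonneg_right key (Real.exp_pos _).le

/-- The additive form of the bound in the two-constants inequality. -/
theorem mul_div_rpow_le_add {b t l : ℝ} (hb : 0 < b) (ht : 0 < t) (hl : 0 ≤ l) (hl1 : l ≤ 1) :
    b * (t / b) ^ l ≤ b + l * t := by
  have hy := Real.geom_mean_le_arith_mean2_weighted (sub_nonneg.2 hl1) hl hb.le ht.le
    (sub_add_cancel 1 l)
  have heq : b * (t / b) ^ l = b ^ (1 - l) * t ^ l := by
    rw [Real.div_rpow ht.le hb.le, Real.rpow_sub hb, Real.rpow_one]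
    field_simp
  rw [heq]
  have : 0 ≤ l * b := by positivity
  nlinarith

/-! ### Submanifolds and functions of Hölder class near a point -/

/-- A function of class `C^{1+α}` has a first-order Taylor expansion with a remainder of order
`1 + α`, with the same constant at all points near `p`. -/
theorem IsHolderClass.exists_taylor {E G : Type*} [NormedAddCommGroup E] [NormedSpace ℝ E]
    [NormedAddCommGroup G] [NormedSpace ℝ G] {α : ℝ≥0} {g : E → G} {U : Set E}
    (hg : IsHolderClass 1 α g U) (hU : IsOpen U) {p : E} (hp : p ∈ U) :
    ∃ C : ℝ, 1 ≤ C ∧ ∃ r > 0, ball p r ⊆ U ∧ DifferentiableOn ℝ g (ball p r) ∧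
      (∀ x ∈ ball p r, ‖fderiv ℝ g x‖ ≤ C) ∧
      (∀ x ∈ ball p r, ∀ y ∈ ball p r,
        ‖fderiv ℝ g x - fderiv ℝ g y‖ ≤ C * ‖x - y‖ ^ (α : ℝ)) ∧
      ∀ x ∈ ball p r, ∀ y ∈ ball p r,
        ‖g y - g x - fderiv ℝ g x (y - x)‖ ≤ C * ‖y - x‖ ^ (1 + α : ℝ) := by
  obtain ⟨hd, hh⟩ := hg
  obtain ⟨V, hV, C0, hC0⟩ := hh p hp
  obtain ⟨r0, hr0, hr0V⟩ := Metric.mem_nhds_iff.1 (Filter.inter_mem hV (hU.mem_nhds hp))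
  set r := min r0 1 with hr
  have hrpos : 0 < r := lt_min hr0 one_pos
  have hrV : ball p r ⊆ V ∩ U := (ball_subset_ball (min_le_left _ _)).trans hr0V
  have hdiff : ∀ x ∈ U, DifferentiableAt ℝ g x := fun x hx =>
    (hd.differentiableOn (by simp)).differentiableAt (hU.mem_nhds hx)
  have hhol : ∀ x ∈ ball p r, ∀ y ∈ ball p r,
      ‖fderiv ℝ g x - fderiv ℝ g y‖ ≤ C0 * ‖x - y‖ ^ (α : ℝ) := by
    intro x hx y hy
    refine ContinuousLinearMap.opNorm_le_bound _ (by positivity) fun w => ?_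
    have h1 := hC0.dist_le (hrV hx).1 (hrV hy).1
    rw [dist_eq_norm, dist_eq_norm] at h1
    have h2 := (iteratedFDeriv ℝ 1 g x - iteratedFDeriv ℝ 1 g y).le_opNorm (fun _ => w)
    simp only [sub_apply, iteratedFDeriv_one_apply, Finset.univ_unique,
      Finset.prod_const, Finset.card_singleton, pow_one] at h2
    exact h2.trans (mul_le_mul_of_nonneg_right h1 (norm_nonneg _))
  set C : ℝ := C0 + ‖fderiv ℝ g p‖ + 1 with hC
  have hCC : (C0 : ℝ) ≤ C := by have := norm_nonneg (fderiv ℝ g p); linarith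
  have hC1 : 1 ≤ C := by have := norm_nonneg (fderiv ℝ g p); linarith [C0.coe_nonneg]
  refine ⟨C, hC1, r, hrpos,
    fun x hx => (hrV hx).2, fun x hx => (hdiff x (hrV hx).2).differentiableWithinAt, ?_, ?_, ?_⟩
  · intro x hx
    have h1 := hhol x hx p (mem_ball_self hrpos)
    have h2 : ‖x - p‖ ^ (α : ℝ) ≤ 1 := by
      apply Real.rpow_le_one (norm_nonneg _) _ α.2
      rw [mem_ball, dist_eq_norm] at hx
      exact hx.le.trans (min_le_right _ _)
    have h3 := norm_le_norm_add_norm_sub' (fderiv ℝ g x) (fderiv ℝ g p)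
    have h4 : (C0 : ℝ) * ‖x - p‖ ^ (α : ℝ) ≤ C0 * 1 := mul_le_mul_of_nonneg_left h2 C0.2
    simp only [hC]; linarith
  · intro x hx y hy
    exact (hhol x hx y hy).trans (mul_le_mul_of_nonneg_right hCC (by positivity))
  · intro x hx y hy
    have hseg : segment ℝ x y ⊆ ball p r := (convex_ball p r).segment_subset hx hy
    have h1 := (convex_segment (𝕜 := ℝ) x y).norm_image_sub_le_of_norm_fderiv_le'
      (f := g) (φ := fderiv ℝ g x) (C := C * ‖y - x‖ ^ (α : ℝ))
      (fun z hz => hdiff z (hrV (hseg hz)).2) ?_ (left_mem_segment ℝ x y)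
      (right_mem_segment ℝ x y)
    · refine h1.trans_eq ?_
      rcases eq_or_ne (‖y - x‖) 0 with h0 | h0
      · rw [h0, Real.zero_rpow (add_pos_of_pos_of_nonneg one_pos α.coe_nonneg).ne']; simp
      · rw [Real.rpow_add (lt_of_le_of_ne (norm_nonneg _) h0.symm), Real.rpow_one]; ring
    · intro z hz
      refine (hhol z (hseg hz) x hx).trans ?_
      have : ‖z - x‖ ≤ ‖y - x‖ := norm_sub_le_of_mem_segment hz
      gcongr

/-- Operators close to a surjective one are surjective, with uniform bounds on preimages. -/
theorem ContinuousLinearMap.exists_uniform_preimage {E W : Type*} [NormedAddCommGroup E]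
    [NormedSpace ℝ E] [CompleteSpace E] [NormedAddCommGroup W] [NormedSpace ℝ W] [CompleteSpace W]
    (f₀ : E →L[ℝ] W) (hf₀ : Function.Surjective f₀) :
    ∃ K : ℝ, 1 ≤ K ∧ ∃ δ > 0, ∀ f : E →L[ℝ] W, ‖f - f₀‖ ≤ δ →
      ∀ y, ∃ x, f x = y ∧ ‖x‖ ≤ K * ‖y‖ := by
  set S := f₀.nonlinearRightInverseOfSurjective (LinearMap.range_eq_top.2 hf₀)
  have hS : 0 < S.nnnorm := f₀.nonlinearRightInverseOfSurjective_nnnorm_pos _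
  have hS' : (0 : ℝ) < S.nnnorm := hS
  refine ⟨max 1 (2 * S.nnnorm), le_max_left _ _, (2 * S.nnnorm : ℝ)⁻¹, by positivity,
    fun f hf y => ?_⟩
  have happ : ApproximatesLinearOn f f₀ univ (2 * S.nnnorm)⁻¹ := by
    intro x _ x' _
    rw [← map_sub, ← sub_apply]
    refine ((f - f₀).le_opNorm _).trans (mul_le_mul_of_nonneg_right ?_ (norm_nonneg _))
    simpa using hf
  have := happ.surjOn_closedBall_of_nonlinearRightInverse S (ε := 2 * S.nnnorm * ‖y‖) (b := 0)
    (by positivity) (subset_univ _)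
  obtain ⟨x, hx, hxy⟩ := this (a := y) (by
    rw [map_zero, mem_closedBall_zero_iff]
    apply le_of_eq
    push_cast
    field_simp
    ring)
  refine ⟨x, hxy, ?_⟩
  rw [mem_closedBall_zero_iff] at hx
  exact hx.trans (mul_le_mul_of_nonneg_right (le_max_right _ _) (norm_nonneg _))


/-- The complex span of the tangent space at a generic point is everything, hence every vector is
of the form `κ₁ + i κ₂` with `κ₁`, `κ₂` in the kernel of the differential of a defining map. -/
theorem exists_ker_add_I_smul_ker {V W : Type*} [NormedAddCommGroup V] [NormedSpace ℂ V]
    [NormedAddCommGroup W] [NormedSpace ℝ W] {M U : Set V} {ρ : V → W} {p : V}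
    (hU : IsOpen U) (hpU : p ∈ U) (hρ : DifferentiableAt ℝ ρ p) (hM : M ∩ U = {z ∈ U | ρ z = 0})
    (hgen : complexTangentSpan M p = ⊤) (z : V) :
    ∃ κ₁ κ₂ : V, fderiv ℝ ρ p κ₁ = 0 ∧ fderiv ℝ ρ p κ₂ = 0 ∧ z = κ₁ + Complex.I • κ₂ := by
  have htan : ∀ w ∈ tangentVectors M p, fderiv ℝ ρ p w = 0 := by
    rintro w ⟨γ, hγ0, hγM, hγ⟩
    have h1 : HasDerivAt (ρ ∘ γ) (fderiv ℝ ρ p w) 0 := by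
      have h2 : HasFDerivAt ρ (fderiv ℝ ρ p) (γ 0) := by rw [hγ0]; exact hρ.hasFDerivAt
      exact h2.comp_hasDerivAt 0 hγ
    have h3 : ∀ᶠ t in 𝓝 (0 : ℝ), (ρ ∘ γ) t = 0 := by
      have h4 : ∀ᶠ t in 𝓝 (0 : ℝ), γ t ∈ U :=
        hγ.continuousAt.eventually_mem (by rw [hγ0]; exact hU.mem_nhds hpU)
      filter_upwards [hγM, h4] with t ht htU
      have : γ t ∈ M ∩ U := ⟨ht, htU⟩
      rw [hM] at this
      exact this.2
    have h5 : HasDerivAt (ρ ∘ γ) 0 0 :=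
      (hasDerivAt_const (0 : ℝ) (0 : W)).congr_of_eventuallyEq h3
    exact h1.unique h5
  have hz : z ∈ Submodule.span ℂ (tangentVectors M p) := by
    change z ∈ complexTangentSpan M p
    rw [hgen]; trivial
  induction hz using Submodule.span_induction with
  | mem x hx => exact ⟨x, 0, htan x hx, map_zero _, by simp⟩
  | zero => exact ⟨0, 0, map_zero _, map_zero _, by simp⟩
  | add x y _ _ hx hy =>
    obtain ⟨a, b, ha, hb, rfl⟩ := hx
    obtain ⟨c, d, hc, hd, rfl⟩ := hy
    exact ⟨a + c, b + d, by rw [map_add, ha, hc, add_zero], by rw [map_add, hb, hd, add_zero],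
      by rw [smul_add]; abel⟩
  | smul s x _ hx =>
    obtain ⟨a, b, ha, hb, rfl⟩ := hx
    refine ⟨s.re • a - s.im • b, s.im • a + s.re • b, ?_, ?_, ?_⟩
    · rw [map_sub, map_smul, map_smul, ha, hb]; simp
    · rw [map_add, map_smul, map_smul, ha, hb]; simp
    · conv_lhs => rw [← Complex.re_add_im s]
      have h1 : ∀ (r : ℝ) (v : V), r • v = (r : ℂ) • v := fun r v => (Complex.coe_smul r v).symm
      simp only [h1]
      have h2 : (s.im : ℂ) • b = -((Complex.I * Complex.I * s.im) • b) := by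
        rw [Complex.I_mul_I, neg_one_mul, neg_smul, neg_neg]
      rw [h2]
      module

/-- The first-order data of a generic `C^{1+α}` submanifold `M` near `p` used below: real subspaces
`T x` (the tangent spaces), which with `i T x` span the ambient space with uniform bounds, and
which approximate `M` to order `1 + α`, uniformly in the base point. -/
structure IsEdgeModel {V : Type*} [NormedAddCommGroup V] [NormedSpace ℂ V]
    (α C r : ℝ) (M : Set V) (T : V → Submodule ℝ V) (p : V) : Prop where
  decomp : ∀ x ∈ M ∩ ball p r, ∀ w, ∃ τ₁ ∈ T x, ∃ τ₂ ∈ T x,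
    w = τ₁ + Complex.I • τ₂ ∧ ‖τ₁‖ ≤ C * ‖w‖ ∧ ‖τ₂‖ ≤ C * ‖w‖
  near : ∀ x ∈ M ∩ ball p r, ∀ τ ∈ T x, ‖τ‖ ≤ r → ∃ y ∈ M, ‖y - (x + τ)‖ ≤ C * ‖τ‖ ^ (1 + α)
  closed : IsClosed (M ∩ closedBall p r)
  secant : ∀ η > 0, ∃ δ > 0, ∀ x ∈ M ∩ ball p δ, ∀ y ∈ M ∩ ball p δ,
    ∃ τ ∈ T p, ‖y - x - τ‖ ≤ η * ‖y - x‖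

theorem IsSubmanifold.exists_isEdgeModel {V : Type*} [NormedAddCommGroup V] [NormedSpace ℂ V]
    [CompleteSpace V] {α : ℝ≥0} (hα : 0 < α) {m : ℕ} {M : Set V} (hM : IsSubmanifold α m M) {p : V}
    (hp : p ∈ M) (hgen : complexTangentSpan M p = ⊤) :
    ∃ C : ℝ, 1 ≤ C ∧ ∃ r > 0, ∃ T, IsEdgeModel α C r M T p := by
  obtain ⟨U, hU, hpU, ρ, hρ, hsurj, hMU⟩ := hM p hp
  obtain ⟨C, hC, r, hr, hrU, hdiff, hbd, hhol, htay⟩ := hρ.exists_taylor hU hpU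
  have hα' : (0 : ℝ) < α := hα
  have hdp : DifferentiableAt ℝ ρ p := hdiff.differentiableAt (ball_mem_nhds p hr)
  set A := fderiv ℝ ρ with hA
  obtain ⟨K₁, hK₁, δ₁, hδ₁, hA₁⟩ := (A p).exists_uniform_preimage (hsurj p hpU)
  have zero_of_mem : ∀ x ∈ M, x ∈ ball p r → ρ x = 0 := fun x hx hxr => by
    have : x ∈ M ∩ U := ⟨hx, hrU hxr⟩
    rw [hMU] at this
    exact this.2
  have mem_of_zero : ∀ x ∈ ball p r, ρ x = 0 → x ∈ M := fun x hxr hx => by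
    have : x ∈ {z ∈ U | ρ z = 0} := ⟨hrU hxr, hx⟩
    rw [← hMU] at this
    exact this.1
  let J : V →L[ℝ] V := (Complex.I • ContinuousLinearMap.id ℝ V)
  have hJ : ∀ v, J v = Complex.I • v := fun v => rfl
  let B : V → V →L[ℝ] _ := fun x => (A x).prod ((A x).comp J)
  have hBsurj : Function.Surjective (B p) := by
    rintro ⟨s, t⟩
    obtain ⟨z₁, hz₁⟩ := hsurj p hpU s
    obtain ⟨z₃, hz₃⟩ := hsurj p hpU (t - A p (J z₁))
    obtain ⟨κ₁, κ₂, h1, h2, h3⟩ := exists_ker_add_I_smul_ker hU hpU hdp hMU hgen z₃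
    refine ⟨z₁ + κ₂, ?_⟩
    change (A p (z₁ + κ₂), A p (J (z₁ + κ₂))) = (s, t)
    rw [map_add, map_add, map_add, hJ κ₂]
    have h4 : A p (Complex.I • κ₂) = t - A p (J z₁) := by
      rw [← hz₃, h3, map_add, h1, zero_add]
    rw [h4, h2, hz₁]
    simp
  obtain ⟨K₂, hK₂, δ₂, hδ₂, hB₂⟩ := (B p).exists_uniform_preimage hBsurj
  -- a radius on which the differential of the defining map is nearly constant
  have hsmall : ∀ η > 0, ∃ s > 0, s ≤ r ∧ C * s ^ (α : ℝ) ≤ η := by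
    intro η hη
    have h1 : Tendsto (fun s : ℝ => C * s ^ (α : ℝ)) (𝓝[>] 0) (𝓝 (C * (0 : ℝ) ^ (α : ℝ))) :=
      (((Real.continuous_rpow_const hα'.le).tendsto 0).const_mul C).mono_left
        nhdsWithin_le_nhds
    rw [Real.zero_rpow hα'.ne', mul_zero] at h1
    have h2 := (h1.eventually (gt_mem_nhds hη)).and
      (Ioo_mem_nhdsGT hr)
    obtain ⟨s, hs1, hs2⟩ := h2.exists
    exact ⟨s, hs2.1, hs2.2.le, hs1.le⟩
  have hAnear : ∀ s, s ≤ r → ∀ x ∈ ball p s, ‖A x - A p‖ ≤ C * s ^ (α : ℝ) := by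
    intro s hs x hx
    have hs0 : 0 < s := pos_of_mem_ball hx
    refine (hhol x (ball_subset_ball hs hx) p (mem_ball_self hr)).trans ?_
    rw [mem_ball, dist_eq_norm] at hx
    gcongr
  have hstrict : ∀ s, s ≤ r → ∀ x ∈ ball p s, ∀ y ∈ ball p s,
      ‖ρ y - ρ x - A p (y - x)‖ ≤ C * (2 * s) ^ (α : ℝ) * ‖y - x‖ + C * s ^ (α : ℝ) * ‖y - x‖ := by
    intro s hs x hx y hy
    have h1 := htay x (ball_subset_ball hs hx) y (ball_subset_ball hs hy)
    have h2 := ((A x - A p).le_opNorm (y - x)).trans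
      (mul_le_mul_of_nonneg_right (hAnear s hs x hx) (norm_nonneg _))
    have h3 : ‖y - x‖ ^ (1 + α : ℝ) ≤ (2 * s) ^ (α : ℝ) * ‖y - x‖ := by
      have h4 : ‖y - x‖ ≤ 2 * s := by
        rw [mem_ball, dist_eq_norm] at hx hy
        have : y - x = (y - p) - (x - p) := by abel
        rw [this]
        exact (norm_sub_le _ _).trans (by linarith)
      rw [Real.rpow_add' (norm_nonneg _) (by positivity), Real.rpow_one, mul_comm]
      gcongr
    have h5 : ρ y - ρ x - A p (y - x) = (ρ y - ρ x - A x (y - x)) + (A x - A p) (y - x) := by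
      rw [sub_apply]; abel
    rw [h5]
    refine (norm_add_le _ _).trans (add_le_add (h1.trans ?_) h2)
    rw [mul_assoc]
    gcongr
  have hstrict' : ∀ η > 0, ∃ s > 0, s ≤ r ∧ ∀ x ∈ ball p s, ∀ y ∈ ball p s,
      ‖ρ y - ρ x - A p (y - x)‖ ≤ η * ‖y - x‖ := by
    intro η hη
    obtain ⟨s, hs, hsr, hsη⟩ := hsmall (η / 2) (by linarith)
    refine ⟨s / 2, by linarith, by linarith, fun x hx y hy => ?_⟩
    have h1 := hstrict (s / 2) (by linarith) x hx y hy
    have h2 : C * (s / 2) ^ (α : ℝ) ≤ C * s ^ (α : ℝ) := by gcongr; linarith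
    rw [mul_div_cancel₀ s two_ne_zero, ← add_mul] at h1
    refine h1.trans ?_
    gcongr
    linarith
  set S := (A p).nonlinearRightInverseOfSurjective (LinearMap.range_eq_top.2 (hsurj p hpU))
  have hS : 0 < S.nnnorm := (A p).nonlinearRightInverseOfSurjective_nnnorm_pos _
  have hS' : (0 : ℝ) < S.nnnorm := hS
  set N : ℝ := ((S.nnnorm : ℝ≥0) : ℝ) with hN
  obtain ⟨s₁, hs₁, hs₁r, happ⟩ := hstrict' (2 * N)⁻¹ (by positivity)
  obtain ⟨s₂, hs₂, hs₂r, hs₂B⟩ := hsmall δ₂ hδ₂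
  -- the bound `C * ‖τ‖ ^ (1 + α)` on `‖ρ (x + τ)‖` times `2 N` has to stay below `s₁ / 2`
  obtain ⟨s₃, hs₃, hs₃r, hs₃B⟩ := hsmall (2 * N)⁻¹ (by positivity)
  set r' : ℝ := min (min s₁ s₂) s₃ / 8 with hr'
  have hr'pos : 0 < r' := by positivity
  have h8 : 8 * r' = min (min s₁ s₂) s₃ := by rw [hr']; ring
  have hr's₁ : 8 * r' ≤ s₁ := by rw [h8]; exact (min_le_left _ _).trans (min_le_left _ _)
  have hr's₂ : 8 * r' ≤ s₂ := by rw [h8]; exact (min_le_left _ _).trans (min_le_right _ _)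
  have hr's₃ : 8 * r' ≤ s₃ := by rw [h8]; exact min_le_right _ _
  set C' : ℝ := max (max 1 (2 * N * C)) (1 + K₂ * C) with hC'
  refine ⟨C', (le_max_left _ _).trans (le_max_left _ _), r', hr'pos,
    fun x => LinearMap.ker (A x).toLinearMap, ?_, ?_, ?_, ?_⟩
  · rintro x ⟨-, hx⟩ w
    have hxs₂ : x ∈ ball p s₂ := ball_subset_ball (by linarith) hx
    have hBx : ‖B x - B p‖ ≤ δ₂ := by
      refine ContinuousLinearMap.opNorm_le_bound _ hδ₂.le fun v => ?_
      have h1 : ∀ u : V, ‖(A x - A p) u‖ ≤ δ₂ * ‖u‖ := fun u =>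
        ((A x - A p).le_opNorm u).trans (mul_le_mul_of_nonneg_right
          ((hAnear s₂ hs₂r x hxs₂).trans hs₂B) (norm_nonneg _))
      change ‖((A x - A p) v, (A x - A p) (J v))‖ ≤ _
      refine max_le (h1 v) ((h1 _).trans_eq ?_)
      rw [hJ, norm_smul]; simp
    obtain ⟨τ₂, hτ₂, hτ₂n⟩ := hB₂ (B x) hBx (0, A x w)
    have e1 : A x τ₂ = 0 := congrArg Prod.fst hτ₂
    have e2 : A x (Complex.I • τ₂) = A x w := congrArg Prod.snd hτ₂
    have hAxw : ‖A x w‖ ≤ C * ‖w‖ := ((A x).le_opNorm w).trans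
      (mul_le_mul_of_nonneg_right (hbd x (ball_subset_ball (by linarith) hx)) (norm_nonneg _))
    have hτn : ‖τ₂‖ ≤ K₂ * C * ‖w‖ := by
      refine hτ₂n.trans ?_
      rw [mul_assoc]
      gcongr
      rw [Prod.norm_def]
      exact max_le (by rw [norm_zero]; positivity) hAxw
    refine ⟨w - Complex.I • τ₂, ?_, τ₂, ?_, by abel, ?_, ?_⟩
    · rw [LinearMap.mem_ker]
      change A x _ = 0
      rw [map_sub, e2, sub_self]
    · exact e1
    · refine (norm_sub_le _ _).trans ?_
      rw [norm_smul, Complex.norm_I, one_mul]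
      calc ‖w‖ + ‖τ₂‖ ≤ (1 + K₂ * C) * ‖w‖ := by linarith
        _ ≤ C' * ‖w‖ := by gcongr; exact le_max_right _ _
    · refine hτn.trans ?_
      gcongr
      exact (by linarith : K₂ * C ≤ 1 + K₂ * C).trans (le_max_right _ _)
  · rintro x ⟨hxM, hx⟩ τ hτ hτr
    have hτ' : A x τ = 0 := hτ
    have hx' : ‖x - p‖ < r' := by rwa [mem_ball, dist_eq_norm] at hx
    have hxr : x ∈ ball p r := ball_subset_ball (by linarith) hx
    have hxτ : ‖x + τ - p‖ < 2 * r' := by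
      rw [show x + τ - p = (x - p) + τ by abel]
      exact (norm_add_le _ _).trans_lt (by linarith)
    have hρτ : ‖ρ (x + τ)‖ ≤ C * ‖τ‖ ^ (1 + α : ℝ) := by
      have := htay x hxr (x + τ) (by rw [mem_ball, dist_eq_norm]; linarith)
      rwa [zero_of_mem x hxM hxr, add_sub_cancel_left, hτ', sub_zero, sub_zero] at this
    have hτsmall : 2 * N * ‖ρ (x + τ)‖ ≤ r' := by
      have h1 : C * ‖τ‖ ^ (1 + α : ℝ) ≤ (2 * N)⁻¹ * r' := by
        rw [Real.rpow_add' (norm_nonneg _) (by positivity), Real.rpow_one]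
        calc C * (‖τ‖ * ‖τ‖ ^ (α : ℝ)) = (C * ‖τ‖ ^ (α : ℝ)) * ‖τ‖ := by ring
          _ ≤ (C * s₃ ^ (α : ℝ)) * r' := by gcongr; linarith
          _ ≤ _ := by gcongr
      calc 2 * N * ‖ρ (x + τ)‖ ≤ 2 * N * ((2 * N)⁻¹ * r') := by
            gcongr; exact hρτ.trans h1
        _ = r' := by field_simp
    have hA' : ApproximatesLinearOn ρ (A p) (ball p s₁) (2 * S.nnnorm)⁻¹ := by
      intro a ha b hb
      have := happ b hb a ha
      simpa using this
    have hsub : closedBall (x + τ) (2 * N * ‖ρ (x + τ)‖) ⊆ ball p s₁ := by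
      intro y hy
      rw [mem_closedBall, dist_eq_norm] at hy
      rw [mem_ball, dist_eq_norm, show y - p = (y - (x + τ)) + (x + τ - p) by abel]
      exact (norm_add_le _ _).trans_lt (by linarith)
    obtain ⟨y, hy, hy0⟩ := hA'.surjOn_closedBall_of_nonlinearRightInverse S (by positivity) hsub
      (a := 0) (by
        rw [mem_closedBall, dist_eq_norm, zero_sub, norm_neg]
        apply le_of_eq
        rw [← hN]
        push_cast
        rw [← hN]
        field_simp
        ring)
    refine ⟨y, mem_of_zero y (ball_subset_ball hs₁r (hsub hy)) hy0, ?_⟩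
    rw [mem_closedBall, dist_eq_norm] at hy
    refine hy.trans ?_
    calc 2 * N * ‖ρ (x + τ)‖ ≤ 2 * N * (C * ‖τ‖ ^ (1 + α : ℝ)) := by gcongr
      _ = 2 * N * C * ‖τ‖ ^ (1 + α : ℝ) := by ring
      _ ≤ _ := by gcongr; exact (le_max_right _ _).trans (le_max_left _ _)
  · have h1 : M ∩ closedBall p r' = closedBall p r' ∩ ρ ⁻¹' {0} := by
      ext y
      constructor
      · rintro ⟨hy, hyr⟩
        exact ⟨hyr, zero_of_mem y hy (closedBall_subset_ball (by linarith) hyr)⟩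
      · rintro ⟨hyr, hy⟩
        exact ⟨mem_of_zero y (closedBall_subset_ball (by linarith) hyr) hy, hyr⟩
    rw [h1]
    exact (hdiff.continuousOn.mono (closedBall_subset_ball (by linarith))).preimage_isClosed_of_isClosed
      isClosed_closedBall isClosed_singleton
  · intro η hη
    obtain ⟨s, hs, hsr, hsη⟩ := hstrict' (η / K₁) (by positivity)
    refine ⟨s, hs, ?_⟩
    rintro x ⟨hxM, hx⟩ y ⟨hyM, hy⟩
    have h1 := hsη x hx y hy
    rw [zero_of_mem x hxM (ball_subset_ball hsr hx), zero_of_mem y hyM (ball_subset_ball hsr hy),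
      sub_zero, zero_sub, norm_neg] at h1
    obtain ⟨z, hz, hzn⟩ := hA₁ (A p) (by simpa using hδ₁.le) (A p (y - x))
    refine ⟨y - x - z, ?_, ?_⟩
    · change A p (y - x - z) = 0
      rw [map_sub, hz, sub_self]
    · rw [sub_sub_cancel]
      calc ‖z‖ ≤ K₁ * ‖A p (y - x)‖ := hzn
        _ ≤ K₁ * (η / K₁ * ‖y - x‖) := by gcongr
        _ = η * ‖y - x‖ := by field_simp

/-! ### Nearly attached analytic discs -/

/-- First-order data, along `M` near `p`, of a function `u` of class `C^{1+α}` on `M`: real linear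
maps `ℓ x` giving Taylor expansions of `u` on `M` with a remainder of order `1 + α`. Only the
values of `ℓ x` on the tangent space of `M` are determined by `u`. -/
structure HasEdgeJets {V G : Type*} [NormedAddCommGroup V] [NormedSpace ℝ V]
    [NormedAddCommGroup G] [NormedSpace ℝ G] (α C r : ℝ) (M : Set V) (u : V → G)
    (ℓ : V → V →L[ℝ] G) (p : V) : Prop where
  bound : ∀ x ∈ M ∩ ball p r, ‖ℓ x‖ ≤ C
  taylor : ∀ x ∈ M ∩ ball p r, ∀ y ∈ M ∩ ball p r,
    ‖u y - u x - ℓ x (y - x)‖ ≤ C * ‖y - x‖ ^ (1 + α)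
  holder : ∀ x ∈ M ∩ ball p r, ‖ℓ x - ℓ p‖ ≤ C * ‖x - p‖ ^ α

/-- The standing situation: a generic edge `M` near `p`, a function `u` of class `C^{1+α}` on `M`,
and a holomorphic function `F` on an open set `W` containing a wedge with edge `M` near `p` and
directions `Γ`, with boundary values `u`. -/
structure EdgeSetting {V G : Type*} [NormedAddCommGroup V] [NormedSpace ℂ V]
    [NormedAddCommGroup G] [NormedSpace ℂ G] (α C r : ℝ) (M : Set V) (T : V → Submodule ℝ V)
    (p : V) (u : V → G) (ℓ : V → V →L[ℝ] G) (Γ W : Set V) (F : V → G) : Prop where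
  model : IsEdgeModel α C r M T p
  jets : HasEdgeJets α C r M u ℓ p
  isOpen : IsOpen W
  holo : DifferentiableOn ℂ F W
  cone : IsOpenCone Γ
  sub : ∀ x ∈ M ∩ ball p r, ∀ w ∈ Γ, ‖w‖ < r → x + w ∈ W
  lim : ∀ x ∈ M ∩ ball p r, Tendsto F (𝓝[W] x) (𝓝 (u x))
  mem : p ∈ M
  one_le : 1 ≤ C
  r_pos : 0 < r
  r_le : r ≤ 1
  α_pos : 0 < α
  α_lt : α < 1

/-- Higher powers are negligible near zero. -/
theorem eventually_mul_rpow_le {γ₁ γ₂ : ℝ} (h : γ₁ < γ₂) (K : ℝ) {η : ℝ} (hη : 0 < η) :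
    ∀ᶠ s in 𝓝[>] (0 : ℝ), K * s ^ γ₂ ≤ η * s ^ γ₁ := by
  have h1 : Tendsto (fun s : ℝ => K * s ^ (γ₂ - γ₁)) (𝓝[>] 0) (𝓝 (K * (0 : ℝ) ^ (γ₂ - γ₁))) :=
    (((Real.continuous_rpow_const (sub_pos.2 h).le).tendsto 0).const_mul K).mono_left
      nhdsWithin_le_nhds
  rw [Real.zero_rpow (sub_pos.2 h).ne', mul_zero] at h1
  filter_upwards [h1.eventually (gt_mem_nhds hη), self_mem_nhdsWithin] with s hs hs0
  have hs0' : 0 < s := hs0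
  have : s ^ γ₂ = s ^ (γ₂ - γ₁) * s ^ γ₁ := by rw [← Real.rpow_add hs0']; ring_nf
  rw [this, ← mul_assoc]
  exact mul_le_mul_of_nonneg_right hs.le (by positivity)

theorem eventually_mul_rpow_le_const {γ : ℝ} (h : 0 < γ) (K : ℝ) {η : ℝ} (hη : 0 < η) :
    ∀ᶠ s in 𝓝[>] (0 : ℝ), K * s ^ γ ≤ η := by
  filter_upwards [eventually_mul_rpow_le h K hη] with s hs
  simpa using hs

theorem eventually_mul_le_const (K : ℝ) {η : ℝ} (hη : 0 < η) :
    ∀ᶠ s in 𝓝[>] (0 : ℝ), K * s ≤ η := by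
  filter_upwards [eventually_mul_rpow_le_const one_pos K hη] with s hs
  simpa using hs

theorem exists_pos_forall_of_eventually {P : ℝ → Prop} (h : ∀ᶠ s in 𝓝[>] (0 : ℝ), P s) :
    ∃ s₀ > 0, ∀ s, 0 < s → s ≤ s₀ → P s := by
  obtain ⟨u, hu, hsub⟩ := mem_nhdsGT_iff_exists_Ioc_subset.1 h
  exact ⟨u, hu, fun s h0 h1 => hsub ⟨h0, h1⟩⟩

/-- An analytic disc through a point `x + w` of the wedge, whose real diameter lies at height `θ`,
very close to the edge, and in the same cone of directions, while the rest of the half disc stays in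
a slightly larger cone. The disc is `ζ ↦ x + θ a + τ₁ + ζ τ₂`, where `τ₁ + i τ₂ = w - θ a` with
`τ₁`, `τ₂` tangent to the edge at `x`; the point `x + w` corresponds to `ζ = i`. The shift by `θ a`
makes up for the distance of the edge from its tangent space. -/
theorem IsEdgeModel.exists_disc {V : Type*} [NormedAddCommGroup V] [NormedSpace ℂ V]
    {α C r : ℝ} {M : Set V} {T : V → Submodule ℝ V} {p : V} (hM : IsEdgeModel α C r M T p)
    (hC : 0 ≤ C) (hα : 0 < α) {x : V} (hx : x ∈ M ∩ ball p r) {a w τ₁ τ₂ : V} {c c' θ s R E : ℝ}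
    (hτ₁ : τ₁ ∈ T x) (hτ₂ : τ₂ ∈ T x) (hdec : τ₁ + Complex.I • τ₂ = w - θ • a)
    (hw : ‖w - s • a‖ ≤ c * s) (hcc' : c ≤ c')
    (hθ : 0 < θ) (hθs : θ ≤ s) (hθs' : c' * θ ≤ (c' - c) * s)
    (hE₁ : ‖τ₁‖ ≤ E) (hE₂ : ‖τ₂‖ ≤ E) (hR : 1 ≤ R) (hRE : 3 * R * E ≤ r)
    (hθE : C * (3 * R * E) ^ (1 + α) ≤ c * θ) {ζ : ℂ} (hζ : ‖ζ‖ ≤ R) (hζi : 0 ≤ ζ.im) :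
    ∃ y ∈ M, ∃ w' : V, ∃ s' : ℝ, x + θ • a + τ₁ + ζ • τ₂ = y + w' ∧
      ‖y - (x + ((1 - ζ.im) • τ₁ + ζ.re • τ₂))‖ ≤ c * θ ∧
      ‖y - x‖ ≤ 3 * R * E + c * θ ∧
      0 < s' ∧ s' ≤ 2 * R * s ∧ ‖w' - s' • a‖ ≤ c' * s' ∧
      (ζ.im = 0 → s' = θ ∧ ‖w' - θ • a‖ ≤ c * θ) := by
  have hE : 0 ≤ E := (norm_nonneg _).trans hE₁
  have him : ζ.im ≤ R := (le_abs_self _).trans ((Complex.abs_im_le_norm ζ).trans hζ)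
  have hre : |ζ.re| ≤ R := (Complex.abs_re_le_norm ζ).trans hζ
  set τ := (1 - ζ.im) • τ₁ + ζ.re • τ₂ with hτ
  have hτn : ‖τ‖ ≤ 3 * R * E := by
    refine (norm_add_le _ _).trans ?_
    rw [norm_smul, norm_smul, Real.norm_eq_abs, Real.norm_eq_abs]
    have h1 : |1 - ζ.im| ≤ 2 * R := by rw [abs_le]; constructor <;> linarith
    calc |1 - ζ.im| * ‖τ₁‖ + |ζ.re| * ‖τ₂‖ ≤ 2 * R * E + R * E := by gcongr
      _ = 3 * R * E := by ring
  obtain ⟨y, hyM, hy⟩ := hM.near x hx τ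
    ((T x).add_mem ((T x).smul_mem _ hτ₁) ((T x).smul_mem _ hτ₂)) (hτn.trans hRE)
  have hyθ : ‖y - (x + τ)‖ ≤ c * θ := by
    refine hy.trans (le_trans ?_ hθE)
    gcongr
  have hs : 0 < s := hθ.trans_le hθs
  refine ⟨y, hyM, x + θ • a + τ₁ + ζ • τ₂ - y, θ + ζ.im * (s - θ), by abel, hyθ, ?_, ?_, ?_, ?_, ?_⟩
  · rw [show y - x = τ + (y - (x + τ)) by abel]
    exact (norm_add_le _ _).trans (add_le_add hτn hyθ)
  · have : 0 ≤ ζ.im * (s - θ) := mul_nonneg hζi (by linarith)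
    linarith
  · have : ζ.im * (s - θ) ≤ R * s := by
      apply mul_le_mul him (by linarith) (by linarith) (by linarith)
    nlinarith
  · have hζτ : ζ • τ₂ = ζ.re • τ₂ + ζ.im • (Complex.I • τ₂) := by
      conv_lhs => rw [← Complex.re_add_im ζ]
      rw [add_smul, mul_smul, Complex.coe_smul, Complex.coe_smul]
    have e1 : x + θ • a + τ₁ + ζ • τ₂ - y - (θ + ζ.im * (s - θ)) • a
        = -(y - (x + τ)) + ζ.im • (w - s • a) := by
      have e2 : Complex.I • τ₂ = w - θ • a - τ₁ := by rw [← hdec]; abel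
      rw [hζτ, e2, hτ]
      module
    rw [e1]
    refine (norm_add_le _ _).trans ?_
    rw [norm_neg, norm_smul, Real.norm_eq_abs, abs_of_nonneg hζi]
    have h1 : ζ.im * ‖w - s • a‖ ≤ ζ.im * (c * s) := by gcongr
    have h2 : ζ.im * (c' * θ) ≤ ζ.im * ((c' - c) * s) := by gcongr
    have h3 : c * θ ≤ c' * θ := by gcongr
    nlinarith
  · intro h0
    have e1 : x + θ • a + τ₁ + ζ • τ₂ - y - θ • a = -(y - (x + τ)) := by
      have hζτ : ζ • τ₂ = ζ.re • τ₂ := by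
        rw [← Complex.coe_smul, ← Complex.re_add_im ζ, h0]; simp
      rw [hζτ, hτ, h0]
      module
    rw [e1, norm_neg, h0]
    exact ⟨by ring, hyθ⟩

section

variable {V G : Type*} [NormedAddCommGroup V] [NormedSpace ℂ V] [NormedAddCommGroup G]
  [NormedSpace ℂ G] {α C r : ℝ} {M : Set V} {T : V → Submodule ℝ V} {p : V} {u : V → G}
  {ℓ : V → V →L[ℝ] G} {Γ W : Set V} {F : V → G}

theorem IsOpenCone.mem_of_norm_sub_le (hΓ : IsOpenCone Γ) {a w : V} {c s : ℝ}
    (hac : closedBall a c ⊆ Γ) (hs : 0 < s) (hw : ‖w - s • a‖ ≤ c * s) : w ∈ Γ := by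
  have h1 : s⁻¹ • w ∈ Γ := by
    apply hac
    rw [mem_closedBall, dist_eq_norm]
    have : s⁻¹ • w - a = s⁻¹ • (w - s • a) := by
      rw [smul_sub, smul_smul, inv_mul_cancel₀ hs.ne', one_smul]
    rw [this, norm_smul, norm_inv, Real.norm_eq_abs, abs_of_pos hs, inv_mul_le_iff₀ hs]
    linarith
  have := hΓ.2 _ h1 s hs
  rwa [smul_smul, mul_inv_cancel₀ hs.ne', one_smul] at this

theorem norm_le_of_norm_sub_smul_le {a w : V} {c s : ℝ} (hs : 0 ≤ s) (hw : ‖w - s • a‖ ≤ c * s) :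
    ‖w‖ ≤ (c + ‖a‖) * s := by
  have : ‖w‖ ≤ ‖w - s • a‖ + ‖s • a‖ := by
    have := norm_add_le (w - s • a) (s • a)
    rwa [sub_add_cancel] at this
  rw [norm_smul, Real.norm_eq_abs, abs_of_nonneg hs] at this
  linarith

theorem exists_closedBall_subset_of_lt [ProperSpace V] (hΓ : IsOpen Γ) {a : V} {c : ℝ} (hc : 0 ≤ c)
    (hac : closedBall a c ⊆ Γ) : ∃ c' > c, closedBall a c' ⊆ Γ := by
  obtain ⟨δ, hδ, hsub⟩ := (isCompact_closedBall a c).exists_cthickening_subset_open hΓ hac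
  refine ⟨c + δ, by linarith, ?_⟩
  rwa [cthickening_closedBall hδ.le hc, add_comm] at hsub

theorem HasEdgeJets.norm_sub_le (hu : HasEdgeJets α C r M u ℓ p) (hC : 0 ≤ C) (hα : 0 < α)
    {x y : V} (hx : x ∈ M ∩ ball p r) (hy : y ∈ M ∩ ball p r) (hxy : ‖y - x‖ ≤ 1) :
    ‖u y - u x‖ ≤ 2 * C * ‖y - x‖ := by
  have h1 := hu.taylor x hx y hy
  have h2 : ‖ℓ x (y - x)‖ ≤ C * ‖y - x‖ :=
    ((ℓ x).le_opNorm _).trans (mul_le_mul_of_nonneg_right (hu.bound x hx) (norm_nonneg _))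
  have h3 : ‖y - x‖ ^ (1 + α) ≤ ‖y - x‖ := by
    have := Real.rpow_le_rpow_of_exponent_ge' (norm_nonneg (y - x)) hxy zero_le_one
      (by linarith : (1 : ℝ) ≤ 1 + α)
    simpa using this
  have h4 : u y - u x = (u y - u x - ℓ x (y - x)) + ℓ x (y - x) := by abel
  rw [h4]
  refine (norm_add_le _ _).trans ?_
  have : C * ‖y - x‖ ^ (1 + α) ≤ C * ‖y - x‖ := by gcongr
  linarith

/-- The function `F` approaches its boundary values at the rate `s ^ β` in the height `s`, uniformly
in the base points near `p` and on closed subcones of the cone of directions. -/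
def HasEdgeRate (M : Set V) (p : V) (u : V → G) (Γ : Set V) (F : V → G) (β : ℝ) : Prop :=
  ∀ (a : V) (c : ℝ), 0 < c → closedBall a c ⊆ Γ → ∃ A : ℝ, 0 ≤ A ∧ ∃ s₀ > 0,
    ∀ x ∈ M ∩ ball p s₀, ∀ (w : V) (s : ℝ), 0 < s → s ≤ s₀ → ‖w - s • a‖ ≤ c * s →
      ‖F (x + w) - u x‖ ≤ A * s ^ β

/-- The height function of the maximum principle argument is continuous up to the edge. -/
theorem EdgeSetting.continuousOn_dist (S : EdgeSetting α C r M T p u ℓ Γ W F) {a : V} {c : ℝ}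
    (hac : closedBall a c ⊆ Γ) {D : Set (V × V × ℝ)}
    (hD : ∀ q ∈ D, q.1 ∈ M ∩ ball p r ∧ ‖q.2.1‖ < r ∧ 0 ≤ q.2.2 ∧
      ‖q.2.1 - q.2.2 • a‖ ≤ c * q.2.2) :
    ContinuousOn (fun q : V × V × ℝ => if q.2.2 = 0 then 0 else ‖F (q.1 + q.2.1) - u q.1‖) D := by
  have hC : 0 ≤ C := zero_le_one.trans S.one_le
  have hu : ∀ x ∈ M ∩ ball p r, ContinuousWithinAt u (M ∩ ball p r) x := by
    intro x hx
    rw [Metric.continuousWithinAt_iff]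
    intro η hη
    refine ⟨min 1 (η / (2 * C + 1)), by positivity, fun {y} hy hyx => ?_⟩
    rw [dist_eq_norm] at hyx ⊢
    have h1 := S.jets.norm_sub_le hC S.α_pos hx hy (hyx.le.trans (min_le_left _ _))
    have h2 : ‖y - x‖ < η / (2 * C + 1) := hyx.trans_le (min_le_right _ _)
    rw [lt_div_iff₀ (by positivity)] at h2
    nlinarith [norm_nonneg (y - x)]
  have hW : ∀ q ∈ D, q.2.2 ≠ 0 → q.1 + q.2.1 ∈ W := fun q hq h0 => by
    obtain ⟨h1, h2, h3, h4⟩ := hD q hq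
    exact S.sub _ h1 _ (S.cone.mem_of_norm_sub_le hac (lt_of_le_of_ne h3 (Ne.symm h0)) h4) h2
  intro q hq
  obtain ⟨hq1, hq2, hq3, hq4⟩ := hD q hq
  have huq : ContinuousWithinAt (fun q : V × V × ℝ => u q.1) D q :=
    (hu q.1 hq1).comp continuous_fst.continuousWithinAt (fun q' hq' => (hD q' hq').1)
  by_cases h0 : q.2.2 = 0
  · have hw0 : q.2.1 = 0 := by
      rw [h0] at hq4
      simpa using hq4
    rw [Metric.continuousWithinAt_iff']
    intro η hη
    have h1 : ∀ᶠ z in 𝓝 q.1, z ∈ W → dist (F z) (u q.1) < η / 2 :=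
      eventually_nhdsWithin_iff.1 ((Metric.tendsto_nhds.1 (S.lim q.1 hq1)) (η / 2) (by linarith))
    have h2 : Tendsto (fun q' : V × V × ℝ => q'.1 + q'.2.1) (𝓝[D] q) (𝓝 q.1) := by
      have : Tendsto (fun q' : V × V × ℝ => q'.1 + q'.2.1) (𝓝 q) (𝓝 (q.1 + q.2.1)) :=
        Continuous.tendsto (by fun_prop) q
      rw [hw0, add_zero] at this
      exact this.mono_left nhdsWithin_le_nhds
    have h3 := (Metric.continuousWithinAt_iff'.1 huq) (η / 2) (by linarith)
    filter_upwards [h2.eventually h1, h3, self_mem_nhdsWithin] with q' h4 h5 h6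
    rw [if_pos h0]
    split_ifs with h7
    · simpa using hη
    · rw [dist_zero_right, norm_norm, ← dist_eq_norm]
      have := dist_triangle_right (F (q'.1 + q'.2.1)) (u q'.1) (u q.1)
      linarith [h4 (hW q' h6 h7)]
  · have hF : ContinuousAt F (q.1 + q.2.1) :=
      (S.holo.differentiableAt (S.isOpen.mem_nhds (hW q hq h0))).continuousAt
    have h1 : ContinuousWithinAt (fun q : V × V × ℝ => ‖F (q.1 + q.2.1) - u q.1‖) D q := by
      refine (ContinuousWithinAt.sub ?_ huq).norm
      exact (ContinuousAt.comp (f := fun q : V × V × ℝ => q.1 + q.2.1) hF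
        (Continuous.continuousAt (by fun_prop))).continuousWithinAt
    refine h1.congr_of_eventuallyEq ?_ (if_neg h0)
    have h2 : ∀ᶠ q' : V × V × ℝ in 𝓝 q, q'.2.2 ≠ 0 :=
      (continuous_snd.comp continuous_snd).continuousAt.eventually_ne h0
    filter_upwards [nhdsWithin_le_nhds h2] with q' hq'
    exact if_neg hq'

/-- The two-constants inequality on a disc through `x + w`: a bound `b` at height `θ` and a rough
bound `t` on the larger cone, both for the difference of `F` and a function that is affine along
the disc, give a bound at `x + w`. -/
theorem EdgeSetting.norm_sub_le_of_disc (S : EdgeSetting α C r M T p u ℓ Γ W F)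
    {x a w τ₁ τ₂ : V} {c c' θ s R E b t : ℝ} {g₀ g₁ : G} (hx : x ∈ M ∩ ball p r)
    (hτ₁ : τ₁ ∈ T x) (hτ₂ : τ₂ ∈ T x) (hdec : τ₁ + Complex.I • τ₂ = w - θ • a)
    (hw : ‖w - s • a‖ ≤ c * s) (hcc' : c ≤ c') (hac' : closedBall a c' ⊆ Γ) (hc' : 0 ≤ c')
    (hθ : 0 < θ) (hθs : θ ≤ s) (hθs' : c' * θ ≤ (c' - c) * s)
    (hE₁ : ‖τ₁‖ ≤ E) (hE₂ : ‖τ₂‖ ≤ E) (hR : 1 < R) (hRE : 3 * R * E ≤ r)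
    (hθE : C * (3 * R * E) ^ (1 + α) ≤ c * θ) (hxr : ‖x - p‖ + (3 * R * E + c * θ) < r)
    (hsr : (c' + ‖a‖) * (2 * R * s) < r) (hb : 0 < b) (hbt : b ≤ t)
    (hbot : ∀ (σ : ℝ) (y w' : V), |σ| ≤ R → y ∈ M ∩ ball p r →
      ‖y - (x + (τ₁ + σ • τ₂))‖ ≤ c * θ → ‖y - x‖ ≤ 3 * R * E + c * θ →
      ‖w' - θ • a‖ ≤ c * θ → ‖F (y + w') - (g₀ + σ • g₁)‖ ≤ b)
    (htop : ∀ (ζ : ℂ) (y w' : V) (s' : ℝ), ‖ζ‖ ≤ R → y ∈ M ∩ ball p r →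
      ‖y - x‖ ≤ 3 * R * E + c * θ → 0 < s' → s' ≤ 2 * R * s → ‖w' - s' • a‖ ≤ c' * s' →
      ‖F (y + w') - (g₀ + ζ • g₁)‖ ≤ t) :
    ‖F (x + w) - (g₀ + Complex.I • g₁)‖ ≤ b * (t / b) ^ (3 / R) := by
  have hC : 0 ≤ C := zero_le_one.trans S.one_le
  have hdisc := fun (ζ : ℂ) (hζ : ‖ζ‖ ≤ R) (hζi : 0 ≤ ζ.im) =>
    S.model.exists_disc hC S.α_pos hx hτ₁ hτ₂ hdec hw hcc' hθ hθs hθs' hE₁ hE₂ hR.le hRE hθE hζ hζi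
  set Z : ℂ → V := fun ζ => x + θ • a + τ₁ + ζ • τ₂ with hZ
  have hZd : Differentiable ℂ Z := by rw [hZ]; fun_prop
  have hbase : ∀ y ∈ M, ‖y - x‖ ≤ 3 * R * E + c * θ → y ∈ M ∩ ball p r := by
    intro y hyM hy
    refine ⟨hyM, ?_⟩
    rw [mem_ball, dist_eq_norm, show y - p = (x - p) + (y - x) by abel]
    exact (norm_add_le _ _).trans_lt (by linarith)
  have hZI : Z Complex.I = x + w := by
    change x + θ • a + τ₁ + Complex.I • τ₂ = x + w
    rw [show x + θ • a + τ₁ + Complex.I • τ₂ = x + θ • a + (τ₁ + Complex.I • τ₂) by abel, hdec]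
    abel
  rw [← hZI]
  refine norm_le_of_halfDisc (F := fun ζ => F (Z ζ) - (g₀ + ζ • g₁)) (O := Z ⁻¹' W)
    ((S.holo.comp hZd.differentiableOn (mapsTo_preimage _ _)).sub
      (Differentiable.differentiableOn (by fun_prop))) hR ?_ hb hbt ?_ ?_
  · intro ζ hζ hζi
    obtain ⟨y, hyM, w', s', hz, -, hy, hs', hs'R, hw', -⟩ := hdisc ζ hζ hζi
    change x + θ • a + τ₁ + ζ • τ₂ ∈ W
    rw [hz]
    refine S.sub y (hbase y hyM hy) w' (S.cone.mem_of_norm_sub_le hac' hs' hw') ?_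
    refine (norm_le_of_norm_sub_smul_le hs'.le hw').trans_lt (lt_of_le_of_lt ?_ hsr)
    gcongr
  · intro ζ hζ hζi
    obtain ⟨y, hyM, w', s', hz, hyτ, hy, -, -, -, hw'⟩ := hdisc ζ hζ hζi.ge
    change ‖F (x + θ • a + τ₁ + ζ • τ₂) - (g₀ + ζ • g₁)‖ ≤ b
    have hζ' : ζ • g₁ = ζ.re • g₁ := by
      conv_lhs => rw [← Complex.re_add_im ζ, hζi]
      simp
    rw [hz, hζ']
    rw [hζi, sub_zero, one_smul] at hyτ
    exact hbot ζ.re y w' ((Complex.abs_re_le_norm ζ).trans hζ) (hbase y hyM hy) hyτ hy (hw' hζi).2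
  · intro ζ hζ hζi
    obtain ⟨y, hyM, w', s', hz, -, hy, hs', hs'R, hw', -⟩ := hdisc ζ hζ hζi
    change ‖F (x + θ • a + τ₁ + ζ • τ₂) - (g₀ + ζ • g₁)‖ ≤ t
    rw [hz]
    exact htop ζ y w' s' hζ (hbase y hyM hy) hy hs' hs'R hw'

end

/-! ### The rate of approach to the boundary values -/

section

variable {V G : Type*} [NormedAddCommGroup V] [NormedSpace ℂ V] [NormedAddCommGroup G]
  [NormedSpace ℂ G] {α C r : ℝ} {M : Set V} {T : V → Submodule ℝ V} {p : V} {u : V → G}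
  {ℓ : V → V →L[ℝ] G} {Γ W : Set V} {F : V → G}

set_option maxHeartbeats 1000000 in
/-- A first, weak, rate. At a positive maximum of
`‖F (x + w) - u x‖ - A (s ^ β + ‖x - x₀‖ ^ 2)` over the closed wedge, the two-constants inequality
on a disc through `x + w` of radius `s ^ (1 - β)`, with its diameter at height `s ^ (1 + β)`, bounds
`‖F (x + w) - u x‖` by its values at smaller heights plus `O (s ^ β)`; for large `A` this
contradicts maximality. -/
theorem EdgeSetting.hasEdgeRate_quarter [ProperSpace V]
    (S : EdgeSetting α C r M T p u ℓ Γ W F) : HasEdgeRate M p u Γ F (α / 4) := by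
  intro a c hc hac
  have hC1 := S.one_le
  have hC : 0 < C := one_pos.trans_le S.one_le
  have hα := S.α_pos
  have hα1 := S.α_lt
  have hr := S.r_pos
  obtain ⟨c', hcc', hac'⟩ := exists_closedBall_subset_of_lt S.cone.1 hc.le hac
  have hc' : 0 < c' := hc.trans hcc'
  set δ : ℝ := α / 4 with hδ
  have hδ0 : 0 < δ := by positivity
  have hδ1 : δ < 1 / 4 := by linarith
  obtain ⟨r₁, hr₁, hF₁⟩ : ∃ r₁ > 0, ∀ z ∈ W ∩ ball p r₁, ‖F z - u p‖ ≤ 1 := by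
    have h1 := Metric.tendsto_nhds.1 (S.lim p ⟨S.mem, mem_ball_self hr⟩) 1 one_pos
    obtain ⟨r₁, hr₁, h2⟩ := Metric.mem_nhdsWithin_iff.1 h1
    exact ⟨r₁, hr₁, fun z hz => by rw [← dist_eq_norm]; exact (h2 ⟨hz.2, hz.1⟩ : dist _ _ < 1).le⟩
  set r₀ : ℝ := min (min r r₁) (1 / (2 * C)) / 4 with hr₀
  have hr₀pos : 0 < r₀ := by positivity
  have h4r₀ : 4 * r₀ = min (min r r₁) (1 / (2 * C)) := by rw [hr₀]; ring
  have hr₀r : 4 * r₀ ≤ r := by rw [h4r₀]; exact (min_le_left _ _).trans (min_le_left _ _)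
  have hr₀r₁ : 4 * r₀ ≤ r₁ := by rw [h4r₀]; exact (min_le_left _ _).trans (min_le_right _ _)
  have hr₀C : 4 * r₀ ≤ 1 / (2 * C) := by rw [h4r₀]; exact min_le_right _ _
  have hr1 := S.r_le
  have hbound : ∀ x ∈ M ∩ ball p (4 * r₀), ∀ z ∈ W ∩ ball p r₁, ‖F z - u x‖ ≤ 2 := by
    intro x hx z hz
    have h1 := hF₁ z hz
    have hxn : ‖x - p‖ < 4 * r₀ := by have := hx.2; rwa [mem_ball, dist_eq_norm] at this
    have h2 := S.jets.norm_sub_le hC.le hα ⟨S.mem, mem_ball_self hr⟩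
      ⟨hx.1, ball_subset_ball hr₀r hx.2⟩ (by linarith)
    have h3 : 2 * C * ‖x - p‖ ≤ 1 := by
      calc 2 * C * ‖x - p‖ ≤ 2 * C * (1 / (2 * C)) := by gcongr; linarith
        _ = 1 := by field_simp
    rw [show F z - u x = (F z - u p) - (u x - u p) by abel]
    exact (norm_sub_le _ _).trans (by linarith)
  set N : ℝ := c + ‖a‖ with hN
  have hN0 : 0 < N := by positivity
  set K : ℝ := 3 * (C * N) with hK
  have hK0 : 0 < K := by positivity
  set C₅ : ℝ := K + c with hC₅
  have hC₅0 : 0 < C₅ := by positivity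
  set κ : ℝ := (c' - c) / c' with hκ
  have hκ0 : 0 < κ := div_pos (by linarith) hc'
  have hκ1 : κ ≤ 1 := by rw [hκ, div_le_one hc']; linarith
  -- with `P = s ^ (1 - δ)` the size of the disc and `θ = s ^ (1 + δ)` the height of its diameter, all
  -- the error terms are small multiples of `s ^ δ`, since `1 - δ > δ` and `θ ^ δ ≪ s ^ δ`
  obtain ⟨s₂, hs₂, hev⟩ := exists_pos_forall_of_eventually
    (((eventually_mul_rpow_le (by linarith : (1 : ℝ) < 1 + δ) 1 hκ0).and
    ((eventually_mul_rpow_le_const (by linarith : 0 < 1 - δ) K hr).and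
    ((eventually_mul_rpow_le (by nlinarith : 1 + δ < (1 - δ) * (1 + α)) (C * K ^ (1 + α)) hc).and
    (eventually_mul_rpow_le_const (by linarith : 0 < 1 - δ) C₅ (half_pos hr₀pos))))).and
    (((eventually_mul_rpow_le (by linarith : δ < 1 - δ) (3 * C₅) (by norm_num : (0 : ℝ) < 1 / 4)).and
    ((eventually_mul_rpow_le (by linarith : δ < 1 - δ) (2 * C * C₅)
      (by norm_num : (0 : ℝ) < 1 / 4)).and
    (eventually_mul_rpow_le (by nlinarith : δ < (1 + δ) * δ) 1 (by norm_num : (0 : ℝ) < 1 / 4)))).and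
    ((eventually_mul_rpow_le_const hδ0 3 one_pos).and
    ((eventually_mul_rpow_le_const (by linarith : 0 < 1 - δ) (2 * (c' + ‖a‖)) hr₀pos).and
    (eventually_mul_le_const 1 one_pos)))))
  set A : ℝ := max 48 (8 / r₀ ^ 2) with hA
  have hA48 : 48 ≤ A := le_max_left _ _
  have hAr : 2 ≤ A * (r₀ / 2) ^ 2 := by
    calc (2 : ℝ) = 8 / r₀ ^ 2 * (r₀ / 2) ^ 2 := by field_simp; norm_num
      _ ≤ _ := by gcongr; exact le_max_right _ _
  refine ⟨A, by linarith, min s₂ r₀, lt_min hs₂ hr₀pos, ?_⟩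
  rintro x₀ ⟨hx₀M, hx₀⟩ w₁ s₁ hs₁ hs₁le hw₁
  have hx₀' : ‖x₀ - p‖ < r₀ := by
    rw [mem_ball, dist_eq_norm] at hx₀
    exact hx₀.trans_le (min_le_right _ _)
  set D : Set (V × V × ℝ) := {q | q.1 ∈ M ∩ closedBall p r ∧ q.1 ∈ closedBall x₀ r₀ ∧
    0 ≤ q.2.2 ∧ q.2.2 ≤ s₂ ∧ ‖q.2.1 - q.2.2 • a‖ ≤ c * q.2.2} with hD
  have hball : ∀ x ∈ closedBall x₀ r₀, ‖x - p‖ < 2 * r₀ := by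
    intro x hx
    rw [mem_closedBall, dist_eq_norm] at hx
    rw [show x - p = (x - x₀) + (x₀ - p) by abel]
    exact (norm_add_le _ _).trans_lt (by linarith)
  -- the heights involved are bounded by a small multiple of `r₀`
  have hheight : ∀ s, 0 < s → s ≤ s₂ → s ≤ s ^ (1 - δ) ∧ (c' + ‖a‖) * s ≤ r₀ := by
    intro s h0 h1
    obtain ⟨-, -, -, e8, e9⟩ := hev s h0 h1
    have h2 : s ≤ s ^ (1 - δ) := by
      have := Real.rpow_le_rpow_of_exponent_ge h0 (by linarith : s ≤ 1)
        (by linarith : 1 - δ ≤ 1)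
      simpa using this
    refine ⟨h2, ?_⟩
    have : (c' + ‖a‖) * s ≤ (c' + ‖a‖) * s ^ (1 - δ) := by gcongr
    have h3 : 0 ≤ (c' + ‖a‖) * s ^ (1 - δ) := by positivity
    linarith
  have hDprop : ∀ q ∈ D, q.1 ∈ M ∩ ball p r ∧ ‖q.2.1‖ < r ∧ 0 ≤ q.2.2 ∧
      ‖q.2.1 - q.2.2 • a‖ ≤ c * q.2.2 := by
    rintro ⟨x, w, s⟩ ⟨h1, h2, h3, h4, h5⟩
    refine ⟨⟨h1.1, ?_⟩, ?_, h3, h5⟩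
    · rw [mem_ball, dist_eq_norm]; linarith [hball x h2]
    · have h6 := norm_le_of_norm_sub_smul_le h3 h5
      refine h6.trans_lt ?_
      rcases h3.eq_or_lt with h7 | h7
      · change (c + ‖a‖) * s < r
        rw [← show (0 : ℝ) = s from h7]; simpa using hr
      · have := (hheight s h7 h4).2
        have h8 : (c + ‖a‖) * s ≤ (c' + ‖a‖) * s := by gcongr
        change (c + ‖a‖) * s < r
        linarith
  have hDc : IsCompact D := by
    refine ((isCompact_closedBall x₀ r₀).prod
      ((isCompact_closedBall (0 : V) (N * s₂)).prod (isCompact_Icc (a := (0 : ℝ)) (b := s₂)))).of_isClosed_subset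
      ?_ ?_
    · have h1 : Continuous fun q : V × V × ℝ => q.2.2 := by fun_prop
      have h2 : Continuous fun q : V × V × ℝ => ‖q.2.1 - q.2.2 • a‖ := by fun_prop
      have h3 : Continuous fun q : V × V × ℝ => c * q.2.2 := by fun_prop
      exact (S.model.closed.preimage continuous_fst).inter
        ((isClosed_closedBall.preimage continuous_fst).inter
        ((isClosed_le continuous_const h1).inter
        ((isClosed_le h1 continuous_const).inter (isClosed_le h2 h3))))
    · rintro ⟨x, w, s⟩ ⟨h1, h2, h3, h4, h5⟩
      refine ⟨h2, ?_, h3, h4⟩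
      rw [mem_closedBall_zero_iff]
      refine (norm_le_of_norm_sub_smul_le h3 h5).trans ?_
      change N * s ≤ N * s₂
      gcongr
  set Φ : V × V × ℝ → ℝ := fun q => (if q.2.2 = 0 then 0 else ‖F (q.1 + q.2.1) - u q.1‖) -
    A * (q.2.2 ^ δ + ‖q.1 - x₀‖ ^ 2) with hΦ
  have hΦc : ContinuousOn Φ D := by
    refine (S.continuousOn_dist hac hDprop).sub (Continuous.continuousOn ?_)
    have h1 : Continuous fun q : V × V × ℝ => q.2.2 ^ δ :=
      (Real.continuous_rpow_const hδ0.le).comp (continuous_snd.comp continuous_snd)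
    fun_prop
  have hq₁ : (x₀, w₁, s₁) ∈ D := by
    refine ⟨⟨hx₀M, ?_⟩, mem_closedBall_self hr₀pos.le, hs₁.le, hs₁le.trans (min_le_left _ _), hw₁⟩
    rw [mem_closedBall, dist_eq_norm]; linarith
  obtain ⟨⟨x, w, s⟩, hq, hmax⟩ := hDc.exists_isMaxOn ⟨_, hq₁⟩ hΦc
  by_contra hcon
  push Not at hcon
  have hμ : 0 < Φ (x, w, s) := by
    refine lt_of_lt_of_le ?_ (hmax hq₁)
    simp only [hΦ, if_neg hs₁.ne', sub_self, norm_zero]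
    rw [zero_pow two_ne_zero, add_zero]
    linarith
  set μ := Φ (x, w, s) with hμdef
  obtain ⟨hxM, hxx₀, hs0, hss₂, hw⟩ := hq
  replace hxM : x ∈ M := hxM.1
  replace hxx₀ : ‖x - x₀‖ ≤ r₀ := by rw [← dist_eq_norm]; exact hxx₀
  change 0 ≤ s at hs0
  change s ≤ s₂ at hss₂
  change ‖w - s • a‖ ≤ c * s at hw
  -- `Φ ≤ 0` on the edge, so the maximum is attained at a positive height
  have hspos : 0 < s := by
    refine lt_of_le_of_ne hs0 fun h => ?_
    have h2 : μ ≤ 0 := by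
      simp only [hμdef, hΦ, ← h, if_pos]
      have : 0 ≤ A * ((0 : ℝ) ^ δ + ‖x - x₀‖ ^ 2) := by
        have : 0 ≤ (0 : ℝ) ^ δ := Real.rpow_nonneg le_rfl _
        positivity
      linarith
    linarith
  have hμeq : ‖F (x + w) - u x‖ = μ + A * (s ^ δ + ‖x - x₀‖ ^ 2) := by
    simp only [hμdef, hΦ, if_neg hspos.ne']
    ring
  obtain ⟨⟨e1, e2, e3, e4⟩, ⟨e5, e5', e6⟩, e7, e8, e9⟩ := hev s hspos hss₂
  obtain ⟨hsP, hsr₀⟩ := hheight s hspos hss₂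
  set P := s ^ (1 - δ) with hP
  have hP0 : 0 < P := by positivity
  set θ := s ^ (1 + δ) with hθ
  have hθ0 : 0 < θ := by positivity
  have hsδ : 0 < s ^ δ := by positivity
  rw [Real.rpow_one, one_mul] at e1
  have hθs : θ ≤ s := e1.trans (mul_le_of_le_one_left hs0 hκ1)
  set R : ℝ := (s ^ δ)⁻¹ with hR
  have hR3 : 3 ≤ R := by
    rw [hR, le_inv_comm₀ (by norm_num) hsδ]
    linarith
  have hRs : R * s = P := by
    rw [hR, hP, Real.rpow_sub hspos, Real.rpow_one, div_eq_mul_inv, mul_comm]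
  have hxp : ‖x - p‖ < 2 * r₀ := hball x (by rwa [mem_closedBall, dist_eq_norm])
  have hxr : x ∈ M ∩ ball p r := ⟨hxM, by rw [mem_ball, dist_eq_norm]; linarith⟩
  have hwn : ‖w - θ • a‖ ≤ N * s := by
    rw [show w - θ • a = (w - s • a) + (s - θ) • a by module]
    refine (norm_add_le _ _).trans ?_
    rw [norm_smul, Real.norm_eq_abs, abs_of_nonneg (by linarith)]
    have : (s - θ) * ‖a‖ ≤ ‖a‖ * s := by rw [mul_comm]; gcongr; linarith
    rw [hN, add_mul]
    linarith
  obtain ⟨τ₁, hτ₁, τ₂, hτ₂, hdec, hE₁, hE₂⟩ := S.model.decomp x hxr (w - θ • a)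
  have hE₁' : ‖τ₁‖ ≤ C * (N * s) := hE₁.trans (by gcongr)
  have hE₂' : ‖τ₂‖ ≤ C * (N * s) := hE₂.trans (by gcongr)
  have hKP : 3 * R * (C * (N * s)) = K * P := by rw [hK, ← hRs]; ring
  have hyx : ∀ y : V, ‖y - x‖ ≤ 3 * R * (C * (N * s)) + c * θ → ‖y - x‖ ≤ C₅ * P := by
    intro y hy
    rw [hKP] at hy
    refine hy.trans ?_
    rw [hC₅, add_mul]
    gcongr
    exact hθs.trans hsP
  have hyp : ∀ y : V, ‖y - x‖ ≤ C₅ * P → ‖y - p‖ < 5 / 2 * r₀ := by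
    intro y hy
    rw [show y - p = (y - x) + (x - p) by abel]
    exact (norm_add_le _ _).trans_lt (by linarith)
  have hx4 : x ∈ M ∩ ball p (4 * r₀) := ⟨hxM, by rw [mem_ball, dist_eq_norm]; linarith⟩
  have hheight' : ∀ s', 0 < s' → s' ≤ 2 * R * s → ∀ w', ‖w' - s' • a‖ ≤ c' * s' → ‖w'‖ ≤ r₀ := by
    intro s' hs' hs'R w' hw'
    refine (norm_le_of_norm_sub_smul_le hs'.le hw').trans ?_
    calc (c' + ‖a‖) * s' ≤ (c' + ‖a‖) * (2 * R * s) := by gcongr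
      _ = 2 * (c' + ‖a‖) * P := by rw [← hRs]; ring
      _ ≤ r₀ := e8
  have hbound' : ∀ y ∈ M ∩ ball p r, ‖y - x‖ ≤ C₅ * P → ∀ s', 0 < s' → s' ≤ 2 * R * s →
      ∀ w', ‖w' - s' • a‖ ≤ c' * s' → ‖F (y + w') - u x‖ ≤ 2 := by
    intro y hyr hy s' hs' hs'R w' hw'
    have hw'n := hheight' s' hs' hs'R w' hw'
    refine hbound x hx4 _ ⟨S.sub y hyr w' (S.cone.mem_of_norm_sub_le hac' hs' hw') (by linarith), ?_⟩
    rw [mem_ball, dist_eq_norm, show y + w' - p = (y - p) + w' by abel]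
    exact (norm_add_le _ _).trans_lt (by linarith [hyp y hy])
  have hle2 : ‖F (x + w) - u x‖ ≤ 2 := by
    refine hbound' x hxr (by rw [sub_self, norm_zero]; positivity) s hspos ?_ w
      (hw.trans (by gcongr))
    calc s ≤ P := hsP
      _ ≤ 2 * P := by linarith
      _ = 2 * R * s := by rw [← hRs]; ring
  -- the penalty `A * ‖x - x₀‖ ^ 2` keeps the maximum away from the boundary of the ball around `x₀`,
  -- so that the whole disc is over base points in that ball
  have hxx₀2 : ‖x - x₀‖ < r₀ / 2 := by
    by_contra h
    push Not at h
    have h1 : A * (r₀ / 2) ^ 2 ≤ A * ‖x - x₀‖ ^ 2 := by gcongr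
    have h2 : 0 < A * s ^ δ := by positivity
    rw [hμeq, mul_add] at hle2
    linarith
  -- maximality of `μ` bounds `F` on the diameter of the disc
  set b : ℝ := μ + A * (θ ^ δ + (‖x - x₀‖ ^ 2 + 3 * (C₅ * P))) + 2 * C * (C₅ * P) with hb
  have hb0 : 0 < b := by positivity
  have hbot : ∀ y ∈ M ∩ ball p r, ‖y - x‖ ≤ C₅ * P → ∀ w', ‖w' - θ • a‖ ≤ c * θ →
      ‖F (y + w') - u x‖ ≤ b := by
    intro y hyr hy' w' hw'
    have hyx₀ : ‖y - x₀‖ ≤ ‖x - x₀‖ + C₅ * P := by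
      rw [show y - x₀ = (x - x₀) + (y - x) by abel]
      exact (norm_add_le _ _).trans (by linarith)
    have hmem : (y, w', θ) ∈ D := by
      refine ⟨⟨hyr.1, ball_subset_closedBall hyr.2⟩, ?_, hθ0.le, hθs.trans hss₂, hw'⟩
      rw [mem_closedBall, dist_eq_norm]
      linarith
    have h1 : Φ (y, w', θ) ≤ μ := hmax hmem
    simp only [hΦ, if_neg hθ0.ne'] at h1
    have h2 := S.jets.norm_sub_le hC.le hα hxr hyr (hy'.trans (by linarith))
    have h3 : ‖y - x₀‖ ^ 2 ≤ ‖x - x₀‖ ^ 2 + 3 * (C₅ * P) := by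
      have h4 : 0 ≤ C₅ * P := by positivity
      have h5 : (2 * ‖x - x₀‖ + C₅ * P) * (C₅ * P) ≤ 3 * (C₅ * P) :=
        mul_le_mul_of_nonneg_right (by linarith) h4
      calc ‖y - x₀‖ ^ 2 ≤ (‖x - x₀‖ + C₅ * P) ^ 2 := by gcongr
        _ = ‖x - x₀‖ ^ 2 + (2 * ‖x - x₀‖ + C₅ * P) * (C₅ * P) := by ring
        _ ≤ _ := by linarith
    have h6 : A * (θ ^ δ + ‖y - x₀‖ ^ 2) ≤ A * (θ ^ δ + (‖x - x₀‖ ^ 2 + 3 * (C₅ * P))) := by gcongr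
    have h7 : 2 * C * ‖y - x‖ ≤ 2 * C * (C₅ * P) := by gcongr
    rw [show F (y + w') - u x = (F (y + w') - u y) + (u y - u x) by abel]
    exact (norm_add_le _ _).trans (by linarith)
  have hfin : ‖F (x + w) - u x‖ ≤ b + 3 / R * 2 := by
    rcases le_total b 2 with hb2 | hb2
    · have h1 := S.norm_sub_le_of_disc (g₀ := u x) (g₁ := 0) (R := R)
        (E := C * (N * s)) hxr hτ₁ hτ₂ hdec.symm hw hcc'.le hac'
        hc'.le hθ0 hθs
        (by calc c' * θ ≤ c' * (κ * s) := by gcongr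
              _ = (c' - c) * s := by rw [hκ]; field_simp)
        hE₁' hE₂' (by linarith) (by rw [hKP]; exact e2)
        (by
          rw [hKP, Real.mul_rpow hK0.le hP0.le, hP, ← Real.rpow_mul hs0, ← mul_assoc]
          exact e3)
        (by
          rw [hKP]
          have : c * θ ≤ c * P := by gcongr; exact hθs.trans hsP
          rw [hC₅, add_mul] at e4
          linarith)
        (by
          calc (c' + ‖a‖) * (2 * R * s) = 2 * (c' + ‖a‖) * P := by rw [← hRs]; ring
            _ < r := by linarith)
        hb0 hb2
        (fun σ y w' _ hyr _ hy hw' => by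
          rw [smul_zero, add_zero]
          exact hbot y hyr (hyx y hy) w' hw')
        (fun ζ y w' s' _ hyr hy hs' hs'R hw' => by
          rw [smul_zero, add_zero]
          exact hbound' y hyr (hyx y hy) s' hs' hs'R w' hw')
      rw [smul_zero, add_zero] at h1
      have hR0 : 0 < R := by linarith
      exact h1.trans (mul_div_rpow_le_add hb0 two_pos (by positivity) ((div_le_one hR0).2 hR3))
    · have : 0 ≤ 3 / R * 2 := by positivity
      linarith
  have hR' : 3 / R * 2 = 6 * s ^ δ := by rw [hR, div_inv_eq_mul]; ring
  rw [hR', hμeq, hb] at hfin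
  -- the terms with `θ ^ δ` and with the variation of the penalty each use up a quarter of `A * s ^ δ`
  have h1 : θ ^ δ ≤ 1 / 4 * s ^ δ := by
    rw [hθ, ← Real.rpow_mul hs0]; linarith
  have h2 : A * (3 * (C₅ * P)) ≤ A * (1 / 4 * s ^ δ) :=
    mul_le_mul_of_nonneg_left (by linarith) (by linarith)
  have h3 : A * θ ^ δ ≤ A * (1 / 4 * s ^ δ) := by gcongr
  have h4 : 48 * s ^ δ ≤ A * s ^ δ := by gcongr
  rw [mul_add, mul_add, mul_add] at hfin
  linarith

end

theorem HasEdgeRate.mono {V G : Type*} [NormedAddCommGroup V] [NormedSpace ℂ V]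
    [NormedAddCommGroup G] {M : Set V} {p : V} {u : V → G} {Γ : Set V} {F : V → G} {β β' : ℝ}
    (h : HasEdgeRate M p u Γ F β) (hβ : β' ≤ β) :
    HasEdgeRate M p u Γ F β' := by
  intro a c hc hac
  obtain ⟨A, hA, s₀, hs₀, h⟩ := h a c hc hac
  refine ⟨A, hA, min s₀ 1, by positivity, ?_⟩
  rintro x ⟨hxM, hx⟩ w s hs hss₀ hw
  refine (h x ⟨hxM, ball_subset_ball (min_le_left _ _) hx⟩ w s hs
    (hss₀.trans (min_le_left _ _)) hw).trans ?_
  gcongr A * ?_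
  exact Real.rpow_le_rpow_of_exponent_ge hs (hss₀.trans (min_le_right _ _)) hβ

section

variable {V G : Type*} [NormedAddCommGroup V] [NormedSpace ℂ V] [NormedAddCommGroup G]
  [NormedSpace ℂ G] {α C r : ℝ} {M : Set V} {T : V → Submodule ℝ V} {p : V} {u : V → G}
  {ℓ : V → V →L[ℝ] G} {Γ W : Set V} {F : V → G}

theorem norm_sub_smul_le_of_height {a w : V} {c s θ : ℝ} (hθ : 0 ≤ θ) (hθs : θ ≤ s)
    (hw : ‖w - s • a‖ ≤ c * s) : ‖w - θ • a‖ ≤ (c + ‖a‖) * s := by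
  rw [show w - θ • a = (w - s • a) + (s - θ) • a by module]
  refine (norm_add_le _ _).trans ?_
  rw [norm_smul, Real.norm_eq_abs, abs_of_nonneg (by linarith)]
  have : (s - θ) * ‖a‖ ≤ ‖a‖ * s := by rw [mul_comm]; gcongr; linarith
  rw [add_mul]
  linarith

/-- The gain from discs of radius comparable to the height. If `F` approaches `u` at the rate
`s ^ β`, and if `u` agrees along the edge of the disc with a function that is affine along the disc
up to `O (s ^ γ)`, then `F (x + w)` agrees with the latter up to `O (s ^ ((3 γ + β) / 4))`: the
diameter of the disc is at height `O (s ^ (1 + α))`. -/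
theorem EdgeSetting.exists_norm_sub_affine_le (S : EdgeSetting α C r M T p u ℓ Γ W F)
    {β γ : ℝ} (hrate : HasEdgeRate M p u Γ F β) (hβ : 0 < β) (hβγ : β ≤ γ) (hγ : γ ≤ (1 + α) * β)
    {a : V} {c c' B D : ℝ} (hc : 0 < c) (hcc' : c < c') (hac' : closedBall a c' ⊆ Γ)
    (hB : 0 < B) (hD : 0 ≤ D) :
    ∃ A ≥ 0, ∃ s₀ > 0, s₀ ≤ 1 ∧ ∀ x ∈ M ∩ ball p s₀, ∀ (w : V) (s : ℝ), 0 < s → s ≤ s₀ →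
      ‖w - s • a‖ ≤ c * s → C * (36 * B) ^ (1 + α) / c * s ^ (1 + α) ≤ s ∧
      ∀ τ₁ ∈ T x, ∀ τ₂ ∈ T x,
        τ₁ + Complex.I • τ₂ = w - (C * (36 * B) ^ (1 + α) / c * s ^ (1 + α)) • a →
        ‖τ₁‖ ≤ B * s → ‖τ₂‖ ≤ B * s → ∀ g₀ g₁ : G,
        (∀ y ∈ M ∩ ball p r, ∀ σ : ℝ, |σ| ≤ 12 →
          ‖y - (x + (τ₁ + σ • τ₂))‖ ≤ C * (36 * B) ^ (1 + α) * s ^ (1 + α) →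
          ‖y - x‖ ≤ (36 * B + c) * s → ‖u y - (g₀ + σ • g₁)‖ ≤ D * s ^ γ) →
        (∀ y ∈ M ∩ ball p r, ∀ ζ : ℂ, ‖ζ‖ ≤ 12 →
          ‖y - x‖ ≤ (36 * B + c) * s → ‖u y - (g₀ + ζ • g₁)‖ ≤ D * s ^ β) →
        ‖F (x + w) - (g₀ + Complex.I • g₁)‖ ≤ A * s ^ ((3 * γ + β) / 4) := by
  have hC : 0 < C := one_pos.trans_le S.one_le
  have hα := S.α_pos
  have hr := S.r_pos
  have hc' : 0 < c' := hc.trans hcc'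
  obtain ⟨A, hA, s₁, hs₁, hrate⟩ := hrate a c' hc' hac'
  set C₆ : ℝ := C * (36 * B) ^ (1 + α) / c with hC₆
  have hC₆0 : 0 < C₆ := by positivity
  have hC₆c : c * C₆ = C * (36 * B) ^ (1 + α) := by rw [hC₆]; field_simp
  set κ : ℝ := (c' - c) / c' with hκ
  have hκ0 : 0 < κ := div_pos (by linarith) hc'
  have hκ1 : κ ≤ 1 := by rw [hκ, div_le_one hc']; linarith
  have hmin : 0 < min r s₁ := lt_min hr hs₁
  obtain ⟨s₂, hs₂, hev⟩ := exists_pos_forall_of_eventually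
    (((eventually_mul_rpow_le (by linarith : (1 : ℝ) < 1 + α) C₆ hκ0).and
    (eventually_mul_le_const (36 * B) hr)).and
    ((eventually_mul_le_const (36 * B + c) (by positivity : 0 < min r s₁ / 4)).and
    ((eventually_mul_le_const ((c' + ‖a‖) * 24) (by positivity : 0 < r / 2)).and
    ((eventually_mul_le_const 24 hs₁).and (eventually_mul_le_const 1 one_pos)))))
  set Q : ℝ := A * C₆ ^ β + A * 24 ^ β + D + 1 with hQ
  have hQ0 : 0 < Q := by positivity
  set s₀ : ℝ := min (min s₂ (min r s₁ / 4)) 1 with hs₀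
  have hs₀s₂ : s₀ ≤ s₂ := (min_le_left _ _).trans (min_le_left _ _)
  have hs₀r : s₀ ≤ min r s₁ / 4 := (min_le_left _ _).trans (min_le_right _ _)
  have hs₀1 : s₀ ≤ 1 := min_le_right _ _
  refine ⟨Q, hQ0.le, s₀, by positivity, hs₀1, ?_⟩
  rintro x ⟨hxM, hx⟩ w s hs hss₀ hw
  obtain ⟨⟨e1, e2⟩, e3, e4, e5, e6⟩ := hev s hs (hss₀.trans hs₀s₂)
  rw [Real.rpow_one] at e1
  set θ : ℝ := C₆ * s ^ (1 + α) with hθ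
  have hθ0 : 0 < θ := by positivity
  have hθs : θ ≤ s := e1.trans (mul_le_of_le_one_left hs.le hκ1)
  refine ⟨hθs, ?_⟩
  intro τ₁ hτ₁ τ₂ hτ₂ hdec hE₁ hE₂ g₀ g₁ hbot htop
  have hxp : ‖x - p‖ < min r s₁ / 4 := by
    rw [mem_ball, dist_eq_norm] at hx
    linarith
  have hminr : min r s₁ ≤ r := min_le_left _ _
  have hmins₁ : min r s₁ ≤ s₁ := min_le_right _ _
  have hxr : x ∈ M ∩ ball p r := ⟨hxM, by rw [mem_ball, dist_eq_norm]; linarith⟩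
  have hcθ : c * θ ≤ c * s := by gcongr
  have hcθ' : c * θ = C * (36 * B) ^ (1 + α) * s ^ (1 + α) := by rw [hθ, ← mul_assoc, hC₆c]
  have h36 : 3 * 12 * (B * s) = 36 * B * s := by ring
  have hysub : ∀ y : V, ‖y - x‖ ≤ 3 * 12 * (B * s) + c * θ → ‖y - x‖ ≤ (36 * B + c) * s := by
    intro y hy
    rw [h36] at hy
    rw [add_mul]
    linarith
  have hys₁ : ∀ y ∈ M ∩ ball p r, ‖y - x‖ ≤ (36 * B + c) * s → y ∈ M ∩ ball p s₁ := by
    intro y hyM hy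
    refine ⟨hyM.1, ?_⟩
    rw [mem_ball, dist_eq_norm, show y - p = (y - x) + (x - p) by abel]
    exact (norm_add_le _ _).trans_lt (by linarith)
  have hs1 : s ≤ 1 := by linarith
  -- a disc of radius `12` gives the exponent `3 / 12 = 1 / 4` in the two-constants inequality
  have hmain := S.norm_sub_le_of_disc (g₀ := g₀) (g₁ := g₁) (R := 12) (E := B * s) (θ := θ) (s := s)
    (b := Q * s ^ γ) (t := Q * s ^ β) hxr hτ₁ hτ₂ hdec hw hcc'.le hac' hc'.le hθ0 hθs
    (by calc c' * θ ≤ c' * (κ * s) := by gcongr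
          _ = (c' - c) * s := by rw [hκ]; field_simp)
    hE₁ hE₂ (by norm_num) (by rw [h36]; exact e2)
    (by rw [h36, Real.mul_rpow (by positivity) hs.le, hcθ', mul_assoc])
    (by rw [h36]; rw [add_mul] at e3; linarith)
    (by calc (c' + ‖a‖) * (2 * 12 * s) = (c' + ‖a‖) * 24 * s := by ring
          _ < r := by linarith)
    (by positivity)
    (by gcongr Q * ?_; exact Real.rpow_le_rpow_of_exponent_ge hs hs1 hβγ)
    (fun σ y w' hσ hyr hyτ hy hw' => by
      have hy' := hysub y hy
      have h1 := hrate y (hys₁ y hyr hy') w' θ hθ0 (by linarith)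
        (hw'.trans (by gcongr))
      have h2 := hbot y hyr σ hσ (hyτ.trans_eq hcθ') hy'
      have h3 : A * θ ^ β ≤ A * C₆ ^ β * s ^ γ := by
        rw [hθ, Real.mul_rpow hC₆0.le (by positivity), ← Real.rpow_mul hs.le, ← mul_assoc]
        gcongr A * C₆ ^ β * ?_
        exact Real.rpow_le_rpow_of_exponent_ge hs hs1 hγ
      have h4 : 0 ≤ A * 24 ^ β * s ^ γ := by positivity
      have h5 : 0 ≤ s ^ γ := by positivity
      rw [show F (y + w') - (g₀ + σ • g₁) = (F (y + w') - u y) + (u y - (g₀ + σ • g₁)) by abel]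
      refine (norm_add_le _ _).trans ?_
      rw [hQ, add_mul, add_mul, add_mul, one_mul]
      linarith)
    (fun ζ y w' s' hζ hyr hy hs' hs's hw' => by
      have hy' := hysub y hy
      have hs's' : s' ≤ 24 * s := by linarith
      have h1 := hrate y (hys₁ y hyr hy') w' s' hs' (by linarith) hw'
      have h2 := htop y hyr ζ hζ hy'
      have h3 : A * s' ^ β ≤ A * 24 ^ β * s ^ β := by
        rw [mul_assoc, ← Real.mul_rpow (by norm_num) hs.le]
        gcongr
      have h4 : 0 ≤ A * C₆ ^ β * s ^ β := by positivity
      have h5 : 0 ≤ s ^ β := by positivity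
      rw [show F (y + w') - (g₀ + ζ • g₁) = (F (y + w') - u y) + (u y - (g₀ + ζ • g₁)) by abel]
      refine (norm_add_le _ _).trans ?_
      rw [hQ, add_mul, add_mul, add_mul, one_mul]
      linarith)
  refine hmain.trans_eq ?_
  rw [mul_div_mul_left _ _ hQ0.ne', ← Real.rpow_sub hs, ← Real.rpow_mul hs.le, mul_assoc,
    ← Real.rpow_add hs]
  congr 2
  ring

/-- Improvement of the rate of approach, as long as it is below the Lipschitz rate. -/
theorem EdgeSetting.hasEdgeRate_improve [ProperSpace V] (S : EdgeSetting α C r M T p u ℓ Γ W F)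
    {β γ : ℝ} (hrate : HasEdgeRate M p u Γ F β) (hβ : 0 < β) (hβγ : β ≤ γ) (hγ : γ ≤ (1 + α) * β)
    (hγ1 : γ ≤ 1) : HasEdgeRate M p u Γ F ((3 * γ + β) / 4) := by
  intro a c hc hac
  have hC : 0 < C := one_pos.trans_le S.one_le
  obtain ⟨c', hcc', hac'⟩ := exists_closedBall_subset_of_lt S.cone.1 hc.le hac
  have hB : 0 < C * (c + ‖a‖) := by positivity
  obtain ⟨A, hA, s₀, hs₀, hs₀1, h⟩ := S.exists_norm_sub_affine_le hrate hβ hβγ hγ hc hcc' hac' hB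
    (D := 2 * C * (36 * (C * (c + ‖a‖)) + c)) (by positivity)
  obtain ⟨s₁, hs₁, hs₁'⟩ := exists_pos_forall_of_eventually
    (eventually_mul_le_const (36 * (C * (c + ‖a‖)) + c) one_pos)
  have hr := S.r_pos
  refine ⟨A, hA, min (min s₀ s₁) r, by positivity, ?_⟩
  rintro x ⟨hxM, hx⟩ w s hs hss₀ hw
  have hmin₀ : min (min s₀ s₁) r ≤ s₀ := (min_le_left _ _).trans (min_le_left _ _)
  have hmin₁ : min (min s₀ s₁) r ≤ s₁ := (min_le_left _ _).trans (min_le_right _ _)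
  have hxr : x ∈ M ∩ ball p r := ⟨hxM, ball_subset_ball (min_le_right _ _) hx⟩
  obtain ⟨hθs, h⟩ := h x ⟨hxM, ball_subset_ball hmin₀ hx⟩ w s hs (hss₀.trans hmin₀) hw
  have e := hs₁' s hs (hss₀.trans hmin₁)
  set θ : ℝ := C * (36 * (C * (c + ‖a‖))) ^ (1 + α) / c * s ^ (1 + α) with hθ
  have hθ0 : 0 ≤ θ := by positivity
  obtain ⟨τ₁, hτ₁, τ₂, hτ₂, hdec, hE₁, hE₂⟩ := S.model.decomp x hxr (w - θ • a)
  have hwθ := norm_sub_smul_le_of_height hθ0 hθs hw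
  have hs1 : s ≤ 1 := (hss₀.trans hmin₀).trans hs₀1
  have hlip : ∀ y ∈ M ∩ ball p r, ‖y - x‖ ≤ (36 * (C * (c + ‖a‖)) + c) * s → ∀ δ : ℝ, δ ≤ 1 →
      ‖u y - u x‖ ≤ 2 * C * (36 * (C * (c + ‖a‖)) + c) * s ^ δ := by
    intro y hy hyx δ hδ
    refine (S.jets.norm_sub_le hC.le S.α_pos hxr hy (by linarith)).trans ?_
    rw [mul_assoc (2 * C)]
    gcongr 2 * C * ?_
    refine hyx.trans ?_
    gcongr _ * ?_
    have := Real.rpow_le_rpow_of_exponent_ge hs hs1 hδ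
    simpa using this
  have := h τ₁ hτ₁ τ₂ hτ₂ hdec.symm
    (hE₁.trans (by rw [mul_assoc]; gcongr)) (hE₂.trans (by rw [mul_assoc]; gcongr)) (u x) 0
    (fun y hy σ _ _ hyx => by rw [smul_zero, add_zero]; exact hlip y hy hyx γ hγ1)
    (fun y hy ζ _ hyx => by rw [smul_zero, add_zero]; exact hlip y hy hyx β (hβγ.trans hγ1))
  rwa [smul_zero, add_zero] at this

/-- The function `F` approaches its boundary values at a rate almost as good as the Lipschitz
rate. -/
theorem EdgeSetting.hasEdgeRate [ProperSpace V] (S : EdgeSetting α C r M T p u ℓ Γ W F) :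
    HasEdgeRate M p u Γ F (1 - α / 4) := by
  have hα := S.α_pos
  have hα1 := S.α_lt
  -- each improvement gains at least `g`
  set g : ℝ := min (3 * α ^ 2 / 16) (3 * α / 16) with hg
  have hg0 : 0 < g := by positivity
  have key : ∀ k : ℕ, HasEdgeRate M p u Γ F (min (α / 4 + k * g) (1 - α / 4)) := by
    intro k
    induction k with
    | zero =>
      refine S.hasEdgeRate_quarter.mono ((min_le_left _ _).trans ?_)
      simp
    | succ k ih =>
      set β := min (α / 4 + k * g) (1 - α / 4) with hβ
      have hβ4 : α / 4 ≤ β := by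
        refine le_min ?_ (by linarith)
        have : 0 ≤ k * g := by positivity
        linarith
      have hβ1 : β ≤ 1 - α / 4 := min_le_right _ _
      have hβ0 : 0 < β := by linarith
      have h1 := S.hasEdgeRate_improve (γ := min ((1 + α) * β) 1) ih hβ0
        (le_min (by nlinarith) (by linarith)) (min_le_left _ _) (min_le_right _ _)
      refine h1.mono ?_
      have h2 : g ≤ 3 * α ^ 2 / 16 := min_le_left _ _
      have h3 : g ≤ 3 * α / 16 := min_le_right _ _
      have h4 : β + g ≤ (3 * min ((1 + α) * β) 1 + β) / 4 := by
        rcases min_cases ((1 + α) * β) 1 with ⟨h5, -⟩ | ⟨h5, -⟩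
        · rw [h5]; nlinarith
        · rw [h5]; linarith
      refine le_trans ?_ h4
      push_cast
      rcases min_cases (α / 4 + k * g) (1 - α / 4) with ⟨h5, -⟩ | ⟨h5, -⟩
      · rw [hβ, h5]
        refine (min_le_left _ _).trans (le_of_eq ?_)
        ring
      · rw [hβ, h5]
        exact (min_le_right _ _).trans (by linarith)
  obtain ⟨k, hk⟩ := exists_nat_gt ((1 - α / 4) / g)
  have h1 := key k
  rw [div_lt_iff₀ hg0] at hk
  rwa [min_eq_right (by linarith)] at h1

/-- First-order expansion of `F` at the edge: with `w = τ₁ + i τ₂`, the linear part at `x` is the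
complex linear extension `ℓ x τ₁ + i ℓ x τ₂` of the differential of `u` along the edge. -/
theorem EdgeSetting.exists_norm_sub_jet_le [ProperSpace V] (S : EdgeSetting α C r M T p u ℓ Γ W F)
    {a : V} {c B : ℝ} (hc : 0 < c) (hac : closedBall a c ⊆ Γ) (hB : 0 < B) :
    ∃ A ≥ 0, ∃ s₀ > 0, ∀ x ∈ M ∩ ball p s₀, ∀ (w : V) (s : ℝ), 0 < s → s ≤ s₀ →
      ‖w - s • a‖ ≤ c * s → ∀ τ₁ ∈ T x, ∀ τ₂ ∈ T x, τ₁ + Complex.I • τ₂ = w →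
        ‖τ₁‖ ≤ B * s → ‖τ₂‖ ≤ B * s →
        ‖F (x + w) - u x - (ℓ x τ₁ + Complex.I • ℓ x τ₂)‖ ≤ A * s ^ (1 + α / 4) := by
  have hC : 0 < C := one_pos.trans_le S.one_le
  have hα := S.α_pos
  have hα1 := S.α_lt
  obtain ⟨c', hcc', hac'⟩ := exists_closedBall_subset_of_lt S.cone.1 hc.le hac
  set B' : ℝ := B + C * ‖a‖ with hB'
  have hB'0 : 0 < B' := by positivity
  set C' : ℝ := 36 * B' + c with hC'
  have hC'0 : 0 < C' := by positivity
  set C₇ : ℝ := C * (36 * B') ^ (1 + α) with hC₇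
  have hC₇0 : 0 < C₇ := by positivity
  set D : ℝ := C * C' ^ (1 + α) + C * C₇ + 2 * C * C' + 13 * (C * B') with hD
  obtain ⟨A, hA, s₀, hs₀, hs₀1, h⟩ := S.exists_norm_sub_affine_le S.hasEdgeRate
    (by linarith : 0 < 1 - α / 4) (by linarith : 1 - α / 4 ≤ 1 + α / 2) (by nlinarith)
    hc hcc' hac' hB'0 (D := D) (by positivity)
  obtain ⟨s₁, hs₁, hs₁'⟩ := exists_pos_forall_of_eventually (eventually_mul_le_const C' one_pos)
  have hr := S.r_pos
  refine ⟨A + 2 * (C * (C₇ / c * (C * ‖a‖))), by positivity, min (min s₀ s₁) r, by positivity, ?_⟩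
  rintro x ⟨hxM, hx⟩ w s hs hss₀ hw τ₁ hτ₁ τ₂ hτ₂ hdec hE₁ hE₂
  have hmin₀ : min (min s₀ s₁) r ≤ s₀ := (min_le_left _ _).trans (min_le_left _ _)
  have hmin₁ : min (min s₀ s₁) r ≤ s₁ := (min_le_left _ _).trans (min_le_right _ _)
  have hxr : x ∈ M ∩ ball p r := ⟨hxM, ball_subset_ball (min_le_right _ _) hx⟩
  obtain ⟨hθs, h⟩ := h x ⟨hxM, ball_subset_ball hmin₀ hx⟩ w s hs (hss₀.trans hmin₀) hw
  have e := hs₁' s hs (hss₀.trans hmin₁)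
  have hs1 : s ≤ 1 := (hss₀.trans hmin₀).trans hs₀1
  set θ : ℝ := C₇ / c * s ^ (1 + α) with hθ
  have hθ0 : 0 ≤ θ := by positivity
  -- the disc needs a decomposition of `w - θ a`, which comes from those of `w` and `a`
  obtain ⟨α₁, hα₁, α₂, hα₂, hadec, hα₁n, hα₂n⟩ := S.model.decomp x hxr a
  have hτ' : ∀ τ κ : V, ‖τ‖ ≤ B * s → ‖κ‖ ≤ C * ‖a‖ → ‖τ - θ • κ‖ ≤ B' * s := by
    intro τ κ h1 h2
    refine (norm_sub_le _ _).trans ?_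
    rw [norm_smul, Real.norm_eq_abs, abs_of_nonneg hθ0, hB', add_mul]
    have : θ * ‖κ‖ ≤ s * (C * ‖a‖) := by gcongr
    linarith
  have hℓ : ∀ v, ‖ℓ x v‖ ≤ C * ‖v‖ := fun v =>
    ((ℓ x).le_opNorm v).trans (mul_le_mul_of_nonneg_right (S.jets.bound x hxr) (norm_nonneg _))
  have hpow : ∀ δ ≤ 1 + α, s ^ (1 + α) ≤ s ^ δ := fun δ hδ =>
    Real.rpow_le_rpow_of_exponent_ge hs hs1 hδ
  have hpow' : s ≤ s ^ (1 - α / 4) := by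
    have := Real.rpow_le_rpow_of_exponent_ge hs hs1 (by linarith : 1 - α / 4 ≤ 1)
    simpa using this
  have hn₁ := hτ' τ₁ α₁ hE₁ hα₁n
  have hn₂ := hτ' τ₂ α₂ hE₂ hα₂n
  have hmain := h (τ₁ - θ • α₁) ((T x).sub_mem hτ₁ ((T x).smul_mem _ hα₁))
    (τ₂ - θ • α₂) ((T x).sub_mem hτ₂ ((T x).smul_mem _ hα₂))
    (by
      conv_rhs => rw [← hdec, hadec]
      rw [smul_sub, smul_add, smul_comm Complex.I θ]
      abel)
    hn₁ hn₂ (u x + ℓ x (τ₁ - θ • α₁)) (ℓ x (τ₂ - θ • α₂))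
    (fun y hy σ _ hyτ hyx => by
      have h1 := S.jets.taylor x hxr y hy
      have h2 := hℓ (y - (x + ((τ₁ - θ • α₁) + σ • (τ₂ - θ • α₂))))
      have h3 : ‖y - x‖ ^ (1 + α) ≤ C' ^ (1 + α) * s ^ (1 + α) := by
        rw [← Real.mul_rpow hC'0.le hs.le]
        gcongr
      have h4 : u y - (u x + ℓ x (τ₁ - θ • α₁) + σ • ℓ x (τ₂ - θ • α₂)) =
          (u y - u x - ℓ x (y - x)) + ℓ x (y - (x + ((τ₁ - θ • α₁) + σ • (τ₂ - θ • α₂)))) := by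
        simp only [map_sub, map_add, map_smul]
        abel
      rw [h4]
      refine (norm_add_le _ _).trans ?_
      have h5 : C * ‖y - x‖ ^ (1 + α) ≤ C * C' ^ (1 + α) * s ^ (1 + α / 2) := by
        rw [mul_assoc]
        gcongr C * ?_
        exact h3.trans (by gcongr _ * ?_; exact hpow _ (by linarith))
      have h6 : C * ‖y - (x + ((τ₁ - θ • α₁) + σ • (τ₂ - θ • α₂)))‖ ≤
          C * C₇ * s ^ (1 + α / 2) := by
        rw [mul_assoc]
        gcongr C * ?_
        exact hyτ.trans (by gcongr _ * ?_; exact hpow _ (by linarith))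
      have h7 : 0 ≤ (2 * C * C' + 13 * (C * B')) * s ^ (1 + α / 2) := by positivity
      rw [hD, add_assoc (C * C' ^ (1 + α) + C * C₇), add_mul, add_mul]
      linarith)
    (fun y hy ζ hζ hyx => by
      have h1 := S.jets.norm_sub_le hC.le hα hxr hy (by linarith)
      have h2 : ‖ℓ x (τ₁ - θ • α₁)‖ ≤ C * (B' * s) := (hℓ _).trans (by gcongr)
      have h3 : ‖ζ • ℓ x (τ₂ - θ • α₂)‖ ≤ 12 * (C * (B' * s)) := by
        rw [norm_smul]
        exact mul_le_mul hζ ((hℓ _).trans (by gcongr)) (norm_nonneg _) (by norm_num)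
      have h4 : 2 * C * ‖y - x‖ ≤ 2 * C * (C' * s) := by gcongr
      have h5 : u y - (u x + ℓ x (τ₁ - θ • α₁) + ζ • ℓ x (τ₂ - θ • α₂)) =
        (u y - u x) - ℓ x (τ₁ - θ • α₁) - ζ • ℓ x (τ₂ - θ • α₂) := by abel
      rw [h5]
      have h6 : D * s ≤ D * s ^ (1 - α / 4) := by gcongr
      have h7 : 0 ≤ (C * C' ^ (1 + α) + C * C₇) * s := by positivity
      refine (norm_sub_le _ _).trans ((add_le_add ((norm_sub_le _ _).trans
        (add_le_add (h1.trans h4) h2)) h3).trans (le_trans ?_ h6))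
      rw [hD, add_assoc (C * C' ^ (1 + α) + C * C₇), add_mul (C * C' ^ (1 + α) + C * C₇)]
      have h8 : (2 * C * C' + 13 * (C * B')) * s =
        2 * C * (C' * s) + C * (B' * s) + 12 * (C * (B' * s)) := by ring
      linarith)
  have h1 : F (x + w) - u x - (ℓ x τ₁ + Complex.I • ℓ x τ₂) =
      (F (x + w) - (u x + ℓ x (τ₁ - θ • α₁) + Complex.I • ℓ x (τ₂ - θ • α₂))) -
        (θ • ℓ x α₁ + Complex.I • θ • ℓ x α₂) := by
    simp only [map_sub, map_smul, smul_sub]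
    abel
  have h2 : ‖θ • ℓ x α₁ + Complex.I • θ • ℓ x α₂‖ ≤ 2 * (C * (C₇ / c * (C * ‖a‖))) * s ^ (1 + α / 4) := by
    have h3 : ∀ κ : V, ‖κ‖ ≤ C * ‖a‖ → ‖θ • ℓ x κ‖ ≤ C * (C₇ / c * (C * ‖a‖)) * s ^ (1 + α / 4) := by
      intro κ hκ
      rw [norm_smul, Real.norm_eq_abs, abs_of_nonneg hθ0]
      calc θ * ‖ℓ x κ‖ ≤ θ * (C * (C * ‖a‖)) := by gcongr; exact (hℓ κ).trans (by gcongr)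
        _ = C * (C₇ / c * (C * ‖a‖)) * s ^ (1 + α) := by rw [hθ]; ring
        _ ≤ _ := by gcongr _ * ?_; exact hpow _ (by linarith)
    refine (norm_add_le _ _).trans ?_
    rw [norm_smul Complex.I, Complex.norm_I, one_mul]
    linarith [h3 α₁ hα₁n, h3 α₂ hα₂n]
  rw [h1, add_mul]
  refine (norm_sub_le _ _).trans (add_le_add (hmain.trans ?_) h2)
  gcongr A * ?_
  exact Real.rpow_le_rpow_of_exponent_ge hs hs1 (by linarith)

end

/-! ### Regularity up to the edge -/

/-- `F` is strictly of class `C^1` at the point `x` of the edge `S`, on the wedge with directions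
the cone around `a` of aperture `c`, with boundary values `u` and complex linear differential `L`:
on the wedge the differential of `F` tends to `L` at `x`, the function `F` has first-order
expansions at the points of the edge which are uniform near `x`, and `u` is strictly differentiable
along `S` at `x` with differential `L`. -/
def IsC1AtEdge {E G : Type*} [NormedAddCommGroup E] [NormedSpace ℂ E] [NormedAddCommGroup G]
    [NormedSpace ℂ G] (F u : E → G) (L : E →L[ℂ] G) (S : Set E) (x a : E) (c : ℝ) : Prop :=
  ∀ η > 0, ∃ δ > 0,
    (∀ y ∈ S ∩ ball x δ, ∀ (w : E) (t : ℝ), 0 < t → t < δ → ‖w - t • a‖ ≤ c * t →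
      DifferentiableAt ℂ F (y + w) ∧ ‖fderiv ℂ F (y + w) - L‖ ≤ η ∧
        ‖F (y + w) - u y - L w‖ ≤ η * t) ∧
    ∀ y ∈ S ∩ ball x δ, ∀ y' ∈ S ∩ ball x δ, ‖u y - u y' - L (y - y')‖ ≤ η * ‖y - y'‖

/-- Cauchy's estimate for the differential of a bounded holomorphic map. -/
theorem norm_fderiv_le_of_norm_le {E G : Type*} [NormedAddCommGroup E] [NormedSpace ℂ E]
    [NormedAddCommGroup G] [NormedSpace ℂ G] {f : E → G} {z : E} {ρ B : ℝ} (hρ : 0 < ρ)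
    (hf : DifferentiableOn ℂ f (ball z ρ)) (hB : ∀ y ∈ ball z ρ, ‖f y‖ ≤ B) :
    ‖fderiv ℂ f z‖ ≤ 2 * B / ρ := by
  refine Complex.norm_fderiv_le_div_of_mapsTo_ball hf (fun y hy => ?_) hρ
  rw [mem_closedBall, dist_eq_norm]
  refine (norm_sub_le _ _).trans ?_
  linarith [hB y hy, hB z (mem_ball_self hρ)]

/-- The differential of a holomorphic function of several variables is continuous. -/
theorem continuousAt_fderiv_of_differentiableOn {E G : Type*} [NormedAddCommGroup E]
    [NormedSpace ℂ E] [NormedAddCommGroup G] [NormedSpace ℂ G] {f : E → G} {W : Set E}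
    (hf : DifferentiableOn ℂ f W) (hW : IsOpen W) {z : E} (hz : z ∈ W) :
    ContinuousAt (fderiv ℂ f) z := by
  have hd : ∀ y ∈ W, DifferentiableAt ℂ f y := fun y hy => hf.differentiableAt (hW.mem_nhds hy)
  obtain ⟨ρ, hρ, hρW, hB⟩ : ∃ ρ > 0, ball z (2 * ρ) ⊆ W ∧ ∀ y ∈ ball z (2 * ρ), ‖f y‖ ≤ ‖f z‖ + 1 := by
    have h1 : ∀ᶠ y in 𝓝 z, ‖f y‖ < ‖f z‖ + 1 :=
      (hd z hz).continuousAt.norm.eventually_lt continuousAt_const (by simp)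
    obtain ⟨ρ, hρ, h2⟩ := Metric.mem_nhds_iff.1 (inter_mem (hW.mem_nhds hz) h1)
    refine ⟨ρ / 2, by positivity, ?_, ?_⟩
    · rw [mul_div_cancel₀ _ two_ne_zero]; exact h2.trans inter_subset_left
    · rw [mul_div_cancel₀ _ two_ne_zero]; exact fun y hy => (h2 hy).2.le
  set K := 2 * (‖f z‖ + 1) / ρ with hK
  have hK0 : 0 ≤ K := by positivity
  have hK' : ∀ y ∈ ball z ρ, ‖fderiv ℂ f y‖ ≤ K := fun y hy => by
    have hsub : ball y ρ ⊆ ball z (2 * ρ) :=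
      ball_subset_ball' (by rw [mem_ball] at hy; linarith)
    exact norm_fderiv_le_of_norm_le hρ (hf.mono (hsub.trans hρW)) fun y' hy' => hB y' (hsub hy')
  have hLip : ∀ y ∈ ball z ρ, ∀ y' ∈ ball z ρ, ‖f y' - f y‖ ≤ K * ‖y' - y‖ := fun y hy y' hy' =>
    (convex_ball z ρ).norm_image_sub_le_of_norm_fderiv_le (𝕜 := ℂ)
      (fun x hx => hd x (hρW (ball_subset_ball (by linarith) hx))) hK' hy hy'
  have key : ∀ h : E, ‖h‖ < ρ / 2 → ‖fderiv ℂ f (z + h) - fderiv ℂ f z‖ ≤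
      2 * (K * ‖h‖) / (ρ / 2) := by
    intro h hh
    have hin : ∀ y ∈ ball z (ρ / 2), y ∈ ball z ρ ∧ y + h ∈ ball z ρ := by
      intro y hy
      rw [mem_ball, dist_eq_norm] at hy
      refine ⟨by rw [mem_ball, dist_eq_norm]; linarith, ?_⟩
      rw [mem_ball, dist_eq_norm, show y + h - z = (y - z) + h by abel]
      exact (norm_add_le _ _).trans_lt (by linarith)
    have hd' : ∀ y ∈ ball z (ρ / 2), HasFDerivAt (fun y => f (y + h) - f y)
        (fderiv ℂ f (y + h) - fderiv ℂ f y) y := by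
      intro y hy
      obtain ⟨h1, h2⟩ := hin y hy
      refine HasFDerivAt.sub ?_ (hd y (hρW (ball_subset_ball (by linarith) h1))).hasFDerivAt
      have h3 := (hd (y + h) (hρW (ball_subset_ball (by linarith) h2))).hasFDerivAt
      exact (hasFDerivAt_comp_add_right h).2 h3
    have h1 := norm_fderiv_le_of_norm_le (f := fun y => f (y + h) - f y) (z := z) (ρ := ρ / 2)
      (B := K * ‖h‖) (by positivity)
      (fun y hy => (hd' y hy).differentiableAt.differentiableWithinAt)
      (fun y hy => by
        have := hLip y (hin y hy).1 (y + h) (hin y hy).2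
        rwa [add_sub_cancel_left] at this)
    rwa [(hd' z (mem_ball_self (by positivity))).fderiv] at h1
  rw [Metric.continuousAt_iff]
  intro ε hε
  refine ⟨min (ρ / 2) (ε / (4 * K / ρ + 1)), by positivity, fun {y} hy => ?_⟩
  rw [dist_eq_norm] at hy ⊢
  have h1 := key (y - z) (hy.trans_le (min_le_left _ _))
  rw [add_sub_cancel] at h1
  refine h1.trans_lt ?_
  have h2 : ‖y - z‖ < ε / (4 * K / ρ + 1) := hy.trans_le (min_le_right _ _)
  rw [lt_div_iff₀ (by positivity)] at h2
  have h3 : 2 * (K * ‖y - z‖) / (ρ / 2) = ‖y - z‖ * (4 * K / ρ) := by field_simp; ring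
  rw [h3]
  linarith [norm_nonneg (y - z)]

/-- A real linear map on a real subspace `T` with `T + i T` everything extends to a complex linear
map, as soon as the only possible formula is well defined. -/
theorem exists_complexLinear_extension {V G : Type*} [NormedAddCommGroup V] [NormedSpace ℂ V]
    [FiniteDimensional ℂ V] [NormedAddCommGroup G] [NormedSpace ℂ G] {T : Submodule ℝ V}
    {ℓ : V →L[ℝ] G} (hT : ∀ w : V, ∃ τ₁ ∈ T, ∃ τ₂ ∈ T, w = τ₁ + Complex.I • τ₂)
    (hℓ : ∀ κ₁ ∈ T, ∀ κ₂ ∈ T, κ₁ + Complex.I • κ₂ = 0 → ℓ κ₁ + Complex.I • ℓ κ₂ = 0) :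
    ∃ L : V →L[ℂ] G, ∀ τ₁ ∈ T, ∀ τ₂ ∈ T, L (τ₁ + Complex.I • τ₂) = ℓ τ₁ + Complex.I • ℓ τ₂ := by
  choose t₁ ht₁ t₂ ht₂ ht using hT
  have huniq : ∀ τ₁ ∈ T, ∀ τ₂ ∈ T, ∀ w, w = τ₁ + Complex.I • τ₂ →
      ℓ (t₁ w) + Complex.I • ℓ (t₂ w) = ℓ τ₁ + Complex.I • ℓ τ₂ := by
    intro τ₁ hτ₁ τ₂ hτ₂ w hw
    have h1 := hℓ _ (T.sub_mem (ht₁ w) hτ₁) _ (T.sub_mem (ht₂ w) hτ₂) (by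
      have h2 := (ht w).symm.trans hw
      rw [smul_sub, show t₁ w - τ₁ + (Complex.I • t₂ w - Complex.I • τ₂) =
        (t₁ w + Complex.I • t₂ w) - (τ₁ + Complex.I • τ₂) by abel, h2, sub_self])
    rw [map_sub, map_sub, smul_sub] at h1
    rw [← sub_eq_zero, ← h1]
    abel
  let L₀ : V →ₗ[ℂ] G :=
    { toFun := fun w => ℓ (t₁ w) + Complex.I • ℓ (t₂ w)
      map_add' := fun v w => by
        rw [huniq _ (T.add_mem (ht₁ v) (ht₁ w)) _ (T.add_mem (ht₂ v) (ht₂ w)) (v + w)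
          (by conv_lhs => rw [ht v, ht w]
              rw [smul_add]; abel), map_add, map_add, smul_add]
        abel
      map_smul' := fun s w => by
        have hcoe : ∀ (q : ℝ) (v : V), q • v = (q : ℂ) • v := fun q v => (Complex.coe_smul q v).symm
        have hcoe' : ∀ (q : ℝ) (v : G), q • v = (q : ℂ) • v := fun q v =>
          (Complex.coe_smul q v).symm
        have hs : s = s.re + s.im * Complex.I := (Complex.re_add_im s).symm
        rw [huniq _ (T.sub_mem (T.smul_mem s.re (ht₁ w)) (T.smul_mem s.im (ht₂ w))) _
          (T.add_mem (T.smul_mem s.im (ht₁ w)) (T.smul_mem s.re (ht₂ w))) (s • w) ?_]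
        · rw [map_sub, map_add, map_smul, map_smul, map_smul, map_smul, RingHom.id_apply]
          conv_rhs => rw [hs]
          simp only [hcoe']
          have h2 : (s.im : ℂ) • ℓ (t₂ w) = -((Complex.I * Complex.I * s.im) • ℓ (t₂ w)) := by
            rw [Complex.I_mul_I, neg_one_mul, neg_smul, neg_neg]
          rw [h2]
          module
        · conv_lhs => rw [ht w, hs]
          simp only [hcoe]
          have h2 : (s.im : ℂ) • t₂ w = -((Complex.I * Complex.I * s.im) • t₂ w) := by
            rw [Complex.I_mul_I, neg_one_mul, neg_smul, neg_neg]
          rw [h2]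
          module }
  exact ⟨LinearMap.toContinuousLinearMap L₀, fun τ₁ hτ₁ τ₂ hτ₂ => huniq τ₁ hτ₁ τ₂ hτ₂ _ rfl⟩

section

variable {V G : Type*} [NormedAddCommGroup V] [NormedSpace ℂ V] [NormedAddCommGroup G]
  [NormedSpace ℂ G] {α C r : ℝ} {M : Set V} {T : V → Submodule ℝ V} {p : V} {u : V → G}
  {ℓ : V → V →L[ℝ] G} {Γ W : Set V} {F : V → G}

/-- The boundary value `u` is a CR function: its differentials along the edge are compatible with
the complex structure, because the expansion of `F` at the edge holds for every decomposition of a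
vector of the cone. -/
theorem EdgeSetting.exists_jet_compatible [ProperSpace V]
    (S : EdgeSetting α C r M T p u ℓ Γ W F) (hΓ : Γ.Nonempty) :
    ∃ s₀ > 0, ∀ x ∈ M ∩ ball p s₀, ∀ κ₁ ∈ T x, ∀ κ₂ ∈ T x,
      κ₁ + Complex.I • κ₂ = 0 → ℓ x κ₁ + Complex.I • ℓ x κ₂ = 0 := by
  obtain ⟨a, ha⟩ := hΓ
  obtain ⟨c, hc, hac⟩ := Metric.nhds_basis_closedBall.mem_iff.1 (S.cone.1.mem_nhds ha)
  have hC := zero_le_one.trans S.one_le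
  have hα := S.α_pos
  obtain ⟨A, hA, s₀, hs₀, h⟩ := S.exists_norm_sub_jet_le hc hac
    (B := C * ‖a‖ + 1) (by positivity)
  refine ⟨min s₀ r, lt_min hs₀ S.r_pos, ?_⟩
  rintro x ⟨hxM, hx⟩ κ₁ hκ₁ κ₂ hκ₂ hκ
  have hxs : x ∈ M ∩ ball p s₀ := ⟨hxM, ball_subset_ball (min_le_left _ _) hx⟩
  obtain ⟨α₁, hα₁, α₂, hα₂, hadec, hα₁n, hα₂n⟩ :=
    S.model.decomp x ⟨hxM, ball_subset_ball (min_le_right _ _) hx⟩ a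
  -- both `α₁ + i α₂` and `(α₁ + q κ₁) + i (α₂ + q κ₂)` are decompositions of `a`
  set q : ℝ := (1 + ‖κ₁‖ + ‖κ₂‖)⁻¹ with hq
  have hq0 : 0 < q := by positivity
  have hqn : ∀ κ : V, ‖κ‖ ≤ 1 + ‖κ₁‖ + ‖κ₂‖ → ‖q • κ‖ ≤ 1 := by
    intro κ hκ
    rw [norm_smul, Real.norm_eq_abs, abs_of_pos hq0, hq, inv_mul_le_iff₀ (by positivity)]
    linarith
  have hq₁ := hqn κ₁ (by linarith [norm_nonneg κ₂])
  have hq₂ := hqn κ₂ (by linarith [norm_nonneg κ₁])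
  by_contra hne
  set X := ℓ x κ₁ + Complex.I • ℓ x κ₂ with hX
  have hX0 : 0 < q * ‖X‖ := mul_pos hq0 (norm_pos_iff.2 hne)
  obtain ⟨s₁, hs₁, hs₁'⟩ := exists_pos_forall_of_eventually
    (eventually_mul_rpow_le_const (by positivity : 0 < α / 4) (2 * A) (half_pos hX0))
  set s := min s₀ s₁ with hs
  have hs0 : 0 < s := lt_min hs₀ hs₁
  have e := hs₁' s hs0 (min_le_right _ _)
  have hnorm : ∀ v : V, ‖v‖ ≤ C * ‖a‖ + 1 → ‖s • v‖ ≤ (C * ‖a‖ + 1) * s := by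
    intro v hv
    rw [norm_smul, Real.norm_eq_abs, abs_of_pos hs0, mul_comm]
    gcongr
  have hw : ‖s • a - s • a‖ ≤ c * s := by rw [sub_self, norm_zero]; positivity
  have h1 := h x hxs (s • a) s hs0 (min_le_left _ _) hw (s • α₁) ((T x).smul_mem _ hα₁)
    (s • α₂) ((T x).smul_mem _ hα₂) (by rw [hadec, smul_add, smul_comm])
    (hnorm _ (by linarith)) (hnorm _ (by linarith))
  have h2 := h x hxs (s • a) s hs0 (min_le_left _ _) hw
    (s • (α₁ + q • κ₁)) ((T x).smul_mem _ ((T x).add_mem hα₁ ((T x).smul_mem _ hκ₁)))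
    (s • (α₂ + q • κ₂)) ((T x).smul_mem _ ((T x).add_mem hα₂ ((T x).smul_mem _ hκ₂)))
    (by
      have h3 : q • κ₁ + Complex.I • q • κ₂ = 0 := by
        rw [smul_comm Complex.I q, ← smul_add, hκ, smul_zero]
      rw [smul_comm Complex.I s, ← smul_add, smul_add Complex.I, show α₁ + q • κ₁ + (Complex.I • α₂ +
        Complex.I • q • κ₂) = (α₁ + Complex.I • α₂) + (q • κ₁ + Complex.I • q • κ₂) by abel,
        h3, add_zero, hadec])
    (hnorm _ ((norm_add_le _ _).trans (by linarith)))
    (hnorm _ ((norm_add_le _ _).trans (by linarith)))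
  have h3 : (s * q) • X = (F (x + s • a) - u x - (ℓ x (s • α₁) + Complex.I • ℓ x (s • α₂))) -
      (F (x + s • a) - u x - (ℓ x (s • (α₁ + q • κ₁)) + Complex.I • ℓ x (s • (α₂ + q • κ₂)))) := by
    simp only [hX, map_smul, map_add, smul_add, mul_smul, smul_comm Complex.I]
    abel
  have h4 : ‖(s * q) • X‖ ≤ 2 * A * s ^ (1 + α / 4) := by
    rw [h3]
    exact (norm_sub_le _ _).trans (by linarith)
  rw [norm_smul, Real.norm_eq_abs, abs_of_pos (by positivity), Real.rpow_add hs0, Real.rpow_one,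
    show 2 * A * (s * s ^ (α / 4)) = s * (2 * A * s ^ (α / 4)) by ring, mul_assoc] at h4
  have h5 := le_of_mul_le_mul_left h4 hs0
  linarith

/-- A holomorphic function on a wedge whose boundary values are of class `C^{1+α}` is of class `C^1`
up to the edge, on smaller cones of directions. -/
theorem EdgeSetting.exists_isC1AtEdge [FiniteDimensional ℂ V]
    (S : EdgeSetting α C r M T p u ℓ Γ W F) {a : V} {c : ℝ} (hc : 0 < c)
    (hac : closedBall a c ⊆ Γ) : ∃ L, IsC1AtEdge F u L M p a c := by
  have : ProperSpace V := FiniteDimensional.proper ℂ V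
  have hC : 0 < C := one_pos.trans_le S.one_le
  have hα := S.α_pos
  have hr := S.r_pos
  obtain ⟨c', hcc', hac'⟩ := exists_closedBall_subset_of_lt S.cone.1 hc.le hac
  have hc' : 0 < c' := hc.trans hcc'
  obtain ⟨s₁, hs₁, hcompat⟩ := S.exists_jet_compatible ⟨a, hac (mem_closedBall_self hc.le)⟩
  obtain ⟨A, hA, s₂, hs₂, hjet⟩ := S.exists_norm_sub_jet_le hc' hac'
    (B := C * (c' + ‖a‖)) (by positivity)
  obtain ⟨s₃, hs₃, hs₃'⟩ := exists_pos_forall_of_eventually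
    (eventually_mul_le_const (c' + ‖a‖) (by positivity : 0 < r / 2))
  set s₀ := min (min s₁ s₂) (min s₃ r) with hs₀
  have hs₀s₁ : s₀ ≤ s₁ := (min_le_left _ _).trans (min_le_left _ _)
  have hs₀s₂ : s₀ ≤ s₂ := (min_le_left _ _).trans (min_le_right _ _)
  have hs₀s₃ : s₀ ≤ s₃ := (min_le_right _ _).trans (min_le_left _ _)
  have hs₀r : s₀ ≤ r := (min_le_right _ _).trans (min_le_right _ _)
  have hs₀0 : 0 < s₀ := by positivity
  have hL : ∀ x, ∃ L : V →L[ℂ] G, x ∈ M ∩ ball p s₀ → ∀ τ₁ ∈ T x, ∀ τ₂ ∈ T x,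
      L (τ₁ + Complex.I • τ₂) = ℓ x τ₁ + Complex.I • ℓ x τ₂ := by
    intro x
    by_cases hx : x ∈ M ∩ ball p s₀
    · obtain ⟨L, hL⟩ := exists_complexLinear_extension (T := T x) (ℓ := ℓ x) (fun w => by
        obtain ⟨τ₁, h1, τ₂, h2, h3, -⟩ := S.model.decomp x ⟨hx.1, ball_subset_ball hs₀r hx.2⟩ w
        exact ⟨τ₁, h1, τ₂, h2, h3⟩)
        (hcompat x ⟨hx.1, ball_subset_ball hs₀s₁ hx.2⟩)
      exact ⟨L, fun _ => hL⟩
    · exact ⟨0, fun h => absurd h hx⟩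
  choose L hL using hL
  -- first-order expansion at all points of the edge near `p`
  have hexp : ∀ x ∈ M ∩ ball p s₀, ∀ (w : V) (s : ℝ), 0 < s → s ≤ s₀ → ‖w - s • a‖ ≤ c' * s →
      ‖F (x + w) - u x - L x w‖ ≤ A * s ^ (1 + α / 4) := by
    intro x hx w s hs hss₀ hw
    obtain ⟨τ₁, hτ₁, τ₂, hτ₂, hdec, hE₁, hE₂⟩ :=
      S.model.decomp x ⟨hx.1, ball_subset_ball hs₀r hx.2⟩ w
    have hwn := norm_le_of_norm_sub_smul_le hs.le hw
    have h1 := hjet x ⟨hx.1, ball_subset_ball hs₀s₂ hx.2⟩ w s hs (hss₀.trans hs₀s₂) hw τ₁ hτ₁ τ₂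
      hτ₂ hdec.symm (hE₁.trans (by rw [mul_assoc]; gcongr)) (hE₂.trans (by rw [mul_assoc]; gcongr))
    rwa [← hL x hx τ₁ hτ₁ τ₂ hτ₂, ← hdec] at h1
  have hW : ∀ x ∈ M ∩ ball p s₀, ∀ (w : V) (s : ℝ), 0 < s → s ≤ s₀ → ‖w - s • a‖ ≤ c' * s →
      x + w ∈ W := by
    intro x hx w s hs hss₀ hw
    refine S.sub x ⟨hx.1, ball_subset_ball hs₀r hx.2⟩ w (S.cone.mem_of_norm_sub_le hac' hs hw) ?_
    have := hs₃' s hs (hss₀.trans hs₀s₃)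
    exact (norm_le_of_norm_sub_smul_le hs.le hw).trans_lt (by linarith)
  have hdF : ∀ z ∈ W, DifferentiableAt ℂ F z := fun z hz =>
    S.holo.differentiableAt (S.isOpen.mem_nhds hz)
  set A' : ℝ := 2 * A / (c' - c) with hA'
  have hA'0 : 0 ≤ A' := div_nonneg (by positivity) (by linarith)
  -- Cauchy's estimate on balls of radius comparable to the height
  have hder : ∀ x ∈ M ∩ ball p s₀, ∀ (w : V) (s : ℝ), 0 < s → s ≤ s₀ → ‖w - s • a‖ ≤ c * s →
      ‖fderiv ℂ F (x + w) - L x‖ ≤ A' * s ^ (α / 4) := by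
    intro x hx w s hs hss₀ hw
    set ρ := (c' - c) * s with hρ
    have hρ0 : 0 < ρ := mul_pos (by linarith) hs
    have hcone : ∀ z ∈ ball (x + w) ρ, ‖(z - x) - s • a‖ ≤ c' * s := by
      intro z hz
      rw [mem_ball, dist_eq_norm] at hz
      rw [show z - x - s • a = (z - (x + w)) + (w - s • a) by abel]
      refine (norm_add_le _ _).trans ?_
      rw [hρ] at hz
      linarith
    have hzW : ∀ z ∈ ball (x + w) ρ, z ∈ W := fun z hz => by
      have := hW x hx (z - x) s hs hss₀ (hcone z hz)
      rwa [add_sub_cancel] at this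
    have hg : ∀ z ∈ ball (x + w) ρ, HasFDerivAt (fun z => F z - u x - L x (z - x))
        (fderiv ℂ F z - L x) z := by
      intro z hz
      refine ((hdF z (hzW z hz)).hasFDerivAt.sub_const _).sub ?_
      exact (L x).hasFDerivAt.comp z (hasFDerivAt_sub_const x)
    have h1 := norm_fderiv_le_of_norm_le (f := fun z => F z - u x - L x (z - x)) (z := x + w)
      (ρ := ρ) (B := A * s ^ (1 + α / 4)) hρ0
      (fun z hz => (hg z hz).differentiableAt.differentiableWithinAt)
      (fun z hz => by
        have := hexp x hx (z - x) s hs hss₀ (hcone z hz)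
        rwa [add_sub_cancel] at this)
    rw [(hg _ (mem_ball_self hρ0)).fderiv] at h1
    refine h1.trans_eq ?_
    have : c' - c ≠ 0 := by linarith
    rw [Real.rpow_add hs, Real.rpow_one, hρ, hA']
    field_simp
  have hpmem : p ∈ M ∩ ball p s₀ := ⟨S.mem, mem_ball_self hs₀0⟩
  -- the differentials `L x` depend continuously on `x` at `p`
  have hcont : ∀ η > 0, ∃ δ > 0, ∀ x ∈ M ∩ ball p δ, ‖L x - L p‖ ≤ η := by
    intro η hη
    obtain ⟨s₄, hs₄, hs₄'⟩ := exists_pos_forall_of_eventually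
      (eventually_mul_rpow_le_const (by positivity : 0 < α / 4) A' (by positivity : 0 < η / 3))
    set s := min s₄ s₀ with hs
    have hs0 : 0 < s := lt_min hs₄ hs₀0
    have e := hs₄' s hs0 (min_le_left _ _)
    have hw : ‖s • a - s • a‖ ≤ c * s := by rw [sub_self, norm_zero]; positivity
    have hpW : p + s • a ∈ W := hW p hpmem (s • a) s hs0 (min_le_right _ _)
      (hw.trans (by gcongr))
    obtain ⟨δ, hδ, h1⟩ := Metric.continuousAt_iff.1
      (continuousAt_fderiv_of_differentiableOn S.holo S.isOpen hpW) (η / 3) (by positivity)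
    refine ⟨min δ s₀, lt_min hδ hs₀0, ?_⟩
    rintro x ⟨hxM, hx⟩
    have h2 := hder x ⟨hxM, ball_subset_ball (min_le_right _ _) hx⟩ (s • a) s hs0
      (min_le_right _ _) hw
    have h3 := hder p hpmem (s • a) s hs0 (min_le_right _ _) hw
    have h4 : dist (fderiv ℂ F (x + s • a)) (fderiv ℂ F (p + s • a)) < η / 3 := by
      apply h1
      rw [dist_add_right]
      exact lt_of_lt_of_le hx (min_le_left _ _)
    rw [dist_eq_norm] at h4
    rw [show L x - L p = -(fderiv ℂ F (x + s • a) - L x) +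
      (fderiv ℂ F (x + s • a) - fderiv ℂ F (p + s • a)) + (fderiv ℂ F (p + s • a) - L p) by abel]
    refine (norm_add_le _ _).trans ?_
    have h5 := norm_add_le (-(fderiv ℂ F (x + s • a) - L x))
      (fderiv ℂ F (x + s • a) - fderiv ℂ F (p + s • a))
    rw [norm_neg] at h5
    linarith
  refine ⟨L p, fun η hη => ?_⟩
  set Q : ℝ := c + ‖a‖ + 1 with hQ
  have hQ0 : 0 < Q := by positivity
  obtain ⟨δ₁, hδ₁, hLp⟩ := hcont (η / (2 * Q)) (by positivity)
  obtain ⟨s₅, hs₅, hs₅'⟩ := exists_pos_forall_of_eventually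
    ((eventually_mul_rpow_le_const (by positivity : 0 < α / 4) A' (half_pos hη)).and
      (eventually_mul_rpow_le_const (by positivity : 0 < α / 4) A (half_pos hη)))
  have hQη : η / (2 * Q) ≤ η / 2 := by
    gcongr
    have : 0 ≤ c + ‖a‖ := by positivity
    linarith
  set N : ℝ := ‖ℓ p‖ + ‖L p‖ + 1 with hN
  have hN0 : 0 < N := by positivity
  obtain ⟨δ₂, hδ₂, hsec⟩ := S.model.secant (η / (3 * N)) (by positivity)
  obtain ⟨s₆, hs₆, hs₆'⟩ := exists_pos_forall_of_eventually
    ((eventually_mul_rpow_le_const hα (C * 2 ^ α) (by positivity : 0 < η / 3)).and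
      (eventually_mul_rpow_le_const hα C (by positivity : 0 < η / 3)))
  set δ := min (min (min δ₁ s₅) (min δ₂ s₆)) s₀ with hδ
  have hδ0 : 0 < δ := by positivity
  have hδδ₁ : δ ≤ δ₁ := (min_le_left _ _).trans ((min_le_left _ _).trans (min_le_left _ _))
  have hδs₅ : δ ≤ s₅ := (min_le_left _ _).trans ((min_le_left _ _).trans (min_le_right _ _))
  have hδδ₂ : δ ≤ δ₂ := (min_le_left _ _).trans ((min_le_right _ _).trans (min_le_left _ _))
  have hδs₆ : δ ≤ s₆ := (min_le_left _ _).trans ((min_le_right _ _).trans (min_le_right _ _))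
  have hδs₀ : δ ≤ s₀ := min_le_right _ _
  refine ⟨δ, hδ0, ?_, ?_⟩
  · rintro y ⟨hyM, hy⟩ w t ht htδ hw
    have hy₀ : y ∈ M ∩ ball p s₀ := ⟨hyM, ball_subset_ball hδs₀ hy⟩
    obtain ⟨e1, e2⟩ := hs₅' t ht (htδ.le.trans hδs₅)
    have h1 := hLp y ⟨hyM, ball_subset_ball hδδ₁ hy⟩
    have hw' : ‖w - t • a‖ ≤ c' * t := hw.trans (by gcongr)
    refine ⟨hdF _ (hW y hy₀ w t ht (htδ.le.trans hδs₀) hw'), ?_, ?_⟩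
    · have h2 := hder y hy₀ w t ht (htδ.le.trans hδs₀) hw
      rw [show fderiv ℂ F (y + w) - L p = (fderiv ℂ F (y + w) - L y) + (L y - L p) by abel]
      exact (norm_add_le _ _).trans (by linarith)
    · have h2 := hexp y hy₀ w t ht (htδ.le.trans hδs₀) hw'
      have h3 : ‖(L y - L p) w‖ ≤ η / 2 * t := by
        calc ‖(L y - L p) w‖ ≤ ‖L y - L p‖ * ‖w‖ := (L y - L p).le_opNorm w
          _ ≤ η / (2 * Q) * (Q * t) := by
            gcongr
            refine (norm_le_of_norm_sub_smul_le ht.le hw).trans ?_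
            gcongr
            linarith
          _ = η / 2 * t := by field_simp
      have h4 : A * t ^ (1 + α / 4) ≤ η / 2 * t := by
        rw [Real.rpow_add ht, Real.rpow_one]
        calc A * (t * t ^ (α / 4)) = A * t ^ (α / 4) * t := by ring
          _ ≤ _ := by gcongr
      rw [show F (y + w) - u y - L p w = (F (y + w) - u y - L y w) + (L y - L p) w by
        rw [sub_apply]; abel]
      exact (norm_add_le _ _).trans (by linarith)
  · rintro y ⟨hyM, hy⟩ y' ⟨hy'M, hy'⟩
    have hyr : y ∈ M ∩ ball p r := ⟨hyM, ball_subset_ball (hδs₀.trans hs₀r) hy⟩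
    have hyr' : y' ∈ M ∩ ball p r := ⟨hy'M, ball_subset_ball (hδs₀.trans hs₀r) hy'⟩
    obtain ⟨τ, hτ, hτn⟩ := hsec y' ⟨hy'M, ball_subset_ball hδδ₂ hy'⟩ y
      ⟨hyM, ball_subset_ball hδδ₂ hy⟩
    obtain ⟨e1, e2⟩ := hs₆' δ hδ0 hδs₆
    have h1 := S.jets.taylor y' hyr' y hyr
    have h2 := S.jets.holder y' hyr'
    rw [mem_ball, dist_eq_norm] at hy hy'
    have h3 : C * ‖y - y'‖ ^ (1 + α) ≤ η / 3 * ‖y - y'‖ := by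
      have h4 : ‖y - y'‖ ≤ 2 * δ := by
        rw [show y - y' = (y - p) - (y' - p) by abel]
        exact (norm_sub_le _ _).trans (by linarith)
      rw [Real.rpow_add' (norm_nonneg _) (by linarith), Real.rpow_one]
      calc C * (‖y - y'‖ * ‖y - y'‖ ^ α) = C * ‖y - y'‖ ^ α * ‖y - y'‖ := by ring
        _ ≤ C * (2 * δ) ^ α * ‖y - y'‖ := by gcongr
        _ = C * 2 ^ α * δ ^ α * ‖y - y'‖ := by
          rw [Real.mul_rpow two_pos.le hδ0.le]; ring
        _ ≤ _ := by gcongr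
    have h5 : ‖(ℓ y' - ℓ p) (y - y')‖ ≤ η / 3 * ‖y - y'‖ := by
      refine ((ℓ y' - ℓ p).le_opNorm _).trans ?_
      gcongr
      refine h2.trans (le_trans ?_ e2)
      gcongr
    -- the secant `y - y'` is nearly the tangent vector `τ`, on which `L p` and `ℓ p` agree
    have h6 : L p τ = ℓ p τ := by
      have := hL p hpmem τ hτ 0 (T p).zero_mem
      simpa using this
    have h7 : ‖ℓ p (y - y' - τ) - L p (y - y' - τ)‖ ≤ η / 3 * ‖y - y'‖ := by
      refine (norm_sub_le _ _).trans ((add_le_add ((ℓ p).le_opNorm _)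
        ((L p).le_opNorm _)).trans ?_)
      rw [← add_mul]
      calc (‖ℓ p‖ + ‖L p‖) * ‖y - y' - τ‖ ≤ N * (η / (3 * N) * ‖y - y'‖) := by
            gcongr
            rw [hN]; linarith
        _ = η / 3 * ‖y - y'‖ := by field_simp
    rw [show u y - u y' - L p (y - y') = (u y - u y' - ℓ y' (y - y')) + (ℓ y' - ℓ p) (y - y') +
      (ℓ p (y - y' - τ) - L p (y - y' - τ)) by
        rw [map_sub (ℓ p) (y - y') τ, map_sub (L p) (y - y') τ, h6, sub_apply]
        abel]
    refine (norm_add_le _ _).trans ((add_le_add (norm_add_le _ _) le_rfl).trans ?_)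
    linarith

end

theorem IsEdgeModel.mono {V : Type*} [NormedAddCommGroup V] [NormedSpace ℂ V]
    {α C C' r r' : ℝ} {M : Set V} {T : V → Submodule ℝ V} {p : V} (h : IsEdgeModel α C r M T p)
    (hC : C ≤ C') (hr : r' ≤ r) : IsEdgeModel α C' r' M T p where
  decomp := fun x hx w => by
    obtain ⟨τ₁, h1, τ₂, h2, h3, h4, h5⟩ := h.decomp x ⟨hx.1, ball_subset_ball hr hx.2⟩ w
    exact ⟨τ₁, h1, τ₂, h2, h3, h4.trans (by gcongr), h5.trans (by gcongr)⟩
  near := fun x hx τ hτ hτr => by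
    obtain ⟨y, hy, hyn⟩ := h.near x ⟨hx.1, ball_subset_ball hr hx.2⟩ τ hτ (hτr.trans hr)
    exact ⟨y, hy, hyn.trans (by gcongr)⟩
  closed := by
    have : M ∩ closedBall p r' = (M ∩ closedBall p r) ∩ closedBall p r' := by
      rw [inter_assoc, inter_eq_self_of_subset_right (closedBall_subset_closedBall hr)]
    rw [this]
    exact h.closed.inter isClosed_closedBall
  secant := h.secant

/-- Let `u` be of class `C^{1+α}` near a point `p` of a generic submanifold `M` of class `C^{1+α}`.
A holomorphic function on a wedge with edge `M` near `p`, with boundary values `u`, is `C^1` up to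
the edge at `p`. -/
theorem IsSubmanifold.exists_isC1AtEdge {V G : Type*} [NormedAddCommGroup V] [NormedSpace ℂ V]
    [FiniteDimensional ℂ V] [NormedAddCommGroup G] [NormedSpace ℂ G] {α : ℝ≥0} (hα : 0 < α)
    (hα1 : α < 1) {m : ℕ} {M : Set V} (hM : IsSubmanifold α m M) {p : V} (hp : p ∈ M)
    (hgen : complexTangentSpan M p = ⊤) {u g : V → G} {U : Set V} (hU : IsOpen U) (hpU : p ∈ U)
    (hg : IsHolderClass 1 α g U) (hgu : EqOn g u (M ∩ U)) {Γ W : Set V} {F : V → G}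
    (hΓ : IsOpenCone Γ) (hW : IsOpen W) (hF : DifferentiableOn ℂ F W) {ε : ℝ} (hε : 0 < ε)
    (hsub : ∀ x ∈ M ∩ ball p ε, ∀ w ∈ Γ, ‖w‖ < ε → x + w ∈ W)
    (hlim : ∀ x ∈ M ∩ ball p ε, Tendsto F (𝓝[W] x) (𝓝 (u x)))
    {a : V} {c : ℝ} (hc : 0 < c) (hac : closedBall a c ⊆ Γ) :
    ∃ L, IsC1AtEdge F u L M p a c := by
  have : CompleteSpace V := FiniteDimensional.complete ℂ V
  obtain ⟨C₁, hC₁, r₁, hr₁, T, hT⟩ := hM.exists_isEdgeModel hα hp hgen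
  obtain ⟨C₂, hC₂, r₂, hr₂, hr₂U, -, hb, hh, ht⟩ := hg.exists_taylor hU hpU
  set r := min (min r₁ r₂) (min ε 1) with hr
  have hrr₁ : r ≤ r₁ := (min_le_left _ _).trans (min_le_left _ _)
  have hrr₂ : r ≤ r₂ := (min_le_left _ _).trans (min_le_right _ _)
  have hrε : r ≤ ε := (min_le_right _ _).trans (min_le_left _ _)
  have hr1 : r ≤ 1 := (min_le_right _ _).trans (min_le_right _ _)
  set C := max C₁ C₂ with hC
  have hCC₂ : C₂ ≤ C := le_max_right _ _
  have heq : ∀ x ∈ M ∩ ball p r, g x = u x := fun x hx =>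
    hgu ⟨hx.1, hr₂U (ball_subset_ball hrr₂ hx.2)⟩
  have hmem : ∀ x ∈ M ∩ ball p r, x ∈ ball p r₂ := fun x hx => ball_subset_ball hrr₂ hx.2
  have hjets : HasEdgeJets α C r M u (fderiv ℝ g) p :=
    { bound := fun x hx => (hb x (hmem x hx)).trans hCC₂
      taylor := fun x hx y hy => by
        rw [← heq x hx, ← heq y hy]
        exact (ht x (hmem x hx) y (hmem y hy)).trans (by gcongr)
      holder := fun x hx =>
        (hh x (hmem x hx) p (mem_ball_self hr₂)).trans (by gcongr) }
  have S : EdgeSetting α C r M T p u (fderiv ℝ g) Γ W F :=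
    { model := hT.mono (le_max_left _ _) hrr₁
      jets := hjets
      isOpen := hW
      holo := hF
      cone := hΓ
      sub := fun x hx w hw hwr =>
        hsub x ⟨hx.1, ball_subset_ball hrε hx.2⟩ w hw (hwr.trans_le hrε)
      lim := fun x hx => hlim x ⟨hx.1, ball_subset_ball hrε hx.2⟩
      mem := hp
      one_le := hC₁.trans (le_max_left _ _)
      r_pos := by positivity
      r_le := hr1
      α_pos := hα
      α_lt := hα1 }
  exact S.exists_isC1AtEdge hc hac

/-! ### Inversion on a wedge of a map which is regular up to the edge -/

/-- The truncated wedge with edge `T` and directions the round cone around `v` of aperture `c`. -/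
def roundWedge {E : Type*} [NormedAddCommGroup E] [NormedSpace ℝ E] (T : Set E) (v : E)
    (c r : ℝ) : Set E :=
  {q | ∃ y ∈ T, ∃ t : ℝ, 0 < t ∧ t < r ∧ ‖q - y - t • v‖ < c * t}

theorem isOpen_roundWedge {E : Type*} [NormedAddCommGroup E] [NormedSpace ℝ E] (T : Set E) (v : E)
    (c r : ℝ) : IsOpen (roundWedge T v c r) := by
  have : roundWedge T v c r =
      ⋃ y ∈ T, ⋃ t ∈ Ioo (0 : ℝ) r, {q | ‖q - y - t • v‖ < c * t} := by
    ext q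
    simp only [roundWedge, mem_ofPred_eq, mem_iUnion, exists_prop, mem_Ioo, and_assoc]
  rw [this]
  refine isOpen_biUnion fun y _ => isOpen_biUnion fun t _ => ?_
  exact isOpen_lt (by fun_prop) continuous_const

section Inversion

variable {E : Type*} [NormedAddCommGroup E] [NormedSpace ℂ E]

/-- A map of class `C^1` up to the edge is close to its differential at a point of the edge, on
pairs of points of a thinner wedge. If the two points are close compared to their heights, this
is the mean value inequality; otherwise it follows from the expansions at points of the edge. -/
theorem IsC1AtEdge.exists_approx {G : Type*} [NormedAddCommGroup G] [NormedSpace ℂ G]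
    {F u : E → G} {L : E →L[ℂ] G} {S : Set E} {x v : E} {c : ℝ} (hc : 0 < c)
    (h : IsC1AtEdge F u L S x v c) {η : ℝ} (hη : 0 < η) :
    ∃ δ > 0, ∀ a ∈ roundWedge (S ∩ ball x δ) v (c / 2) δ,
      ∀ b ∈ roundWedge (S ∩ ball x δ) v (c / 2) δ, ‖F a - F b - L (a - b)‖ ≤ η * ‖a - b‖ := by
  set C : ℝ := 1 + (2 * (c + ‖v‖) + 2) * (2 / c) with hC
  have hC1 : 1 ≤ C := by
    rw [hC]; have : 0 ≤ (2 * (c + ‖v‖) + 2) * (2 / c) := by positivity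
    linarith
  have hC0 : 0 < C := by linarith
  obtain ⟨δ, hδ, h1, h2⟩ := h (η / C) (by positivity)
  have hη1 : η / C ≤ η := div_le_self hη.le hC1
  refine ⟨δ, hδ, ?_⟩
  -- the estimate is symmetric in the two points, so the first may be taken to be the higher one
  have key : ∀ y ∈ S ∩ ball x δ, ∀ (ξ : E) (t : ℝ), 0 < t → t < δ → ‖ξ - t • v‖ < c / 2 * t →
      ∀ z ∈ S ∩ ball x δ, ∀ (ζ : E) (s : ℝ), 0 < s → s ≤ t → ‖ζ - s • v‖ < c / 2 * s →
      ‖F (y + ξ) - F (z + ζ) - L ((y + ξ) - (z + ζ))‖ ≤ η * ‖(y + ξ) - (z + ζ)‖ := by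
    intro y hy ξ t ht htδ hξ z hz ζ s hs hst hζ
    rcases le_or_gt ‖(y + ξ) - (z + ζ)‖ (c / 2 * t) with hab | hab
    · -- both points lie in a ball contained in the cone over `y`
      have hconv : Convex ℝ (closedBall (y + t • v) (c * t)) := convex_closedBall _ _
      have hd : ∀ q ∈ closedBall (y + t • v) (c * t),
          DifferentiableAt ℂ F q ∧ ‖fderiv ℂ F q - L‖ ≤ η := by
        intro q hq
        rw [mem_closedBall, dist_eq_norm] at hq
        have := h1 y hy (q - y) t ht htδ (by rwa [sub_sub])
        rw [add_sub_cancel] at this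
        exact ⟨this.1, this.2.1.trans hη1⟩
      have hb1 : y + ξ ∈ closedBall (y + t • v) (c * t) := by
        rw [mem_closedBall, dist_eq_norm, add_sub_add_left_eq_sub]
        nlinarith
      have hb2 : z + ζ ∈ closedBall (y + t • v) (c * t) := by
        rw [mem_closedBall, dist_eq_norm]
        have : z + ζ - (y + t • v) = (ξ - t • v) - ((y + ξ) - (z + ζ)) := by abel
        rw [this]
        refine (norm_sub_le _ _).trans ?_
        linarith
      exact hconv.norm_image_sub_le_of_norm_hasFDerivWithin_le'
        (fun q hq => ((hd q hq).1.hasFDerivAt).hasFDerivWithinAt) (fun q hq => (hd q hq).2) hb2 hb1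
    · have e1 := (h1 y hy ξ t ht htδ (by nlinarith)).2.2
      have e2 := (h1 z hz ζ s hs (hst.trans_lt htδ) (by nlinarith)).2.2
      have e3 := h2 y hy z hz
      have n1 : ‖ξ‖ ≤ (c + ‖v‖) * t := norm_le_of_norm_sub_smul_le ht.le (by nlinarith)
      have n2 : ‖ζ‖ ≤ (c + ‖v‖) * s := norm_le_of_norm_sub_smul_le hs.le (by nlinarith)
      have n2' : (c + ‖v‖) * s ≤ (c + ‖v‖) * t := by gcongr
      have n3 : ‖y - z‖ ≤ ‖(y + ξ) - (z + ζ)‖ + 2 * (c + ‖v‖) * t := by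
        have : y - z = ((y + ξ) - (z + ζ)) - ξ + ζ := by abel
        rw [this]
        refine (norm_add_le _ _).trans ?_
        have := norm_sub_le ((y + ξ) - (z + ζ)) ξ
        linarith
      have ht' : t ≤ 2 / c * ‖(y + ξ) - (z + ζ)‖ := by
        rw [div_mul_eq_mul_div, le_div_iff₀ hc]
        linarith
      have e4 : F (y + ξ) - F (z + ζ) - L ((y + ξ) - (z + ζ)) =
          (F (y + ξ) - u y - L ξ) - (F (z + ζ) - u z - L ζ) + (u y - u z - L (y - z)) := by
        simp only [map_add, map_sub]; abel
      rw [e4]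
      have e5 := (norm_add_le ((F (y + ξ) - u y - L ξ) - (F (z + ζ) - u z - L ζ))
        (u y - u z - L (y - z))).trans (add_le_add (norm_sub_le _ _) le_rfl)
      refine e5.trans ?_
      have hs' : η / C * s ≤ η / C * t := by gcongr
      calc _ ≤ η / C * t + η / C * t + η / C * ‖y - z‖ := by linarith
        _ = η / C * (2 * t + ‖y - z‖) := by ring
        _ ≤ η / C * (‖(y + ξ) - (z + ζ)‖ + (2 * (c + ‖v‖) + 2) * t) :=
            mul_le_mul_of_nonneg_left (by linarith) (by positivity)
        _ ≤ η / C * (‖(y + ξ) - (z + ζ)‖ +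
              (2 * (c + ‖v‖) + 2) * (2 / c * ‖(y + ξ) - (z + ζ)‖)) := by gcongr
        _ = η / C * C * ‖(y + ξ) - (z + ζ)‖ := by rw [hC]; ring
        _ = _ := by rw [div_mul_cancel₀ _ hC0.ne']
  rintro a ⟨y, hy, t, ht, htδ, hat⟩ b ⟨z, hz, s, hs, hsδ, hbs⟩
  rcases le_total s t with hst | hst
  · have := key y hy (a - y) t ht htδ hat z hz (b - z) s hs hst hbs
    rwa [add_sub_cancel, add_sub_cancel] at this
  · have := key z hz (b - z) s hs hsδ hbs y hy (a - y) t ht hst hat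
    rw [add_sub_cancel, add_sub_cancel] at this
    have e : F a - F b - L (a - b) = -(F b - F a - L (b - a)) := by
      rw [← neg_sub b a, map_neg]; abel
    rwa [e, norm_neg, norm_sub_rev a b]

/-- The analogue of `IsC1AtEdge.exists_approx` where one of the two points is on the edge. The
hypothesis on `K` bounds the height of a point of the wedge by its distance to the edge. -/
theorem IsC1AtEdge.exists_approx_edge {G : Type*} [NormedAddCommGroup G] [NormedSpace ℂ G]
    {F u : E → G} {L : E →L[ℂ] G} {S : Set E} {x v : E} {c K : ℝ} (hc : 0 < c) (hK : 0 ≤ K)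
    (hheight : ∀ x ∈ S, ∀ y ∈ S, ∀ (w : E) (t : ℝ), 0 < t → ‖w - t • v‖ ≤ c * t →
      t ≤ K * ‖y + w - x‖)
    (h : IsC1AtEdge F u L S x v c) {η : ℝ} (hη : 0 < η) :
    ∃ δ > 0, ∀ z ∈ S ∩ ball x δ, ∀ T ⊆ S, ∀ r, ∀ b ∈ roundWedge T v c r ∩ ball x δ,
      ‖fderiv ℂ F b - L‖ ≤ η ∧ ‖F b - u z - L (b - z)‖ ≤ η * ‖b - z‖ := by
  set C : ℝ := 1 + (c + ‖v‖) * K + K with hC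
  have hC1 : 1 ≤ C := by
    rw [hC]; have : 0 ≤ (c + ‖v‖) * K := by positivity
    linarith
  have hC0 : 0 < C := by linarith
  obtain ⟨δ, hδ, h1, h2⟩ := h (η / (2 * C)) (by positivity)
  refine ⟨δ / (4 * C), by positivity, ?_⟩
  rintro z ⟨hzS, hz⟩ T hT r b ⟨⟨y, hy, t, ht, -, hbt⟩, hb⟩
  have ht1 : t ≤ K * ‖b - z‖ := by
    have := hheight z hzS y (hT hy) (b - y) t ht hbt.le
    rwa [add_sub_cancel] at this
  have hy1 : ‖y - z‖ ≤ (1 + (c + ‖v‖) * K) * ‖b - z‖ := by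
    have n1 : ‖b - y‖ ≤ (c + ‖v‖) * t := norm_le_of_norm_sub_smul_le ht.le hbt.le
    have : y - z = (b - z) - (b - y) := by abel
    rw [this]
    refine (norm_sub_le _ _).trans ?_
    have : (c + ‖v‖) * t ≤ (c + ‖v‖) * (K * ‖b - z‖) := by gcongr
    linarith
  have hδC : δ / (4 * C) ≤ δ / 4 :=
    div_le_div_of_nonneg_left hδ.le (by norm_num) (by linarith)
  rw [mem_ball, dist_eq_norm] at hb hz
  have hbz : C * ‖b - z‖ < δ / 2 := by
    have e : b - z = (b - x) - (z - x) := by abel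
    have h3 : ‖b - z‖ < δ / (4 * C) + δ / (4 * C) := by
      rw [e]; exact (norm_sub_le _ _).trans_lt (add_lt_add hb hz)
    calc C * ‖b - z‖ < C * (δ / (4 * C) + δ / (4 * C)) := by gcongr
      _ = δ / 2 := by field_simp; ring
  have hbn := norm_nonneg (b - z)
  have hcv : 0 ≤ (c + ‖v‖) * K := by positivity
  have hsum : t + ‖y - z‖ ≤ C * ‖b - z‖ := by rw [hC]; linarith
  have hyδ : y ∈ S ∩ ball x δ := by
    refine ⟨hT hy, ?_⟩
    rw [mem_ball, dist_eq_norm, ← sub_add_sub_cancel y z x]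
    refine (norm_add_le _ _).trans_lt ?_
    linarith
  have hzδ : z ∈ S ∩ ball x δ := by
    refine ⟨hzS, ?_⟩
    rw [mem_ball, dist_eq_norm]
    linarith
  have hyn := norm_nonneg (y - z)
  have h3 := h1 y hyδ (b - y) t ht (by linarith) hbt.le
  rw [add_sub_cancel] at h3
  have h4 := h2 y hyδ z hzδ
  have hη' : η / (2 * C) ≤ η := div_le_self hη.le (by linarith)
  refine ⟨h3.2.1.trans hη', ?_⟩
  have e : F b - u z - L (b - z) =
      (F b - u y - L (b - y)) + (u y - u z - L (y - z)) := by
    simp only [map_sub]; abel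
  rw [e]
  calc _ ≤ η / (2 * C) * t + η / (2 * C) * ‖y - z‖ :=
        (norm_add_le _ _).trans (add_le_add h3.2.2 h4)
    _ = η / (2 * C) * (t + ‖y - z‖) := by ring
    _ ≤ η / (2 * C) * (C * ‖b - z‖) := mul_le_mul_of_nonneg_left hsum (by positivity)
    _ = η / 2 * ‖b - z‖ := by field_simp
    _ ≤ η * ‖b - z‖ := by gcongr; linarith

/-- A continuous linear endomorphism at distance less than one from the identity is invertible. -/
theorem exists_equiv_of_norm_sub_id_lt [CompleteSpace E] {A : E →L[ℂ] E}
    (hA : ‖A - ContinuousLinearMap.id ℂ E‖ < 1) : ∃ A' : E ≃L[ℂ] E, (A' : E →L[ℂ] E) = A := by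
  let U : (E →L[ℂ] E)ˣ := Units.oneSub (1 - A) (by rw [norm_sub_rev]; exact hA)
  refine ⟨ContinuousLinearEquiv.ofUnit U, ?_⟩
  ext x
  change ((1 : E →L[ℂ] E) - (1 - A)) x = A x
  simp

theorem tendsto_of_norm_sub_le_mul {X G : Type*} [NormedAddCommGroup G] {l : Filter X}
    {f g : X → G} {C : ℝ} {x y : G} (h : ∀ᶠ q in l, ‖f q - x‖ ≤ C * ‖g q - y‖)
    (hg : Tendsto g l (𝓝 y)) : Tendsto f l (𝓝 x) := by
  rw [tendsto_iff_norm_sub_tendsto_zero] at hg ⊢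
  exact squeeze_zero' (Eventually.of_forall fun _ => norm_nonneg _) h (by simpa using hg.const_mul C)

/-- A map `Ξ` of class `C^1` up to the edge `S` of a wedge, whose differential at a point `p` of
the edge is the identity, has an inverse on a thinner wedge with edge the image of `S` near `p`
and the same direction; the inverse is of class `C^1` up to the edge. -/
theorem exists_inverse_on_roundWedge [FiniteDimensional ℂ E] {Ξ u : E → E} {L : E → E →L[ℂ] E}
    {S : Set E} {p v : E} {c K r : ℝ} (hc : 0 < c) (hK : 0 ≤ K) (hr : 0 < r) (hp : p ∈ S)
    (hheight : ∀ x ∈ S, ∀ y ∈ S, ∀ (w : E) (t : ℝ), 0 < t → ‖w - t • v‖ ≤ c * t →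
      t ≤ K * ‖y + w - x‖)
    (hΞ : ∀ x ∈ S ∩ ball p r, IsC1AtEdge Ξ u (L x) S x v c)
    (hLp : L p = ContinuousLinearMap.id ℂ E) :
    ∃ (G : E → E), ∃ c' > 0, ∃ δ > 0, c' ≤ c ∧ δ ≤ r ∧
      (∀ x ∈ S ∩ ball p δ, ∀ (w : E) (t : ℝ), 0 < t → t < δ → ‖w - t • v‖ < c' * t →
        ‖G (u x + w) - x - t • v‖ < c * t) ∧
      (∀ q ∈ roundWedge (u '' (S ∩ ball p δ)) v c' δ, ∃ A : E ≃L[ℂ] E,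
        HasFDerivAt G (A : E →L[ℂ] E) q) ∧
      ∀ x ∈ S ∩ ball p δ, ∃ A : E ≃L[ℂ] E,
        Tendsto G (𝓝[roundWedge (u '' (S ∩ ball p δ)) v c' δ] (u x)) (𝓝 x) ∧
        ((fun q => G q - x - A (q - u x)) =o[𝓝[roundWedge (u '' (S ∩ ball p δ)) v c' δ] (u x)]
          fun q => q - u x) ∧
        Tendsto (fderiv ℂ G) (𝓝[roundWedge (u '' (S ∩ ball p δ)) v c' δ] (u x))
          (𝓝 (A : E →L[ℂ] E)) := by
  have hCS : CompleteSpace E := FiniteDimensional.complete ℂ E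
  have hp1 := hΞ p ⟨hp, mem_ball_self hr⟩
  rw [hLp] at hp1
  obtain ⟨δ₁, hδ₁, hpair⟩ := hp1.exists_approx hc (η := 1 / 2) (by norm_num)
  obtain ⟨δ₂, hδ₂, hedge⟩ := hp1.exists_approx_edge hc hK hheight (η := 1 / 2) (by norm_num)
  obtain ⟨δ₃, hδ₃, h1, -⟩ := hp1 (min (1 / 2) (c / 8)) (by positivity)
  -- the points of the wedge over the edge near `p` with small height are near `p`
  obtain ⟨δ, hδ, hδr, hδ1, hδ2, hδ3⟩ : ∃ δ > 0, δ ≤ r ∧ δ ≤ δ₁ ∧ (1 + (c + ‖v‖)) * δ ≤ δ₂ ∧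
      δ ≤ δ₃ := by
    refine ⟨min (min r δ₁) (min (δ₂ / (1 + (c + ‖v‖))) δ₃), by positivity, ?_, ?_, ?_, ?_⟩
    · exact (min_le_left _ _).trans (min_le_left _ _)
    · exact (min_le_left _ _).trans (min_le_right _ _)
    · rw [mul_comm, ← le_div_iff₀ (by positivity)]
      exact (min_le_right _ _).trans (min_le_left _ _)
    · exact (min_le_right _ _).trans (min_le_right _ _)
  set W : Set E := roundWedge (S ∩ ball p δ) v (c / 2) δ with hW
  have hWδ : W ⊆ ball p δ₂ := by
    rintro b ⟨y, hy, t, ht, htδ, hb⟩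
    have hy2 := hy.2
    rw [mem_ball, dist_eq_norm] at hy2 ⊢
    have n1 : ‖b - y‖ ≤ (c + ‖v‖) * t := norm_le_of_norm_sub_smul_le ht.le (by nlinarith)
    have n2 : (c + ‖v‖) * t ≤ (c + ‖v‖) * δ := by gcongr
    rw [← sub_add_sub_cancel b y p]
    refine (norm_add_le _ _).trans_lt ?_
    linarith
  have hWc : W ⊆ roundWedge (S ∩ ball p δ) v c δ := by
    rintro b ⟨y, hy, t, ht, htδ, hb⟩
    exact ⟨y, hy, t, ht, htδ, by nlinarith⟩
  have hpair' : ∀ a ∈ W, ∀ b ∈ W, ‖Ξ a - Ξ b - (a - b)‖ ≤ 1 / 2 * ‖a - b‖ := by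
    have hsub : W ⊆ roundWedge (S ∩ ball p δ₁) v (c / 2) δ₁ := by
      rintro b ⟨y, hy, t, ht, htδ, hb⟩
      exact ⟨y, ⟨hy.1, ball_subset_ball hδ1 hy.2⟩, t, ht, htδ.trans_le hδ1, hb⟩
    intro a ha b hb
    exact hpair a (hsub ha) b (hsub hb)
  have hlip : ∀ a ∈ W, ∀ b ∈ W, ‖a - b‖ ≤ 2 * ‖Ξ a - Ξ b‖ := by
    intro a ha b hb
    have h2 := hpair' a ha b hb
    have h3 := norm_sub_le (Ξ a - Ξ b) (Ξ a - Ξ b - (a - b))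
    rw [sub_sub_cancel] at h3
    linarith
  have hlip' : ∀ x ∈ S ∩ ball p δ, ∀ b ∈ W, ‖b - x‖ ≤ 2 * ‖Ξ b - u x‖ := by
    intro x hx b hb
    have hδδ : δ ≤ δ₂ := by
      have : 0 ≤ (c + ‖v‖) * δ := by positivity
      linarith
    have h2 := (hedge x ⟨hx.1, ball_subset_ball hδδ hx.2⟩ (S ∩ ball p δ) inter_subset_left δ b
      ⟨hWc hb, hWδ hb⟩).2
    have h3 := norm_sub_le (Ξ b - u x) (Ξ b - u x - (b - x))
    rw [sub_sub_cancel] at h3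
    simp only [ContinuousLinearMap.id_apply] at h2
    linarith
  have hinj : InjOn Ξ W := by
    intro a ha b hb hab
    have := hlip a ha b hb
    rw [hab, sub_self, norm_zero, mul_zero] at this
    exact sub_eq_zero.1 (norm_le_zero_iff.1 this)
  -- the contraction principle on a ball whose radius is a multiple of the height
  have hsurj : ∀ x ∈ S ∩ ball p δ, ∀ (w : E) (t : ℝ), 0 < t → t < δ → ‖w - t • v‖ < c / 8 * t →
      ∃ b ∈ W, Ξ b = u x + w ∧ ‖b - x - t • v‖ < c / 2 * t := by
    intro x hx w t ht htδ hw
    have hball : ∀ b ∈ closedBall (x + w) (c / 4 * t), ‖b - x - t • v‖ < c / 2 * t := by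
      intro b hb
      rw [mem_closedBall, dist_eq_norm] at hb
      have : b - x - t • v = (b - (x + w)) + (w - t • v) := by abel
      rw [this]
      refine (norm_add_le _ _).trans_lt ?_
      nlinarith
    have hballW : closedBall (x + w) (c / 4 * t) ⊆ W := fun b hb =>
      ⟨x, hx, t, ht, htδ, hball b hb⟩
    have happ : ApproximatesLinearOn Ξ (ContinuousLinearMap.id ℂ E)
        (closedBall (x + w) (c / 4 * t)) (1 / 2) := by
      intro a ha b hb
      simpa using hpair' a (hballW ha) b (hballW hb)
    let R : (ContinuousLinearMap.id ℂ E).NonlinearRightInverse :=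
      { toFun := id, nnnorm := 1, bound' := by simp, right_inv' := by simp }
    have h2 := happ.surjOn_closedBall_of_nonlinearRightInverse R (by positivity) Subset.rfl
    have h3 : u x + w ∈ closedBall (Ξ (x + w))
        ((((R.nnnorm : ℝ≥0) : ℝ)⁻¹ - ((1 / 2 : ℝ≥0) : ℝ)) * (c / 4 * t)) := by
      have h4 := (h1 x ⟨hx.1, ball_subset_ball hδ3 hx.2⟩ w t ht (htδ.trans_le hδ3)
        (by nlinarith)).2.2
      rw [mem_closedBall, dist_eq_norm, norm_sub_rev]
      have h5 : Ξ (x + w) - (u x + w) = Ξ (x + w) - u x - w := by abel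
      rw [h5]
      have h6 : min (1 / 2) (c / 8) * t ≤ c / 8 * t := by gcongr; exact min_le_right _ _
      have h7 : ((R.nnnorm : ℝ≥0) : ℝ) = 1 := rfl
      rw [h7]
      push_cast
      simp only [ContinuousLinearMap.id_apply] at h4
      linarith
    obtain ⟨b, hb, hbq⟩ := h2 h3
    exact ⟨b, hballW hb, hbq, hball b hb⟩
  have hG : ∀ b ∈ W, Function.invFunOn Ξ W (Ξ b) = b := fun b hb =>
    hinj.leftInvOn_invFunOn hb
  set G : E → E := Function.invFunOn Ξ W with hGdef
  have hW' : ∀ q ∈ roundWedge (u '' (S ∩ ball p δ)) v (c / 8) δ, G q ∈ W ∧ Ξ (G q) = q := by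
    rintro q ⟨_, ⟨x, hx, rfl⟩, t, ht, htδ, hq⟩
    obtain ⟨b, hb, hbq, -⟩ := hsurj x hx (q - u x) t ht htδ hq
    rw [add_sub_cancel] at hbq
    have := hG b hb
    rw [hbq] at this
    rw [this]
    exact ⟨hb, hbq⟩
  have hdiff : ∀ b ∈ W, DifferentiableAt ℂ Ξ b ∧ ‖fderiv ℂ Ξ b - ContinuousLinearMap.id ℂ E‖ < 1 := by
    rintro b ⟨y, hy, t, ht, htδ, hb⟩
    have := h1 y ⟨hy.1, ball_subset_ball hδ3 hy.2⟩ (b - y) t ht (htδ.trans_le hδ3)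
      (by nlinarith)
    rw [add_sub_cancel] at this
    refine ⟨this.1, (this.2.1.trans (min_le_left _ _)).trans_lt (by norm_num)⟩
  have hderiv : ∀ q ∈ roundWedge (u '' (S ∩ ball p δ)) v (c / 8) δ, ∃ A : E ≃L[ℂ] E,
      (A : E →L[ℂ] E) = fderiv ℂ Ξ (G q) ∧ HasFDerivAt G (A.symm : E →L[ℂ] E) q := by
    intro q hq
    obtain ⟨hqW, hqΞ⟩ := hW' q hq
    obtain ⟨hd, hn⟩ := hdiff _ hqW
    obtain ⟨A, hA⟩ := exists_equiv_of_norm_sub_id_lt hn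
    have hnhds := (isOpen_roundWedge (u '' (S ∩ ball p δ)) v (c / 8) δ).mem_nhds hq
    refine ⟨A, hA, HasFDerivAt.of_local_left_inverse (f := Ξ) ?_ ?_ ?_⟩
    · refine tendsto_of_norm_sub_le_mul (C := 2) (g := id) (y := q) ?_ tendsto_id
      filter_upwards [hnhds] with q' hq'
      have := hlip _ (hW' q' hq').1 _ hqW
      rwa [(hW' q' hq').2, hqΞ] at this
    · rw [hA]; exact hd.hasFDerivAt
    · filter_upwards [hnhds] with q' hq' using (hW' q' hq').2
  refine ⟨G, c / 8, by positivity, δ, hδ, by linarith, hδr, ?_, ?_, ?_⟩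
  · intro x hx w t ht htδ hw
    obtain ⟨b, hb, hbq, hbx⟩ := hsurj x hx w t ht htδ hw
    rw [← hbq, hG b hb]
    nlinarith
  · intro q hq
    obtain ⟨A, -, h2⟩ := hderiv q hq
    exact ⟨A.symm, h2⟩
  · intro x hx
    have hxC := hΞ x ⟨hx.1, ball_subset_ball hδr hx.2⟩
    -- `L x` and the identity are both close to the differential at a point of the wedge
    obtain ⟨A, hA⟩ : ∃ A : E ≃L[ℂ] E, (A : E →L[ℂ] E) = L x := by
      apply exists_equiv_of_norm_sub_id_lt
      obtain ⟨δ₄, hδ₄, h4, -⟩ := hxC (1 / 4) (by norm_num)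
      have ht : 0 < min δ₃ δ₄ / 2 := by positivity
      have ht3 : min δ₃ δ₄ / 2 < δ₃ := by have := min_le_left δ₃ δ₄; linarith
      have ht4 : min δ₃ δ₄ / 2 < δ₄ := by have := min_le_right δ₃ δ₄; linarith
      have hz : ‖(min δ₃ δ₄ / 2) • v - (min δ₃ δ₄ / 2) • v‖ ≤ c * (min δ₃ δ₄ / 2) := by
        rw [sub_self, norm_zero]; positivity
      have e1 := (h1 x ⟨hx.1, ball_subset_ball hδ3 hx.2⟩ _ _ ht ht3 hz).2.1
      have e2 := (h4 x ⟨hx.1, mem_ball_self hδ₄⟩ _ _ ht ht4 hz).2.1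
      rw [norm_sub_rev] at e2
      have e3 := norm_add_le_of_le e2 (e1.trans (min_le_left _ _))
      rw [sub_add_sub_cancel] at e3
      exact e3.trans_lt (by norm_num)
    have hGb : ∀ q ∈ roundWedge (u '' (S ∩ ball p δ)) v (c / 8) δ, ‖G q - x‖ ≤ 2 * ‖q - u x‖ := by
      intro q hq
      have := hlip' x hx _ (hW' q hq).1
      rwa [(hW' q hq).2] at this
    have hGt : Tendsto G (𝓝[roundWedge (u '' (S ∩ ball p δ)) v (c / 8) δ] (u x)) (𝓝 x) :=
      tendsto_of_norm_sub_le_mul (C := 2) (g := id) (y := u x)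
        (eventually_nhdsWithin_of_forall hGb) (tendsto_id.mono_left nhdsWithin_le_nhds)
    have hsmall : ∀ η > 0, ∀ᶠ q in 𝓝[roundWedge (u '' (S ∩ ball p δ)) v (c / 8) δ] (u x),
        ‖fderiv ℂ Ξ (G q) - L x‖ ≤ η ∧ ‖q - u x - L x (G q - x)‖ ≤ η * ‖G q - x‖ := by
      intro η hη
      obtain ⟨δ₄, hδ₄, h4⟩ := hxC.exists_approx_edge hc hK hheight hη
      filter_upwards [hGt (ball_mem_nhds x hδ₄), self_mem_nhdsWithin] with q hq1 hq2
      have := h4 x ⟨hx.1, mem_ball_self hδ₄⟩ (S ∩ ball p δ) inter_subset_left δ (G q)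
        ⟨hWc (hW' q hq2).1, hq1⟩
      rwa [(hW' q hq2).2] at this
    refine ⟨A.symm, hGt, ?_, ?_⟩
    · rw [Asymptotics.isLittleO_iff]
      intro η hη
      have hη' : 0 < η / (2 * (‖(A.symm : E →L[ℂ] E)‖ + 1)) := by positivity
      filter_upwards [hsmall _ hη', self_mem_nhdsWithin] with q hq hq2
      have e : G q - x - A.symm (q - u x) =
          -(A.symm : E →L[ℂ] E) (q - u x - L x (G q - x)) := by
        rw [← hA, map_sub]
        simp
      rw [e, norm_neg]
      calc _ ≤ ‖(A.symm : E →L[ℂ] E)‖ * ‖q - u x - L x (G q - x)‖ :=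
            ContinuousLinearMap.le_opNorm _ _
        _ ≤ (‖(A.symm : E →L[ℂ] E)‖ + 1) *
              (η / (2 * (‖(A.symm : E →L[ℂ] E)‖ + 1)) * (2 * ‖q - u x‖)) := by
            gcongr
            · linarith
            · exact hq.2.trans (by gcongr; exact hGb q hq2)
        _ = η * ‖q - u x‖ := by field_simp
    · have hinv : ContinuousAt ContinuousLinearMap.inverse (A : E →L[ℂ] E) :=
        (contDiffAt_map_inverse (n := 0) A).continuousAt
      have hder : Tendsto (fun q => fderiv ℂ Ξ (G q))
          (𝓝[roundWedge (u '' (S ∩ ball p δ)) v (c / 8) δ] (u x)) (𝓝 (A : E →L[ℂ] E)) := by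
        rw [hA, tendsto_iff_norm_sub_tendsto_zero, Metric.tendsto_nhds]
        intro η hη
        filter_upwards [hsmall (η / 2) (by positivity)] with q hq
        rw [dist_zero_right, norm_norm]
        linarith [hq.1]
      have := hinv.tendsto.comp hder
      rw [ContinuousLinearMap.inverse_equiv] at this
      refine this.congr' ?_
      filter_upwards [self_mem_nhdsWithin] with q hq
      obtain ⟨B, hB, hBd⟩ := hderiv q hq
      rw [Function.comp_apply, ← hB, ContinuousLinearMap.inverse_equiv, hBd.fderiv]

end Inversion

/-! ### Operations on maps which are regular up to the edge -/

section Operations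

variable {E V G G' : Type*} [NormedAddCommGroup E] [NormedSpace ℂ E] [NormedAddCommGroup V]
  [NormedSpace ℂ V] [NormedAddCommGroup G] [NormedSpace ℂ G] [NormedAddCommGroup G']
  [NormedSpace ℂ G']

theorem ContinuousLinearMap.isC1AtEdge (L : E →L[ℂ] G) (S : Set E) (x a : E) (c : ℝ) :
    IsC1AtEdge L L L S x a c := by
  intro η hη
  refine ⟨1, one_pos, fun y _ w t ht _ _ => ⟨L.differentiableAt, ?_, ?_⟩, fun y _ y' _ => ?_⟩
  · rw [L.fderiv, sub_self, norm_zero]; exact hη.le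
  · rw [map_add, add_sub_cancel_left, sub_self, norm_zero]; positivity
  · rw [map_sub, sub_self, norm_zero]; positivity

theorem IsC1AtEdge.add {F F' u u' : E → G} {L L' : E →L[ℂ] G} {S : Set E} {x a : E} {c : ℝ}
    (h : IsC1AtEdge F u L S x a c) (h' : IsC1AtEdge F' u' L' S x a c) :
    IsC1AtEdge (fun q => F q + F' q) (fun q => u q + u' q) (L + L') S x a c := by
  intro η hη
  obtain ⟨δ, hδ, h1, h2⟩ := h (η / 2) (by positivity)
  obtain ⟨δ', hδ', h1', h2'⟩ := h' (η / 2) (by positivity)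
  have hb : ∀ y ∈ S ∩ ball x (min δ δ'), y ∈ S ∩ ball x δ ∧ y ∈ S ∩ ball x δ' := fun y hy =>
    ⟨⟨hy.1, ball_subset_ball (min_le_left _ _) hy.2⟩,
      ⟨hy.1, ball_subset_ball (min_le_right _ _) hy.2⟩⟩
  refine ⟨min δ δ', by positivity, fun y hy w t ht htδ hw => ?_, fun y hy y' hy' => ?_⟩
  · obtain ⟨d, e, f⟩ := h1 y (hb y hy).1 w t ht (htδ.trans_le (min_le_left _ _)) hw
    obtain ⟨d', e', f'⟩ := h1' y (hb y hy).2 w t ht (htδ.trans_le (min_le_right _ _)) hw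
    refine ⟨d.add d', ?_, ?_⟩
    · rw [fderiv_fun_add d d', add_sub_add_comm]
      exact (norm_add_le_of_le e e').trans (by linarith)
    · have : F (y + w) + F' (y + w) - (u y + u' y) - (L + L') w =
          (F (y + w) - u y - L w) + (F' (y + w) - u' y - L' w) := by
        rw [_root_.add_apply]; abel
      rw [this]
      exact (norm_add_le_of_le f f').trans (by linarith)
  · have : u y + u' y - (u y' + u' y') - (L + L') (y - y') =
        (u y - u y' - L (y - y')) + (u' y - u' y' - L' (y - y')) := by
      rw [_root_.add_apply]; abel
    rw [this]
    exact (norm_add_le_of_le (h2 y (hb y hy).1 y' (hb y' hy').1)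
      (h2' y (hb y hy).2 y' (hb y' hy').2)).trans (by linarith)

theorem IsC1AtEdge.sum {ι : Type*} {F u : ι → E → G} {L : ι → E →L[ℂ] G} {S : Set E} {x a : E}
    {c : ℝ} (s : Finset ι) (h : ∀ i ∈ s, IsC1AtEdge (F i) (u i) (L i) S x a c) :
    IsC1AtEdge (fun q => ∑ i ∈ s, F i q) (fun q => ∑ i ∈ s, u i q) (∑ i ∈ s, L i) S x a c := by
  classical
  induction s using Finset.induction_on with
  | empty =>
    simp only [Finset.sum_empty]
    exact (0 : E →L[ℂ] G).isC1AtEdge S x a c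
  | insert i s hi ih =>
    simp only [Finset.sum_insert hi]
    exact (h i (Finset.mem_insert_self _ _)).add
      (ih fun j hj => h j (Finset.mem_insert_of_mem hj))

theorem IsC1AtEdge.clm_comp {F u : E → G} {L : E →L[ℂ] G} {S : Set E} {x a : E} {c : ℝ}
    (h : IsC1AtEdge F u L S x a c) (T : G →L[ℂ] G') :
    IsC1AtEdge (fun q => T (F q)) (fun q => T (u q)) (T ∘L L) S x a c := by
  intro η hη
  have hT : ∀ r : ℝ, 0 ≤ r → ‖T‖ * (η / (‖T‖ + 1) * r) ≤ η * r := by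
    intro r hr
    rw [← mul_assoc]
    refine mul_le_mul_of_nonneg_right ?_ hr
    rw [mul_div_assoc', div_le_iff₀ (by positivity)]
    nlinarith [norm_nonneg T]
  obtain ⟨δ, hδ, h1, h2⟩ := h (η / (‖T‖ + 1)) (by positivity)
  refine ⟨δ, hδ, fun y hy w t ht htδ hw => ?_, fun y hy y' hy' => ?_⟩
  · obtain ⟨d, e, f⟩ := h1 y hy w t ht htδ hw
    refine ⟨T.differentiableAt.comp _ d, ?_, ?_⟩
    · have : fderiv ℂ (fun q => T (F q)) (y + w) = T ∘L fderiv ℂ F (y + w) :=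
        (T.hasFDerivAt.comp _ d.hasFDerivAt).fderiv
      rw [this, ← ContinuousLinearMap.comp_sub]
      refine (ContinuousLinearMap.opNorm_comp_le _ _).trans ?_
      have := hT 1 zero_le_one
      rw [mul_one, mul_one] at this
      exact (mul_le_mul_of_nonneg_left e (norm_nonneg _)).trans this
    · have : T (F (y + w)) - T (u y) - (T ∘L L) w = T (F (y + w) - u y - L w) := by
        simp only [map_sub, ContinuousLinearMap.comp_apply]
      rw [this]
      exact (T.le_opNorm _).trans ((mul_le_mul_of_nonneg_left f (norm_nonneg _)).trans (hT t ht.le))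
  · have : T (u y) - T (u y') - (T ∘L L) (y - y') = T (u y - u y' - L (y - y')) := by
      simp only [map_sub, ContinuousLinearMap.comp_apply]
    rw [this]
    exact (T.le_opNorm _).trans ((mul_le_mul_of_nonneg_left (h2 y hy y' hy') (norm_nonneg _)).trans
      (hT _ (norm_nonneg _)))

theorem norm_map_sub_smul_le (B : E →L[ℂ] V) {w a : E} {t c c' : ℝ} (ht : 0 ≤ t)
    (hw : ‖w - t • a‖ ≤ c' * t) (hc : ‖B‖ * c' ≤ c) : ‖B w - t • B a‖ ≤ c * t := by
  have : B w - t • B a = B (w - t • a) := by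
    rw [map_sub, ← Complex.coe_smul, ← Complex.coe_smul, map_smul]
  rw [this]
  calc ‖B (w - t • a)‖ ≤ ‖B‖ * (c' * t) :=
        (B.le_opNorm _).trans (mul_le_mul_of_nonneg_left hw (norm_nonneg _))
    _ = ‖B‖ * c' * t := by ring
    _ ≤ c * t := by gcongr

theorem IsC1AtEdge.comp_clm {F u : V → G} {L : V →L[ℂ] G} {M : Set V} {S : Set E} {x a : E}
    {c c' : ℝ} (B : E →L[ℂ] V) (h : IsC1AtEdge F u L M (B x) (B a) c) (hB : MapsTo B S M)
    (hc : ‖B‖ * c' ≤ c) :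
    IsC1AtEdge (fun q => F (B q)) (fun q => u (B q)) (L ∘L B) S x a c' := by
  intro η hη
  have hT : ∀ r : ℝ, 0 ≤ r → η / (‖B‖ + 1) * (‖B‖ * r) ≤ η * r := by
    intro r hr
    rw [← mul_assoc]
    refine mul_le_mul_of_nonneg_right ?_ hr
    rw [div_mul_eq_mul_div, div_le_iff₀ (by positivity)]
    nlinarith [norm_nonneg B]
  have hη1 : η / (‖B‖ + 1) ≤ η := div_le_self hη.le (by linarith [norm_nonneg B])
  obtain ⟨δ, hδ, h1, h2⟩ := h (η / (‖B‖ + 1)) (by positivity)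
  have hδ1 : δ / (‖B‖ + 1) ≤ δ := div_le_self hδ.le (by linarith [norm_nonneg B])
  have hb : ∀ y ∈ S ∩ ball x (δ / (‖B‖ + 1)), B y ∈ M ∩ ball (B x) δ := by
    rintro y ⟨hyS, hy⟩
    refine ⟨hB hyS, ?_⟩
    rw [mem_ball, dist_eq_norm] at hy ⊢
    rw [lt_div_iff₀ (by positivity)] at hy
    rw [← map_sub]
    refine (B.le_opNorm _).trans_lt ?_
    nlinarith [norm_nonneg (y - x)]
  refine ⟨δ / (‖B‖ + 1), by positivity, fun y hy w t ht htδ hw => ?_, fun y hy y' hy' => ?_⟩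
  · obtain ⟨d, e, f⟩ := h1 (B y) (hb y hy) (B w) t ht (htδ.trans_le hδ1)
      (norm_map_sub_smul_le B ht.le hw hc)
    rw [← map_add] at d e f
    refine ⟨d.comp (y + w) B.differentiableAt, ?_, f.trans (by gcongr)⟩
    have : fderiv ℂ (fun q => F (B q)) (y + w) = fderiv ℂ F (B (y + w)) ∘L B :=
      (d.hasFDerivAt.comp _ B.hasFDerivAt).fderiv
    rw [this, ← ContinuousLinearMap.sub_comp]
    refine (ContinuousLinearMap.opNorm_comp_le _ _).trans ?_
    have := hT 1 zero_le_one
    rw [mul_one, mul_one] at this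
    exact (mul_le_mul_of_nonneg_right e (norm_nonneg _)).trans this
  · have := h2 _ (hb y hy) _ (hb y' hy')
    rw [← map_sub] at this
    refine this.trans (le_trans ?_ (hT _ (norm_nonneg _)))
    exact mul_le_mul_of_nonneg_left (B.le_opNorm _) (by positivity)

end Operations

/-! ### The wedge attached to a graph -/

theorem isOpen_wedge {E : Type*} [NormedAddCommGroup E] [NormedSpace ℝ E] (M : Set E) (p : E)
    {Γ : Set E} (hΓ : IsOpen Γ) (ε : ℝ) : IsOpen (wedge M p Γ ε) :=
  (hΓ.inter isOpen_ball).add_left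

theorem ExtendsToWedge.exists_isC1AtEdge {V G : Type*} [NormedAddCommGroup V] [NormedSpace ℂ V]
    [FiniteDimensional ℂ V] [NormedAddCommGroup G] [NormedSpace ℂ G]
    {α : ℝ≥0} (hα : 0 < α) (hα1 : α < 1) {m : ℕ}
    {M : Set V} (hM : IsSubmanifold α m M) (hgen : IsGeneric M) {p : V} {u F : V → G} {Γ : Set V}
    {ε : ℝ} (hu : IsHolderClassOn 1 α u (M ∩ ball p ε)) (hΓ : IsOpenCone Γ)
    (hF : ExtendsToWedge F u M p Γ ε) {a : V} {c : ℝ} (hc : 0 < c) (hac : closedBall a c ⊆ Γ)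
    {x : V} (hx : x ∈ M ∩ ball p ε) : ∃ L, IsC1AtEdge F u L M x a c := by
  obtain ⟨U, hU, hxU, g, hg, hgu⟩ := hu x hx
  obtain ⟨ε', hε', hsub⟩ := exists_ball_subset_ball hx.2
  have hb : ∀ y ∈ M ∩ ball x (min ε' ε), y ∈ M ∩ ball p ε := fun y hy =>
    ⟨hy.1, hsub (ball_subset_ball (min_le_left _ _) hy.2)⟩
  have hε : 0 < ε := pos_of_mem_ball hx.2
  refine hM.exists_isC1AtEdge hα hα1 hx.1 (hgen x hx.1) (hU.inter isOpen_ball) ⟨hxU, hx.2⟩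
    (g := g) ⟨hg.1.mono inter_subset_left, fun y hy => hg.2 y hy.1⟩ ?_ hΓ
    (isOpen_wedge M p hΓ.1 ε) hF.1 (ε := min ε' ε) (by positivity) ?_ ?_ hc hac
  · intro y hy
    exact hgu ⟨⟨hy.1, hy.2.2⟩, hy.2.1⟩
  · intro y hy w hw hwε
    exact Set.add_mem_add (hb y hy) ⟨hw, by
      rw [mem_ball_zero_iff]; exact hwε.trans_le (min_le_right _ _)⟩
  · intro y hy
    exact hF.2 y (hb y hy)

/-- If `h` is strictly differentiable along `M` at `p` with a complex linear differential `l`,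
then the complex span of the tangent space to its graph contains the graph of `l` over the complex
span of the tangent space to `M`. -/
theorem mem_complexTangentSpan_graphOver {V G : Type*} [NormedAddCommGroup V] [NormedSpace ℂ V]
    [NormedAddCommGroup G] [NormedSpace ℂ G] {M : Set V} {h : V → G} {p : V}
    {l : V →L[ℂ] G} (hl : HasFDerivWithinAt h (l.restrictScalars ℝ) M p) {w : V}
    (hw : w ∈ complexTangentSpan M p) :
    (w, l w) ∈ complexTangentSpan (graphOver h M) (p, h p) := by
  have hle : complexTangentSpan M p ≤
      (complexTangentSpan (graphOver h M) (p, h p)).comap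
        ((LinearMap.id : V →ₗ[ℂ] V).prod (l : V →ₗ[ℂ] G)) := by
    refine Submodule.span_le.2 ?_
    rintro w ⟨γ, hγ0, hγM, hγ⟩
    refine Submodule.subset_span ⟨fun t => (γ t, h (γ t)), by simp [hγ0], ?_, ?_⟩
    · filter_upwards [hγM] with t ht using ⟨ht, rfl⟩
    · refine hγ.prodMk ?_
      have h1 : HasDerivWithinAt γ w {t | γ t ∈ M} 0 := hγ.hasDerivWithinAt
      have h2 : HasFDerivWithinAt h (l.restrictScalars ℝ) M (γ 0) := by rwa [hγ0]
      have h3 := h2.comp_hasDerivWithinAt 0 h1 (fun t ht => ht)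
      exact h3.hasDerivAt hγM
  exact hle hw


theorem IsC1AtEdge.hasFDerivWithinAt {E G : Type*} [NormedAddCommGroup E] [NormedSpace ℂ E]
    [NormedAddCommGroup G] [NormedSpace ℂ G] {F u : E → G} {L : E →L[ℂ] G} {S : Set E} {x a : E}
    {c : ℝ} (h : IsC1AtEdge F u L S x a c) (hx : x ∈ S) : HasFDerivWithinAt u L S x := by
  rw [hasFDerivWithinAt_iff_isLittleO, Asymptotics.isLittleO_iff]
  intro η hη
  obtain ⟨δ, hδ, -, h2⟩ := h η hη
  filter_upwards [inter_mem_nhdsWithin S (ball_mem_nhds x hδ)] with y hy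
  exact h2 y hy x ⟨hx, mem_ball_self hδ⟩

section Graph

variable {V H : Type*} [NormedAddCommGroup V] [NormedSpace ℂ V] [NormedAddCommGroup H]
  [NormedSpace ℂ H]

/-- The linear function on `V × H` which vanishes exactly on the graph of `l`. -/
noncomputable def graphDefect (l : V →L[ℂ] H) : V × H →L[ℂ] H :=
  ContinuousLinearMap.snd ℂ V H - l ∘L ContinuousLinearMap.fst ℂ V H

theorem graphDefect_apply (l : V →L[ℂ] H) (q : V × H) : graphDefect l q = q.2 - l q.1 := rfl

/-- The linear map `V × H → V` which restricts to the first projection on the graph of `l` and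
takes the value `b` at `v`, provided that `μ` takes the value one at `v.2 - l v.1`. It pulls back
a wedge of direction `b` in `V` to a wedge of direction `v`. -/
noncomputable def shearToward (l : V →L[ℂ] H) (μ : H →L[ℂ] ℂ) (v : V × H) (b : V) : V × H →L[ℂ] V :=
  ContinuousLinearMap.fst ℂ V H + (μ ∘L graphDefect l).smulRight (b - v.1)

theorem shearToward_apply (l : V →L[ℂ] H) (μ : H →L[ℂ] ℂ) (v : V × H) (b : V) (q : V × H) :
    shearToward l μ v b q = q.1 + μ (graphDefect l q) • (b - v.1) := rfl

theorem shearToward_of_graphDefect_eq_zero (l : V →L[ℂ] H) (μ : H →L[ℂ] ℂ) (v : V × H) (b : V)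
    {q : V × H} (hq : graphDefect l q = 0) : shearToward l μ v b q = q.1 := by
  rw [shearToward_apply, hq, map_zero, zero_smul, add_zero]

theorem shearToward_self {l : V →L[ℂ] H} {μ : H →L[ℂ] ℂ} {v : V × H}
    (hμ : μ (graphDefect l v) = 1) (b : V) : shearToward l μ v b v = b := by
  rw [shearToward_apply, hμ, one_smul, add_sub_cancel]

/-- Near a point of the graph of a decomposable map `h`, for a complex transversal direction `v`,
there is an invertible holomorphic map `G` on a wedge of direction `v`, of class `C^1` up to the
edge, which takes the graph of `h` to the graph of a linear map. It is the inverse of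
`(z, w) ↦ (z, w + ∑ i, F i (B i (z, w)) - R (z, w))`, where `F i` are the holomorphic extensions of
the summands of `h`, the linear map `B i` tilts the direction `v` into the wedge of `F i`, and the
linear term `R` makes the differential at the reference point the identity. -/
theorem exists_inverse_on_wedge_graphOver [FiniteDimensional ℂ V] [FiniteDimensional ℂ H]
    {α : ℝ≥0} (hα : 0 < α) (hα1 : α < 1) {m : ℕ} {M : Set V} (hM : IsSubmanifold α m M)
    (hgen : IsGeneric M) {h : V → H} {p : V} (hp : p ∈ M) (hdec : IsDecomposableAt 1 α h M p)
    {v : V × H} (hv : IsComplexTransversal v (graphOver h M) (p, h p)) :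
    ∃ l : V →L[ℂ] H, graphDefect l v ≠ 0 ∧ ∀ c₀ > 0, ∃ Γ : Set (V × H), IsOpenCone Γ ∧ v ∈ Γ ∧
      ∃ ε > 0, ε ≤ c₀ ∧ ∃ G : V × H → V × H,
        (∀ x ∈ M ∩ ball p ε, ∀ w ∈ Γ, ‖w‖ < ε → ∃ t, 0 < t ∧ t < c₀ ∧
          ‖G ((x, h x) + w) - (x, l x) - t • v‖ < c₀ * t) ∧
        (∀ q ∈ wedge (graphOver h M) (p, h p) Γ ε, ∃ A : (V × H) ≃L[ℂ] (V × H),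
          HasFDerivAt G (A : V × H →L[ℂ] V × H) q) ∧
        ∀ x ∈ M ∩ ball p ε, ∃ A : (V × H) ≃L[ℂ] (V × H),
          Tendsto G (𝓝[wedge (graphOver h M) (p, h p) Γ ε] (x, h x)) (𝓝 (x, l x)) ∧
          ((fun q => G q - (x, l x) - A (q - (x, h x)))
            =o[𝓝[wedge (graphOver h M) (p, h p) Γ ε] (x, h x)] fun q => q - (x, h x)) ∧
          Tendsto (fderiv ℂ G) (𝓝[wedge (graphOver h M) (p, h p) Γ ε] (x, h x))
            (𝓝 (A : V × H →L[ℂ] V × H)) := by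
  obtain ⟨ε₀, hε₀, k, U, hsum, hU⟩ := hdec
  choose hUreg Γ₀ hΓ₀ hΓne F hF using hU
  choose b hb using hΓne
  have hball : ∀ i, ∃ c > 0, closedBall (b i) c ⊆ Γ₀ i := fun i =>
    nhds_basis_closedBall.mem_iff.1 ((hΓ₀ i).1.mem_nhds (hb i))
  choose c hc hcΓ using hball
  have hL : ∀ i, ∀ x ∈ M ∩ ball p ε₀, ∃ L, IsC1AtEdge (F i) (U i) L M x (b i) (c i) :=
    fun i x hx => (hF i).exists_isC1AtEdge hα hα1 hM hgen (hUreg i) (hΓ₀ i) (hc i) (hcΓ i) hx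
  choose! L hL using hL
  set l : V →L[ℂ] H := ∑ i, L i p with hl
  have hpε : p ∈ M ∩ ball p ε₀ := ⟨hp, mem_ball_self hε₀⟩
  have hder : HasFDerivWithinAt h l M p := by
    have h1 : HasFDerivWithinAt (fun x => ∑ i, U i x) l M p :=
      HasFDerivWithinAt.fun_sum fun i _ => (hL i p hpε).hasFDerivWithinAt hp
    refine h1.congr_of_eventuallyEq ?_ (hsum p hpε)
    filter_upwards [inter_mem_nhdsWithin M (ball_mem_nhds p hε₀)] with x hx using hsum x hx
  -- otherwise `v` would be in the graph of `l`, which is in the complex tangent span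
  have hπv : graphDefect l v ≠ 0 := by
    intro h0
    rw [graphDefect_apply, sub_eq_zero] at h0
    apply hv
    have := mem_complexTangentSpan_graphOver (hder.restrictScalars ℝ)
      (w := v.1) (by rw [hgen p hp]; trivial)
    rwa [← h0] at this
  refine ⟨l, hπv, fun c₀ hc₀ => ?_⟩
  obtain ⟨μ, hμ⟩ := SeparatingDual.exists_eq_one (R := ℂ) hπv
  set π : V × H →L[ℂ] H := graphDefect l with hπ
  set B : Fin k → V × H →L[ℂ] V := fun i => shearToward l μ v (b i) with hB
  set R : V × H →L[ℂ] H := l ∘L ContinuousLinearMap.fst ℂ V H +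
    (μ ∘L π).smulRight (∑ i, L i p (b i - v.1)) with hR
  obtain ⟨s, hs, hs1, hs2, hs3⟩ : ∃ s > 0, (∀ i, ‖B i‖ * s ≤ c i) ∧ ‖π‖ * s ≤ ‖π v‖ / 2 ∧
      1 * s ≤ c₀ := by
    have := ((((eventually_all.2 fun i => eventually_mul_le_const ‖B i‖ (hc i)).and
      (eventually_mul_le_const ‖π‖ (half_pos (norm_pos_iff.2 hπv)))).and
      (eventually_mul_le_const 1 hc₀))).and self_mem_nhdsWithin
    obtain ⟨s, ⟨⟨h1, h2⟩, h3⟩, h4⟩ := this.exists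
    exact ⟨s, h4, h1, h2, h3⟩
  rw [one_mul] at hs3
  set S : Set (V × H) := {q | q.1 ∈ M ∧ π q = 0} with hS
  have hSl : ∀ x ∈ M, (x, l x) ∈ S := fun x hx => ⟨hx, by simp [hπ, graphDefect_apply]⟩
  set Ξ : V × H → V × H := fun q => ContinuousLinearMap.id ℂ (V × H) q +
    ContinuousLinearMap.inr ℂ V H (∑ i, F i (B i q) + (-R) q) with hΞdef
  set u : V × H → V × H := fun q => ContinuousLinearMap.id ℂ (V × H) q +
    ContinuousLinearMap.inr ℂ V H (∑ i, U i (B i q) + (-R) q) with hudef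
  have hBS : ∀ i, ∀ q ∈ S, B i q = q.1 := fun i q hq =>
    shearToward_of_graphDefect_eq_zero l μ v (b i) hq.2
  have hux : ∀ x ∈ M ∩ ball p ε₀, u (x, l x) = (x, h x) := by
    intro x hx
    have h1 : ∀ i, B i (x, l x) = x := fun i => hBS i _ (hSl x hx.1)
    have h2 : R (x, l x) = l x := by
      simp [hR, (hSl x hx.1).2]
    simp only [hudef, h1, ← hsum x hx, _root_.neg_apply, h2]
    simp
  have hheight : ∀ x ∈ S, ∀ y ∈ S, ∀ (w : V × H) (t : ℝ), 0 < t → ‖w - t • v‖ ≤ s * t →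
      t ≤ 2 / ‖π v‖ * ‖π‖ * ‖y + w - x‖ := by
    intro x hx y hy w t ht hw
    have h1 : ‖π w - t • π v‖ ≤ ‖π v‖ / 2 * t := norm_map_sub_smul_le π ht.le hw hs2
    have h2 : π (y + w - x) = π w := by rw [map_sub, map_add, hx.2, hy.2]; simp
    have h3 : ‖t • π v‖ ≤ ‖π w‖ + ‖π w - t • π v‖ := by
      have := norm_sub_le (π w) (π w - t • π v)
      rwa [sub_sub_cancel] at this
    rw [norm_smul, Real.norm_eq_abs, abs_of_pos ht] at h3
    have h4 := π.le_opNorm (y + w - x)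
    rw [h2] at h4
    have h5 : 0 < ‖π v‖ := norm_pos_iff.2 hπv
    rw [mul_assoc, div_mul_eq_mul_div, le_div_iff₀ h5]
    linarith
  have hK : 0 ≤ 2 / ‖π v‖ * ‖π‖ := by positivity
  set K : ℝ := 2 / ‖π v‖ * ‖π‖ with hKdef
  have hΞ : ∀ x ∈ S ∩ ball (p, l p) (min ε₀ c₀), IsC1AtEdge Ξ u
      (ContinuousLinearMap.id ℂ (V × H) + ContinuousLinearMap.inr ℂ V H ∘L
        (∑ i, L i x.1 ∘L B i + -R)) S x v s := by
    rintro x ⟨hxS, hx⟩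
    have hx1 : x.1 ∈ M ∩ ball p ε₀ := by
      refine ⟨hxS.1, ?_⟩
      rw [mem_ball, Prod.dist_eq, max_lt_iff] at hx
      exact hx.1.trans_le (min_le_left _ _)
    refine ((ContinuousLinearMap.id ℂ (V × H)).isC1AtEdge S x v s).add
      (((IsC1AtEdge.sum Finset.univ fun i _ => ?_).add ((-R).isC1AtEdge S x v s)).clm_comp
        (ContinuousLinearMap.inr ℂ V H))
    refine IsC1AtEdge.comp_clm (M := M) (c := c i) (B i) ?_ (fun q hq => ?_) (hs1 i)
    · rw [hBS i x hxS, hB, shearToward_self hμ]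
      exact hL i _ hx1
    · rw [hBS i q hq]; exact hq.1
  have hLp : ContinuousLinearMap.id ℂ (V × H) + ContinuousLinearMap.inr ℂ V H ∘L
        (∑ i, L i (p, l p).1 ∘L B i + -R) = ContinuousLinearMap.id ℂ (V × H) := by
    have : ∑ i, L i p ∘L B i = R := by
      refine ContinuousLinearMap.ext fun q => ?_
      simp only [sum_apply, ContinuousLinearMap.comp_apply, hB, shearToward_apply, map_add,
        map_smul, Finset.sum_add_distrib, hR, hl, ContinuousLinearMap.smulRight_apply,
        Finset.smul_sum, _root_.add_apply]
      rfl
    rw [this, add_neg_cancel, ContinuousLinearMap.comp_zero, add_zero]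
  obtain ⟨G, c', hc', δ, hδ, hc's, hδr, hG1, hG2, hG3⟩ := exists_inverse_on_roundWedge hs hK
    (lt_min hε₀ hc₀) (hSl p hp) hheight hΞ hLp
  have hden : 0 < 1 + ‖l‖ + K := by positivity
  obtain ⟨ε, hε, hεε₀, hεδ⟩ : ∃ ε > 0, ε ≤ ε₀ ∧ (1 + ‖l‖ + K) * ε ≤ δ := by
    refine ⟨min ε₀ (δ / (1 + ‖l‖ + K)), by positivity, min_le_left _ _, ?_⟩
    rw [mul_comm, ← le_div_iff₀ hden]
    exact min_le_right _ _
  have hε1 : ε ≤ δ := by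
    have : 0 ≤ (‖l‖ + K) * ε := by positivity
    linarith
  have hxS : ∀ x ∈ M ∩ ball p ε, (x, l x) ∈ S ∩ ball (p, l p) δ ∧ u (x, l x) = (x, h x) := by
    rintro x ⟨hxM, hx⟩
    refine ⟨⟨hSl x hxM, ?_⟩, hux x ⟨hxM, ball_subset_ball hεε₀ hx⟩⟩
    rw [mem_ball, dist_eq_norm] at hx
    rw [mem_ball, Prod.dist_eq, max_lt_iff, dist_eq_norm, dist_eq_norm, ← map_sub]
    refine ⟨hx.trans_le hε1, (l.le_opNorm _).trans_lt ?_⟩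
    have h1 : ‖l‖ * ‖x - p‖ ≤ ‖l‖ * ε := by gcongr
    have h2 : 0 ≤ K * ε := by positivity
    linarith
  set Γ : Set (V × H) := {w | ∃ t : ℝ, 0 < t ∧ ‖w - t • v‖ < c' * t} with hΓ
  -- a small vector of the cone has small height
  have hΓt : ∀ w, ‖w‖ < ε → ∀ t : ℝ, 0 < t → ‖w - t • v‖ < c' * t → t < δ := by
    intro w hw t ht hwt
    have h1 := hheight _ (hSl p hp) _ (hSl p hp) w t ht (hwt.le.trans (by gcongr))
    rw [add_sub_cancel_left] at h1
    have h2 : K * ‖w‖ ≤ K * ε := by gcongr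
    have h3 : 0 ≤ ‖l‖ * ε := by positivity
    linarith
  have hwedge : wedge (graphOver h M) (p, h p) Γ ε ⊆
      roundWedge (u '' (S ∩ ball (p, l p) δ)) v c' δ := by
    rintro _ ⟨⟨x, y⟩, ⟨⟨hxM, hy⟩, hxy⟩, w, ⟨⟨t, ht, hwt⟩, hw⟩, rfl⟩
    obtain rfl : y = h x := hy
    rw [mem_ball, Prod.dist_eq, max_lt_iff] at hxy
    rw [mem_ball_zero_iff] at hw
    obtain ⟨h1, h2⟩ := hxS x ⟨hxM, hxy.1⟩
    refine ⟨(x, h x), ⟨_, h1, h2⟩, t, ht, hΓt w hw t ht hwt, ?_⟩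
    simpa using hwt
  refine ⟨Γ, ⟨?_, ?_⟩, ⟨1, one_pos, ?_⟩, ε, hε, hε1.trans (hδr.trans (min_le_right _ _)), G,
    ?_, fun q hq => hG2 q (hwedge hq), ?_⟩
  · have : Γ = ⋃ t ∈ Ioi (0 : ℝ), {w | ‖w - t • v‖ < c' * t} := by
      ext w
      simp only [hΓ, mem_ofPred_eq, mem_iUnion, exists_prop, mem_Ioi]
    rw [this]
    exact isOpen_biUnion fun t _ => isOpen_lt (by fun_prop) continuous_const
  · rintro w ⟨t, ht, hwt⟩ r hr
    refine ⟨r * t, mul_pos hr ht, ?_⟩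
    rw [mul_smul, ← smul_sub, norm_smul, Real.norm_eq_abs, abs_of_pos hr]
    calc r * ‖w - t • v‖ < r * (c' * t) := by gcongr
      _ = c' * (r * t) := by ring
  · rw [one_smul, sub_self, norm_zero]; positivity
  · rintro x hx w ⟨t, ht, hwt⟩ hw
    obtain ⟨h1, h2⟩ := hxS x hx
    have htδ := hΓt w hw t ht hwt
    refine ⟨t, ht, htδ.trans_le (hδr.trans (min_le_right _ _)), ?_⟩
    have := hG1 _ h1 w t ht htδ hwt
    rw [h2] at this
    exact this.trans_le (by gcongr)
  · intro x hx
    obtain ⟨h1, h2⟩ := hxS x hx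
    obtain ⟨A, hA1, hA2, hA3⟩ := hG3 _ h1
    rw [h2] at hA1 hA2 hA3
    have hmono := nhdsWithin_mono (x, h x) hwedge
    exact ⟨A, hA1.mono_left hmono, hA2.mono hmono, hA3.mono_left hmono⟩

end Graph

theorem theorem1p4 (k m n : ℕ) (hn : 0 < n) (α : ℝ≥0) (hα0 : 0 < α) (hα1 : α < 1)
    -- the generic submanifold of CR dimension `k`, the CR map `h` and its graph `N`
    (M : Set (CSpace (k + m))) (hM : IsSubmanifold α m M) (hgen : IsGeneric M)
    (h : CSpace (k + m) → CSpace n) (hreg : IsHolderClassOn 1 α h M) (hCR : IsCRMap h M)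
    (N : Set (CSpace (k + m) × CSpace n)) (hN : N = graphOver h M)
    (p : CSpace (k + m)) (hp : p ∈ M) (hdec : IsDecomposableAt 1 α h M p)
    (v : CSpace (k + m) × CSpace n) (hv : IsComplexTransversal v N (p, h p))
    -- the decomposable function on `N`
    (f : CSpace (k + m) × CSpace n → ℂ) (hf : IsHolderClassOn 0 α f N)
    (hfdec : IsDecomposableAt 0 α (fun x => f (x, h x)) M p) :
    ∃ Γ : Set (CSpace (k + m) × CSpace n), IsOpenCone Γ ∧ v ∈ Γ ∧ ∃ ε : ℝ, 0 < ε ∧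
      (∃ F : CSpace (k + m) × CSpace n → ℂ, ExtendsToWedge F f N (p, h p) Γ ε) ∧
      ∃ D : Fin n → CSpace (k + m) × CSpace n → ℂ,
        (∀ i, DifferentiableOn ℂ (D i) (wedge N (p, h p) Γ ε)) ∧
        (∀ z ∈ wedge N (p, h p) Γ ε, LinearIndependent ℂ (fun i => fderiv ℂ (D i) z)) ∧
        ∀ i, VanishesToOrderOne (D i) (wedge N (p, h p) Γ ε) (N ∩ ball (p, h p) ε) := by
  subst hN
  obtain ⟨l, hlv, hG⟩ := exists_inverse_on_wedge_graphOver hα0 hα1 hM hgen hp hdec hv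
  obtain ⟨ε₁, hε₁, K, U, hsum, hU⟩ := hfdec
  choose _ Γ₁ hΓ₁ hΓne F hF using hU
  choose b hb using hΓne
  have hball : ∀ i, ∃ c > 0, closedBall (b i) c ⊆ Γ₁ i := fun i =>
    nhds_basis_closedBall.mem_iff.1 ((hΓ₁ i).1.mem_nhds (hb i))
  choose c hc hcΓ using hball
  obtain ⟨μ, hμ⟩ := SeparatingDual.exists_eq_one (R := ℂ) hlv
  set π := graphDefect l with hπ
  have hπ0 : ∀ x, π (x, l x) = 0 := fun x => by rw [hπ, graphDefect_apply, sub_self]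
  set B : Fin K → CSpace (k + m) × CSpace n →L[ℂ] CSpace (k + m) :=
    fun i => shearToward l μ v (b i) with hB
  have hB0 : ∀ i x, B i (x, l x) = x := fun i x =>
    shearToward_of_graphDefect_eq_zero l μ v (b i) (hπ0 x)
  obtain ⟨s, hs, hs1, hs2, hs3⟩ : ∃ s > 0, (∀ i, ‖B i‖ * s ≤ c i) ∧
      (∀ i, (c i + ‖b i‖) * s ≤ ε₁) ∧ 1 * s ≤ ε₁ := by
    have := (((eventually_all.2 fun i => eventually_mul_le_const ‖B i‖ (hc i)).and
      (eventually_all.2 fun i => eventually_mul_le_const (c i + ‖b i‖) hε₁)).and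
      (eventually_mul_le_const 1 hε₁)).and self_mem_nhdsWithin
    obtain ⟨s, ⟨⟨h1, h2⟩, h3⟩, h4⟩ := this.exists
    exact ⟨s, h4, h1, h2, h3⟩
  rw [one_mul] at hs3
  obtain ⟨Γ, hΓ, hvΓ, ε, hε, hεs, G, hG1, hG2, hG3⟩ := hG s hs
  have hedge : ∀ q ∈ graphOver h M ∩ ball (p, h p) ε, ∃ x ∈ M ∩ ball p ε, q = (x, h x) := by
    rintro ⟨x, y⟩ ⟨⟨hxM, hy⟩, hq⟩
    rw [mem_ball, Prod.dist_eq, max_lt_iff] at hq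
    obtain rfl : y = h x := hy
    exact ⟨x, ⟨hxM, hq.1⟩, rfl⟩
  have hxε₁ : ∀ x ∈ M ∩ ball p ε, x ∈ M ∩ ball p ε₁ := fun x hx =>
    ⟨hx.1, ball_subset_ball (hεs.trans hs3) hx.2⟩
  have hBG : ∀ i, ∀ q ∈ wedge (graphOver h M) (p, h p) Γ ε, B i (G q) ∈ wedge M p (Γ₁ i) ε₁ := by
    rintro i _ ⟨q, hq, w, ⟨hwΓ, hw⟩, rfl⟩
    obtain ⟨x, hx, rfl⟩ := hedge q hq
    rw [mem_ball_zero_iff] at hw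
    obtain ⟨t, ht, hts, hGt⟩ := hG1 x hx w hwΓ hw
    have h1 : ‖B i (G ((x, h x) + w) - (x, l x)) - t • b i‖ ≤ c i * t := by
      have := norm_map_sub_smul_le (B i) ht.le hGt.le (hs1 i)
      rwa [hB, shearToward_self hμ] at this
    refine ⟨x, hxε₁ x hx, B i (G ((x, h x) + w) - (x, l x)), ⟨?_, ?_⟩, ?_⟩
    · exact (hΓ₁ i).mem_of_norm_sub_le (hcΓ i) ht h1
    · rw [mem_ball_zero_iff]
      refine (norm_le_of_norm_sub_smul_le ht.le h1).trans_lt (lt_of_lt_of_le ?_ (hs2 i))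
      have : 0 < c i + ‖b i‖ := add_pos_of_pos_of_nonneg (hc i) (norm_nonneg _)
      gcongr
    · change x + B i (G ((x, h x) + w) - (x, l x)) = _
      rw [map_sub, hB0, add_sub_cancel]
  have hDder : ∀ i, ∀ q ∈ wedge (graphOver h M) (p, h p) Γ ε,
      ∃ A : (CSpace (k + m) × CSpace n) ≃L[ℂ] (CSpace (k + m) × CSpace n),
        fderiv ℂ G q = A ∧ HasFDerivAt (fun q => EuclideanSpace.proj (𝕜 := ℂ) i (π (G q)))
          ((EuclideanSpace.proj (𝕜 := ℂ) i ∘L π) ∘L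
            (A : CSpace (k + m) × CSpace n →L[ℂ] CSpace (k + m) × CSpace n)) q := by
    intro i q hq
    obtain ⟨A, hA⟩ := hG2 q hq
    exact ⟨A, hA.fderiv, (EuclideanSpace.proj (𝕜 := ℂ) i ∘L π).hasFDerivAt.comp q hA⟩
  have hπsurj : ∀ y, π (0, y) = y := fun y => by
    rw [hπ, graphDefect_apply]; simp
  refine ⟨Γ, hΓ, hvΓ, ε, hε, ⟨fun q => ∑ i, F i (B i (G q)), ?_, ?_⟩,
    fun i q => EuclideanSpace.proj (𝕜 := ℂ) i (π (G q)), ?_, ?_, ?_⟩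
  · refine DifferentiableOn.fun_sum fun i _ q hq => ?_
    obtain ⟨A, hA⟩ := hG2 q hq
    have h1 := (hF i).1.differentiableAt ((isOpen_wedge M p (hΓ₁ i).1 ε₁).mem_nhds (hBG i q hq))
    exact (h1.comp q ((B i).differentiableAt.comp q hA.differentiableAt)).differentiableWithinAt
  · intro q hq
    obtain ⟨x, hx, rfl⟩ := hedge q hq
    obtain ⟨A, hGx, -, -⟩ := hG3 x hx
    rw [show f (x, h x) = ∑ i, U i x from hsum x (hxε₁ x hx)]
    refine tendsto_finsetSum _ fun i _ => ?_
    refine ((hF i).2 x (hxε₁ x hx)).comp (tendsto_nhdsWithin_iff.2 ⟨?_, ?_⟩)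
    · have := ((B i).continuous.tendsto (x, l x)).comp hGx
      rwa [hB0] at this
    · filter_upwards [self_mem_nhdsWithin] with q hq using hBG i q hq
  · intro i q hq
    obtain ⟨A, -, hA⟩ := hDder i q hq
    exact hA.differentiableAt.differentiableWithinAt
  · intro q hq
    rw [Fintype.linearIndependent_iff]
    intro g hg i
    obtain ⟨A, hA⟩ := hG2 q hq
    -- evaluate the relation at a vector mapped by `π ∘ A` to the `i`-th basis vector
    have h1 := congrArg (fun T => T (A.symm (0, EuclideanSpace.single i (1 : ℂ)))) hg
    have h2 : ∀ j, fderiv ℂ (fun q => EuclideanSpace.proj (𝕜 := ℂ) j (π (G q))) q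
        (A.symm (0, EuclideanSpace.single i (1 : ℂ))) = if j = i then 1 else 0 := by
      intro j
      have h3 : HasFDerivAt (fun q => EuclideanSpace.proj (𝕜 := ℂ) j (π (G q))) _ q :=
        (EuclideanSpace.proj (𝕜 := ℂ) j ∘L π).hasFDerivAt.comp q hA
      rw [h3.fderiv]
      simp [hπsurj]
    simpa only [_root_.sum_apply, _root_.smul_apply, h2, smul_eq_mul, mul_ite, mul_one, mul_zero,
      Finset.sum_ite_eq', Finset.mem_univ, if_true, _root_.zero_apply, Finset.sum_ite_eq] using h1
  · intro i q hq
    obtain ⟨x, hx, rfl⟩ := hedge q hq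
    obtain ⟨A, -, hA1, hA2⟩ := hG3 x hx
    set P : CSpace (k + m) × CSpace n →L[ℂ] ℂ := EuclideanSpace.proj (𝕜 := ℂ) i ∘L π with hP
    refine ⟨P ∘L A, ?_, ?_, ?_⟩
    · intro h0
      have := congrArg (fun T => T (A.symm (0, EuclideanSpace.single i (1 : ℂ)))) h0
      simp [hP, hπsurj] at this
    · refine ((P.isBigO_comp _ _).trans_isLittleO hA1).congr_left fun q => ?_
      have : P (x, l x) = 0 := by rw [hP, ContinuousLinearMap.comp_apply, hπ0, map_zero]
      rw [map_sub, map_sub, this, sub_zero]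
      rfl
    · have h1 : Tendsto (fun q => P ∘L fderiv ℂ G q)
          (𝓝[wedge (graphOver h M) (p, h p) Γ ε] (x, h x)) (𝓝 (P ∘L A)) :=
        (((ContinuousLinearMap.compL ℂ _ _ _ P).continuous.tendsto _).comp hA2)
      refine h1.congr' ?_
      filter_upwards [self_mem_nhdsWithin] with q hq
      obtain ⟨A', hA', hD⟩ := hDder i q hq
      rw [hA', hD.fderiv]
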